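/- Let $N\ge 0$ be an integer, $m_1,\dots,m_N$ non-zero real numbers and $\kappa\in\mathbb R$. On functions of $X=(X_1,\dots,X_N)\in\mathbb R^N$ consider the differential operator $$\mathcal H=-\sum_{j=1}^N\frac1{m_j}\frac{\partial^2}{\partial X_j^2}+\sum_{j=1}^N m_jX_j^2+\kappa\sum_{j<k}(\kappa m_jm_k-1)(m_j+m_k)\frac1{(X_j-X_k)^2},$$ the function $$\Phi_0(X)=\prod_{j=1}^N e^{-m_jX_j^2/2}\prod_{j<k}(X_k-X_j)^{\kappa m_jm_k}$$ (powers of negative numbers are taken with the principal branch), and the constant $$\mathcal E_0=\kappa\Big(\sum_{j=1}^N m_j\Big)^2+\sum_{j=1}^N(1-\kappa m_j^2).$$ Let $\Omega\subset\mathbb R^N$ be the set of points with pairwise distinct coordinates. (1) $\Phi_0$ is smooth on $\Omega$, and $\mathcal H\Phi_0=\mathcal E_0\Phi_0$ at every point of $\Omega$. (2) Suppose moreover that all $m_j$ are positive and that $\Phi_0\in L^2(\mathbb R^N)$. Let $T$ be the operator $\mathcal H$ in $L^2(\mathbb R^N)$ with domain consisting of all functions $\Phi_0g$, where $g\in C_c^\infty(\mathbb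 R^N)$ satisfies $m_k\partial_jg=m_j\partial_kg$ on each hyperplane $X_j=X_k$. Then $T$ is well defined, densely defined, symmetric and bounded from below by $\mathcal E_0$. Its Friedrichs extension $A$ (the restriction of $T^*$ to the part of its domain that lies in the domain of the closure of the form $u\mapsto\langle u,Tu\rangle$) is self-adjoint, is the only self-adjoint extension of $T$ whose domain is contained in the domain of that closed form, and is bounded from below by $\mathcal E_0$; and $\Phi_0$ is a ground state of $A$: it is a non-zero element of the domain of $A$ with $A\Phi_0=\mathcal E_0\Phi_0$. Moreover $A$ is an extension of $\mathcal H$ on $C_c^\infty(\Omega)$, and if $\kappa m_jm_k\ge\frac12$ for all $j\ne k$, then $A$ is also the Friedrichs extension of $\mathcal H$ on $C_c^\infty(\Omega)$. -/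

import Mathlib

open MeasureTheory Filter Topology
open scoped ContDiff LinearPMap

namespace Calogero

noncomputable section

/-- Configurations without collisions: points of `ℝ^N` with pairwise distinct coordinates. -/
def configSpace (N : ℕ) : Set (Fin N → ℝ) := {X | Function.Injective X}

/-- The partial derivative `∂f/∂X_j`. -/
def partialDeriv {N : ℕ} (j : Fin N) (f : (Fin N → ℝ) → ℂ) (X : Fin N → ℝ) : ℂ :=
  lineDeriv ℝ f X (Pi.single j 1)

/-- The differential operator
`𝓗 = -∑_j (1/m_j) ∂_j² + ∑_j m_j X_j² + κ ∑_{j<k} (κ m_j m_k - 1)(m_j + m_k) / (X_j - X_k)²`,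
acting pointwise on functions. -/
def hamiltonian {N : ℕ} (m : Fin N → ℝ) (κ : ℝ) (f : (Fin N → ℝ) → ℂ) (X : Fin N → ℝ) : ℂ :=
  -(∑ j, ((1 / m j : ℝ) : ℂ) * partialDeriv j (partialDeriv j f) X)
    + ((∑ j, m j * X j ^ 2 : ℝ) : ℂ) * f X
    + ((κ * ∑ j, ∑ k ∈ Finset.Ioi j,
        (κ * m j * m k - 1) * (m j + m k) * (1 / (X j - X k) ^ 2) : ℝ) : ℂ) * f X

/-- The function `Φ₀ = ∏_j exp (-m_j X_j² / 2) ∏_{j<k} (X_k - X_j) ^ (κ m_j m_k)`, where the powers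
of negative numbers are taken with the principal branch. -/
def groundStateFun {N : ℕ} (m : Fin N → ℝ) (κ : ℝ) (X : Fin N → ℝ) : ℂ :=
  (∏ j, ((Real.exp (-(m j * X j ^ 2 / 2)) : ℝ) : ℂ)) *
    ∏ j, ∏ k ∈ Finset.Ioi j, ((X k - X j : ℝ) : ℂ) ^ ((κ * m j * m k : ℝ) : ℂ)

/-- The constant `𝓔₀ = κ (∑_j m_j)² + ∑_j (1 - κ m_j²)`. -/
def groundEnergy {N : ℕ} (m : Fin N → ℝ) (κ : ℝ) : ℝ :=
  κ * (∑ j, m j) ^ 2 + ∑ j, (1 - κ * m j ^ 2)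

/-- The Hilbert space `L²(ℝ^N)` of complex-valued functions. -/
abbrev L2 (N : ℕ) : Type := Lp ℂ 2 (volume : Measure (Fin N → ℝ))

/-- Smooth functions with compact support in the set of collision-free configurations. -/
def testFunctions (N : ℕ) : Set ((Fin N → ℝ) → ℂ) :=
  {f | ContDiff ℝ ∞ f ∧ HasCompactSupport f ∧ tsupport f ⊆ configSpace N}

/-- The functions `Φ₀ g` with `g` smooth and compactly supported on `ℝ^N` and such that
`m_k ∂_j g = m_j ∂_k g` on each collision hyperplane `X_j = X_k`. Since
`Φ₀⁻¹ (𝓗 - 𝓔₀) (Φ₀ g)` has the singular terms `-2 κ (m_k ∂_j g - m_j ∂_k g) / (X_j - X_k)`, this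
is the condition under which it stays bounded. These functions include all `testFunctions`. -/
def initialDomain {N : ℕ} (m : Fin N → ℝ) (κ : ℝ) : Set ((Fin N → ℝ) → ℂ) :=
  {f | ∃ g : (Fin N → ℝ) → ℂ, ContDiff ℝ ∞ g ∧ HasCompactSupport g ∧
    (∀ (j k : Fin N) (X : Fin N → ℝ), X j = X k →
      (m k : ℂ) * partialDeriv j g X = (m j : ℂ) * partialDeriv k g X) ∧
    f = fun X => groundStateFun m κ X * g X}

/-- `T` is the operator in `L²` whose domain consists of (the classes of) the functions in `D`
and which acts on them by `P`. -/
def IsRealization {N : ℕ} (P : ((Fin N → ℝ) → ℂ) → (Fin N → ℝ) → ℂ)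
    (D : Set ((Fin N → ℝ) → ℂ)) (T : L2 N →ₗ.[ℂ] L2 N) : Prop :=
  (∀ u : L2 N, u ∈ T.domain ↔ ∃ f ∈ D, u =ᵐ[volume] f) ∧
  ∀ (u : T.domain) (f : (Fin N → ℝ) → ℂ), f ∈ D → (u : L2 N) =ᵐ[volume] f →
    (T u : L2 N) =ᵐ[volume] P f

section Abstract

variable {H : Type*} [NormedAddCommGroup H] [InnerProductSpace ℂ H]

/-- `T ≥ c` in the sense of quadratic forms. -/
def IsBoundedBelowBy (T : H →ₗ.[ℂ] H) (c : ℝ) : Prop :=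
  ∀ u : T.domain, c * ‖(u : H)‖ ^ 2 ≤ (inner ℂ (u : H) (T u)).re

/-- The domain of the closure of the quadratic form `u ↦ ⟪u, T u⟫` of a densely defined symmetric
operator that is bounded below: the limits of the form-Cauchy sequences in the domain of `T`. -/
def formDomain (T : H →ₗ.[ℂ] H) : Set H :=
  {u | ∃ s : ℕ → T.domain, Tendsto (fun n => (s n : H)) atTop (𝓝 u) ∧
    Tendsto (fun p : ℕ × ℕ => inner ℂ ((s p.1 - s p.2 : T.domain) : H) (T (s p.1 - s p.2)))
      atTop (𝓝 0)}

/-- `A` is the Friedrichs extension of `T`: the restriction of the adjoint of `T` to those elements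
of its domain that lie in the form domain of `T`. -/
def IsFriedrichsExtension [CompleteSpace H] (T A : H →ₗ.[ℂ] H) : Prop :=
  A ≤ T† ∧ ∀ u : H, u ∈ A.domain ↔ u ∈ T†.domain ∧ u ∈ formDomain T

/-- `ψ` is a ground state of `A`, with energy `E`: an eigenvector whose eigenvalue `E` is a lower
bound of `A`. -/
def IsGroundState (A : H →ₗ.[ℂ] H) (E : ℝ) (ψ : H) : Prop :=
  ψ ≠ 0 ∧ (∃ h : ψ ∈ A.domain, A ⟨ψ, h⟩ = (E : ℂ) • ψ) ∧ IsBoundedBelowBy A E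

end Abstract

end

end Calogero

/-! Let `L_j = ∂_j log Φ₀` (`logGrad`). Part (1) is the Riccati identity `riccati_identity`: in `-∑
(1/m_j)(L_j² + ∂_j L_j)` the three-body terms cancel because `1/((x-y)(x-z))` has vanishing cyclic
sum (`three_body_sum`), and the two-body and harmonic terms that remain cancel the potential up to
the constant `𝓔₀`. Hence, away from collisions, conjugation by `Φ₀` turns `𝓗 - 𝓔₀` into `gaugedOp`,
which is `-∑ (1/m_j)(∂_j² + 2 L_j ∂_j)`.

Since `∂_j |Φ₀|² = 2 L_j |Φ₀|²`, this is the operator of the weighted Dirichlet form `∑ (1/m_j) ∫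
|Φ₀|² conj(∂_j h) ∂_j g`. Green's formula `integral_weight_mul_gaugedOp` proves this despite the
singularities: collisions are cut out by a slowly varying function of the logarithm of the
discriminant, and the condition on `g` at the hyperplanes bounds both `gaugedOp g` and the cutoff
error, the latter with a factor `1/n`. Symmetry follows, and for positive masses so does the bound
by `𝓔₀`.

The Friedrichs extension is treated abstractly. If `V` is the form completion and `J : V → H` its
canonical map, then `J J*` is the inverse of `A + 1 - c`; self-adjointness, uniqueness and the lower
bound are read off from it.

`Φ₀` is a ground state because Green's formula also holds with `h = 1`, whose gradient vanishes, so
that `T† Φ₀ = 𝓔₀ Φ₀`; it lies in the form domain because radial cutoffs of `Φ₀` have gradient energy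
`O(1/n²)`. For the last assertion, exponents at least `1/2` make `|Φ₀|²` vanish at least linearly at
collisions, and the logarithmic cutoffs then have gradient energy `O(1/n)`
(`tendsto_integral_collisionCutoff`): the hyperplanes have zero capacity. -/

namespace Calogero

noncomputable section

/-! ### Friedrichs extensions of semibounded symmetric operators. -/

section Friedrichs

variable {H : Type*} [NormedAddCommGroup H] [InnerProductSpace ℂ H]

theorem inner_self_eq_ofReal (x : H) : inner ℂ x x = ((‖x‖ ^ 2 : ℝ) : ℂ) := by
  rw [inner_self_eq_norm_sq_to_K]; push_cast; rfl

/-- A vector space with a positive definite inner product embeds densely in a Hilbert space. -/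
theorem exists_hilbert_completion.{u} {D : Type u} [AddCommGroup D] [Module ℂ D]
    (core : InnerProductSpace.Core ℂ D) :
    ∃ (V : Type u) (_ : NormedAddCommGroup V) (_ : InnerProductSpace ℂ V) (_ : CompleteSpace V)
      (j : D →ₗ[ℂ] V), DenseRange j ∧ ∀ x y, inner ℂ (j x) (j y) = core.inner x y := by
  let : NormedAddCommGroup D := core.toNormedAddCommGroup
  let : InnerProductSpace ℂ D := InnerProductSpace.ofCore core.toCore
  refine ⟨UniformSpace.Completion D, inferInstance, inferInstance, inferInstance,
    (UniformSpace.Completion.toComplL (𝕜 := ℂ) (E := D)).toLinearMap, ?_, fun x y => ?_⟩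
  · exact UniformSpace.Completion.denseRange_coe
  · exact UniformSpace.Completion.inner_coe x y

/-- A Hilbert space `V` that completes the domain of `T` for the inner product
`⟪x, T y⟫ + (1 - c) ⟪x, y⟫`, with the canonical map to the ambient space. -/
structure FormCompletion (T : H →ₗ.[ℂ] H) (c : ℝ) (V : Type*) [NormedAddCommGroup V]
    [InnerProductSpace ℂ V] where
  /-- The embedding of the domain. -/
  emb : T.domain →ₗ[ℂ] V
  /-- The canonical map to the ambient space. -/
  proj : V →L[ℂ] H
  dense_emb : DenseRange emb
  inner_emb : ∀ x y, inner ℂ (emb x) (emb y)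
    = inner ℂ (x : H) (T y) + ((1 - c : ℝ) : ℂ) * inner ℂ (x : H) (y : H)
  proj_emb : ∀ x, proj (emb x) = x
  norm_proj_le : ∀ v, ‖proj v‖ ≤ ‖v‖

/-- The shift `1 - c` makes the form dominate the squared norm of `H`, so it is an inner product and
the inclusion of the domain extends to a contraction on the completion. -/
theorem exists_formCompletion.{u} {H : Type u} [NormedAddCommGroup H] [InnerProductSpace ℂ H]
    [CompleteSpace H] {T : H →ₗ.[ℂ] H} {c : ℝ}
    (hs : T.IsFormalAdjoint T) (hc : IsBoundedBelowBy T c) :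
    ∃ (V : Type u) (_ : NormedAddCommGroup V) (_ : InnerProductSpace ℂ V) (_ : CompleteSpace V),
      Nonempty (FormCompletion T c V) := by
  have key : ∀ x : T.domain, ‖(x : H)‖ ^ 2 ≤ (inner ℂ (x : H) (T x)
      + ((1 - c : ℝ) : ℂ) * inner ℂ (x : H) (x : H)).re := by
    intro x
    have h := hc x
    rw [inner_self_eq_ofReal, Complex.add_re, Complex.re_ofReal_mul, Complex.ofReal_re]
    linarith
  let core : InnerProductSpace.Core ℂ T.domain :=
    { inner := fun x y => inner ℂ (x : H) (T y) + ((1 - c : ℝ) : ℂ) * inner ℂ (x : H) (y : H)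
      conj_inner_symm := fun x y => by
        simp only [map_add, map_mul, inner_conj_symm, Complex.conj_ofReal]
        rw [hs]
      re_inner_nonneg := fun x => (sq_nonneg _).trans (key x)
      add_left := fun x y z => by
        simp only [Submodule.coe_add, inner_add_left]; ring
      smul_left := fun x y r => by
        simp only [Submodule.coe_smul, inner_smul_left]; ring
      definite := fun x hx => by
        have := key x
        have h0 : ‖(x : H)‖ ^ 2 ≤ 0 := by
          refine this.trans (le_of_eq ?_)
          exact congrArg Complex.re hx
        have : ‖(x : H)‖ = 0 := by nlinarith [norm_nonneg (x : H)]
        exact Subtype.ext (norm_eq_zero.1 this) }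
  obtain ⟨V, i1, i2, i3, j, hj, hij⟩ := exists_hilbert_completion core
  have hb : ∀ x : T.domain, ‖(x : H)‖ ≤ 1 * ‖j x‖ := by
    intro x
    have h1 : ‖j x‖ ^ 2 = (core.inner x x).re := by
      rw [← hij, inner_self_eq_ofReal, Complex.ofReal_re]
    have h2 : ‖(x : H)‖ ^ 2 ≤ ‖j x‖ ^ 2 := h1 ▸ key x
    rw [one_mul]
    exact le_of_sq_le_sq h2 (norm_nonneg _)
  let J : V →L[ℂ] H := T.domain.subtype.extendOfNorm j
  have hJ : ∀ x, J (j x) = x := fun x =>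
    LinearMap.extendOfNorm_eq hj ⟨1, hb⟩ x
  refine ⟨V, i1, i2, i3, ⟨⟨j, J, hj, fun x y => hij x y, hJ, fun v => ?_⟩⟩⟩
  refine hj.induction_on v (isClosed_le (by fun_prop) (by fun_prop)) fun x => ?_
  rw [hJ]; simpa using hb x

namespace FormCompletion

variable {T : H →ₗ.[ℂ] H} {c : ℝ} {V : Type*} [NormedAddCommGroup V] [InnerProductSpace ℂ V]
  (F : FormCompletion T c V)

include F in
theorem isFormalAdjoint : T.IsFormalAdjoint T := by
  intro x y
  have h1 := F.inner_emb x y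
  have h2 := F.inner_emb y x
  rw [← inner_conj_symm, h2, map_add, map_mul, inner_conj_symm, inner_conj_symm,
    Complex.conj_ofReal] at h1
  exact add_right_cancel h1

theorem inner_emb_left (x : T.domain) (v : V) :
    inner ℂ (F.emb x) v = inner ℂ (T x + ((1 - c : ℝ) : ℂ) • (x : H)) (F.proj v) := by
  refine F.dense_emb.induction_on v (isClosed_eq (by fun_prop) (by fun_prop)) fun y => ?_
  rw [F.inner_emb, F.proj_emb, inner_add_left, inner_smul_left, Complex.conj_ofReal,
    F.isFormalAdjoint]

theorem norm_emb_sq (x : T.domain) :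
    ((‖F.emb x‖ ^ 2 : ℝ) : ℂ)
      = inner ℂ (x : H) (T x) + ((1 - c : ℝ) : ℂ) * ((‖(x : H)‖ ^ 2 : ℝ) : ℂ) := by
  rw [← inner_self_eq_ofReal, ← inner_self_eq_ofReal, F.inner_emb]

/-- The squared norm of `V` is the form plus a multiple of the squared norm of `H`, so sequences
that are Cauchy in both senses are exactly those that converge in `V`. Allowing a restriction `T₀`
lets two form domains be compared inside one completion. -/
theorem mem_formDomain_iff_of_le [CompleteSpace V] {T₀ : H →ₗ.[ℂ] H} (h : T₀ ≤ T) (u : H) :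
    u ∈ formDomain T₀ ↔
      ∃ v ∈ closure (F.emb '' {x : T.domain | (x : H) ∈ T₀.domain}), F.proj v = u := by
  let i : T₀.domain → T.domain := fun x => ⟨x, h.1 x.2⟩
  have hi : ∀ x y, i x - i y = i (x - y) := fun x y => rfl
  have hTi : ∀ x, T (i x) = T₀ x := fun x => (h.2 rfl).symm
  have hn : ∀ x y : T₀.domain, ((‖F.emb (i x) - F.emb (i y)‖ ^ 2 : ℝ) : ℂ)
      = inner ℂ ((x - y : T₀.domain) : H) (T₀ (x - y))
        + ((1 - c : ℝ) : ℂ) * ((‖(x : H) - y‖ ^ 2 : ℝ) : ℂ) := by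
    intro x y
    rw [← map_sub, F.norm_emb_sq, hi, hTi]
    rfl
  constructor
  · rintro ⟨s, hs, hq⟩
    have h1 : CauchySeq fun n => (s n : H) := hs.cauchySeq
    have h2 : CauchySeq fun n => F.emb (i (s n)) := by
      rw [cauchySeq_iff_tendsto_dist_atTop_0] at h1 ⊢
      have h3 : Tendsto (fun p : ℕ × ℕ => ((‖F.emb (i (s p.1)) - F.emb (i (s p.2))‖ ^ 2 : ℝ) : ℂ))
          atTop (𝓝 0) := by
        simp only [hn]
        have h4 : Tendsto (fun p : ℕ × ℕ => ((‖(s p.1 : H) - s p.2‖ ^ 2 : ℝ) : ℂ)) atTop (𝓝 0) := by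
          have := (h1.pow 2).ofReal
          simpa [dist_eq_norm] using this
        simpa using hq.add (h4.const_mul ((1 - c : ℝ) : ℂ))
      have h5 := ((Complex.continuous_re.tendsto _).comp h3).sqrt
      simpa [Function.comp_def, dist_eq_norm, ← Complex.ofReal_pow, Real.sqrt_sq] using h5
    obtain ⟨v, hv⟩ := cauchySeq_tendsto_of_complete h2
    refine ⟨v, mem_closure_of_tendsto hv (Eventually.of_forall fun n => ⟨_, (s n).2, rfl⟩), ?_⟩
    refine tendsto_nhds_unique ((F.proj.continuous.tendsto v).comp hv) ?_
    simpa [Function.comp_def, F.proj_emb] using hs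
  · rintro ⟨v, hv, rfl⟩
    obtain ⟨w, hw, hwv⟩ := mem_closure_iff_seq_limit.1 hv
    choose s hs hsw using hw
    have hw' : w = fun n => F.emb (i ⟨s n, hs n⟩) := funext fun n => (hsw n).symm
    refine ⟨fun n => ⟨s n, hs n⟩, ?_, ?_⟩
    · have := (F.proj.continuous.tendsto v).comp hwv
      simpa [Function.comp_def, hw', F.proj_emb, i] using this
    · have h1 := hwv.cauchySeq
      have h2 : CauchySeq fun n => (s n : H) := by
        have := (F.proj.continuous.tendsto v).comp hwv |>.cauchySeq
        simpa [Function.comp_def, hw', F.proj_emb, i] using this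
      rw [cauchySeq_iff_tendsto_dist_atTop_0] at h1 h2
      have h3 := (h1.pow 2).ofReal
      have h4 := ((h2.pow 2).ofReal).const_mul ((1 - c : ℝ) : ℂ)
      have h5 := h3.sub h4
      simp only [hw', dist_eq_norm] at h5
      refine (h5.congr fun p => ?_).trans (by simp)
      exact sub_eq_of_eq_add (hn _ _)

theorem mem_formDomain_iff [CompleteSpace V] (u : H) :
    u ∈ formDomain T ↔ u ∈ Set.range F.proj := by
  rw [F.mem_formDomain_iff_of_le le_rfl]
  have : F.emb '' {x : T.domain | (x : H) ∈ T.domain} = Set.range F.emb := by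
    rw [← Set.image_univ]; congr 1; ext x; simp
  rw [this, F.dense_emb.closure_range]
  simp

variable [CompleteSpace H] [CompleteSpace V]

/-- If `u = proj v` lies in the domain of `T†`, then testing against the dense range of `emb` gives
`v = proj* f` with `f = (T† + 1 - c) u`. Conversely, `proj (proj* f)` satisfies the weak equation
that defines membership in the domain of `T†`. -/
theorem mem_adjoint_and_formDomain_iff (hT : Dense (T.domain : Set H)) (u : H) :
    (u ∈ T†.domain ∧ u ∈ formDomain T) ↔ ∃ f, u = F.proj (F.proj.adjoint f) := by
  constructor
  · rintro ⟨hu, hf⟩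
    obtain ⟨v, rfl⟩ := (F.mem_formDomain_iff u).1 hf
    refine ⟨T† ⟨_, hu⟩ + ((1 - c : ℝ) : ℂ) • F.proj v, ?_⟩
    congr 1
    refine F.dense_emb.eq_of_inner_left ℂ fun x => ?_
    rw [ContinuousLinearMap.adjoint_inner_left, F.proj_emb, ← inner_conj_symm,
      F.inner_emb_left, inner_conj_symm, inner_add_right, inner_add_left, inner_smul_left,
      inner_smul_right, Complex.conj_ofReal, LinearPMap.adjoint_isFormalAdjoint hT ⟨_, hu⟩ x]
  · rintro ⟨f, rfl⟩
    refine ⟨LinearPMap.mem_adjoint_domain_of_exists _ ⟨f - ((1 - c : ℝ) : ℂ) • F.proj (F.proj.adjoint f),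
      fun x => ?_⟩, (F.mem_formDomain_iff _).2 ⟨_, rfl⟩⟩
    have := F.inner_emb_left x (F.proj.adjoint f)
    rw [ContinuousLinearMap.adjoint_inner_right, F.proj_emb, inner_add_left, inner_smul_left,
      Complex.conj_ofReal] at this
    rw [← inner_conj_symm, inner_sub_right, this, inner_smul_right, add_sub_cancel_right,
      inner_conj_symm]

theorem adjoint_apply_proj (hT : Dense (T.domain : Set H)) (f : H)
    (h : F.proj (F.proj.adjoint f) ∈ T†.domain) :
    T† ⟨_, h⟩ = f - ((1 - c : ℝ) : ℂ) • F.proj (F.proj.adjoint f) := by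
  refine LinearPMap.adjoint_apply_eq hT _ fun x => ?_
  have := F.inner_emb_left x (F.proj.adjoint f)
  rw [ContinuousLinearMap.adjoint_inner_right, F.proj_emb, inner_add_left, inner_smul_left,
    Complex.conj_ofReal] at this
  rw [← inner_conj_symm, inner_sub_right, this, inner_smul_right, add_sub_cancel_right,
    inner_conj_symm]

end FormCompletion

variable [CompleteSpace H] {T A : H →ₗ.[ℂ] H} {c : ℝ}

theorem le_adjoint_of_isFormalAdjoint_of_le {S : H →ₗ.[ℂ] H} (hT : Dense (T.domain : Set H))
    (hTS : T ≤ S) (hS : IsSelfAdjoint S) : S ≤ T† := by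
  refine LinearPMap.IsFormalAdjoint.le_adjoint hT fun x y => ?_
  have h := LinearPMap.adjoint_isFormalAdjoint hS.dense_domain
  rw [LinearPMap.isSelfAdjoint_def.1 hS] at h
  rw [hTS.2 (x := x) (y := ⟨x, hTS.1 x.2⟩) rfl]
  exact h ⟨x, hTS.1 x.2⟩ y

theorem adjoint_antitone {S : H →ₗ.[ℂ] H} (hT : Dense (T.domain : Set H))
    (hTS : T ≤ S) : S† ≤ T† := by
  refine LinearPMap.IsFormalAdjoint.le_adjoint hT fun x y => ?_
  have h := LinearPMap.adjoint_isFormalAdjoint (hT.mono hTS.1)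
  rw [hTS.2 (x := x) (y := ⟨x, hTS.1 x.2⟩) rfl]
  exact h.symm ⟨x, hTS.1 x.2⟩ y

theorem exists_isFriedrichsExtension (hs : T.IsFormalAdjoint T) (hc : IsBoundedBelowBy T c) :
    ∃ A : H →ₗ.[ℂ] H, IsFriedrichsExtension T A := by
  obtain ⟨V, _, _, _, ⟨F⟩⟩ := exists_formCompletion hs hc
  have hV : formDomain T = (LinearMap.range (F.proj : V →ₗ[ℂ] H) : Set H) := by
    ext u; rw [F.mem_formDomain_iff]; rfl
  refine ⟨T†.domRestrict (LinearMap.range (F.proj : V →ₗ[ℂ] H)), LinearPMap.domRestrict_le,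
    fun u => ?_⟩
  rw [hV, and_comm]
  rfl

namespace IsFriedrichsExtension

/-- `G = proj ∘ proj*` is the inverse of `A + 1 - c`. The norm bound holds because `⟪G f, f⟫ =
‖proj* f‖²` and `proj` is a contraction. -/
theorem exists_resolvent (hT : Dense (T.domain : Set H)) (hs : T.IsFormalAdjoint T)
    (hc : IsBoundedBelowBy T c) (hA : IsFriedrichsExtension T A) :
    ∃ G : H →L[ℂ] H, G.adjoint = G ∧ (∀ f, ‖G f‖ ^ 2 ≤ (inner ℂ (G f) f).re) ∧
      (∀ u, u ∈ A.domain ↔ u ∈ Set.range G) ∧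
      ∀ f (h : G f ∈ A.domain), A ⟨G f, h⟩ = f - ((1 - c : ℝ) : ℂ) • G f := by
  obtain ⟨V, _, _, _, ⟨F⟩⟩ := exists_formCompletion hs hc
  refine ⟨F.proj ∘L F.proj.adjoint, ?_, fun f => ?_, fun u => ?_, fun f h => ?_⟩
  · rw [ContinuousLinearMap.adjoint_comp, ContinuousLinearMap.adjoint_adjoint]
  · rw [ContinuousLinearMap.comp_apply, ← ContinuousLinearMap.adjoint_inner_right,
      inner_self_eq_ofReal, Complex.ofReal_re]
    exact pow_le_pow_left₀ (norm_nonneg _) (F.norm_proj_le _) 2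
  · rw [hA.2, F.mem_adjoint_and_formDomain_iff hT]
    exact exists_congr fun f => eq_comm
  · rw [hA.1.2 (y := ⟨F.proj (F.proj.adjoint f), hA.1.1 h⟩) rfl]
    exact F.adjoint_apply_proj hT f _

theorem isBoundedBelowBy (hT : Dense (T.domain : Set H)) (hs : T.IsFormalAdjoint T)
    (hc : IsBoundedBelowBy T c) (hA : IsFriedrichsExtension T A) : IsBoundedBelowBy A c := by
  obtain ⟨G, -, hG, hd, hAG⟩ := hA.exists_resolvent hT hs hc
  rintro ⟨u, hu⟩
  obtain ⟨f, rfl⟩ := (hd u).1 hu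
  have := hG f
  rw [hAG, inner_sub_right, inner_smul_right, inner_self_eq_ofReal, ← Complex.ofReal_mul,
    Complex.sub_re, Complex.ofReal_re]
  linarith

theorem le (hT : Dense (T.domain : Set H)) (hs : T.IsFormalAdjoint T)
    (hA : IsFriedrichsExtension T A) : T ≤ A := by
  have h := LinearPMap.IsFormalAdjoint.le_adjoint hT hs
  have h1 : T.domain ≤ A.domain := fun x hx =>
    (hA.2 x).2 ⟨h.1 hx, fun _ => ⟨x, hx⟩, tendsto_const_nhds, by simp⟩
  exact ⟨h1, fun x y hxy => (h.2 (y := ⟨x, h.1 x.2⟩) rfl).trans (hA.1.2 hxy.symm).symm⟩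

theorem isSelfAdjoint (hT : Dense (T.domain : Set H)) (hs : T.IsFormalAdjoint T)
    (hc : IsBoundedBelowBy T c) (hA : IsFriedrichsExtension T A) : IsSelfAdjoint A := by
  obtain ⟨G, hG, -, hd, hAG⟩ := hA.exists_resolvent hT hs hc
  have hdA : Dense (A.domain : Set H) := hT.mono (hA.le hT hs).1
  have hGi : ∀ x y, inner ℂ (G x) y = inner ℂ x (G y) := fun x y => by
    conv_lhs => rw [← hG]
    exact ContinuousLinearMap.adjoint_inner_left G y x
  have hsymm : A.IsFormalAdjoint A := by
    rintro ⟨u, hu⟩ ⟨v, hv⟩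
    obtain ⟨f, rfl⟩ := (hd u).1 hu
    obtain ⟨g, rfl⟩ := (hd v).1 hv
    simp only [hAG, inner_sub_left, inner_sub_right, inner_smul_left, inner_smul_right,
      Complex.conj_ofReal, hGi, map_sub, map_smul]
  have hle : A ≤ A† := LinearPMap.IsFormalAdjoint.le_adjoint hdA hsymm
  have hdom : A†.domain ≤ A.domain := by
    intro y hy
    -- The vector is `(A† + 1 - c) y`; symmetry of `G` shows that `G` maps it back to `y`.
    refine (hd y).2 ⟨A† ⟨y, hy⟩ + ((1 - c : ℝ) : ℂ) • y, ?_⟩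
    refine ext_inner_right ℂ fun f => ?_
    have hGf : G f ∈ A.domain := (hd _).2 ⟨f, rfl⟩
    have := LinearPMap.adjoint_isFormalAdjoint hdA ⟨y, hy⟩ ⟨G f, hGf⟩
    rw [hAG] at this
    rw [hGi, inner_add_left, inner_smul_left, Complex.conj_ofReal, this, inner_sub_right,
      inner_smul_right, sub_add_cancel]
  have hge : A† ≤ A := ⟨hdom, fun x y hxy => (hle.2 hxy.symm).symm⟩
  exact LinearPMap.isSelfAdjoint_def.2 (le_antisymm hge hle)

/-- Self-adjointness of `B` gives `B ≤ T†`, and the form domain condition then gives `B ≤ A`. Taking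
adjoints reverses this inclusion. -/
theorem eq_of_isSelfAdjoint (hT : Dense (T.domain : Set H)) (hs : T.IsFormalAdjoint T)
    (hc : IsBoundedBelowBy T c) (hA : IsFriedrichsExtension T A) {B : H →ₗ.[ℂ] H} (hTB : T ≤ B)
    (hB : IsSelfAdjoint B) (hBd : (B.domain : Set H) ⊆ formDomain T) : B = A := by
  have hBT : B ≤ T† := le_adjoint_of_isFormalAdjoint_of_le hT hTB hB
  have hBA : B ≤ A := ⟨fun x hx => (hA.2 x).2 ⟨hBT.1 hx, hBd hx⟩, fun x y hxy =>
    (hBT.2 (y := ⟨x, hBT.1 x.2⟩) rfl).trans (hA.1.2 hxy.symm).symm⟩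
  refine le_antisymm hBA ?_
  have := adjoint_antitone hB.dense_domain hBA
  rwa [LinearPMap.isSelfAdjoint_def.1 hB,
    LinearPMap.isSelfAdjoint_def.1 (hA.isSelfAdjoint hT hs hc)] at this

end IsFriedrichsExtension

/-- A restriction whose domain approximates each vector in the domain of `T`, in the norm and in the
quadratic form, has the same Friedrichs extension. -/
theorem IsFriedrichsExtension.of_le {T₀ : H →ₗ.[ℂ] H} (hT : Dense (T.domain : Set H))
    (hs : T.IsFormalAdjoint T) (hc : IsBoundedBelowBy T c) (hA : IsFriedrichsExtension T A)
    (hT₀ : Dense (T₀.domain : Set H)) (hle : T₀ ≤ T)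
    (happ : ∀ x : T.domain, ∃ s : ℕ → T.domain, (∀ n, (s n : H) ∈ T₀.domain) ∧
      Tendsto (fun n => (s n : H)) atTop (𝓝 x) ∧
      Tendsto (fun n => inner ℂ ((x - s n : T.domain) : H) (T (x - s n))) atTop (𝓝 0)) :
    IsFriedrichsExtension T₀ A := by
  have hs₀ : T₀.IsFormalAdjoint T₀ := fun x y => by
    rw [hle.2 (x := x) (y := ⟨x, hle.1 x.2⟩) rfl, hle.2 (x := y) (y := ⟨y, hle.1 y.2⟩) rfl]
    exact hs ⟨x, hle.1 x.2⟩ ⟨y, hle.1 y.2⟩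
  have hc₀ : IsBoundedBelowBy T₀ c := fun x => by
    rw [hle.2 (x := x) (y := ⟨x, hle.1 x.2⟩) rfl]
    exact hc ⟨x, hle.1 x.2⟩
  have hfd : formDomain T ⊆ formDomain T₀ := by
    obtain ⟨V, _, _, _, ⟨F⟩⟩ := exists_formCompletion hs hc
    intro u hu
    obtain ⟨v, rfl⟩ := (F.mem_formDomain_iff u).1 hu
    refine (F.mem_formDomain_iff_of_le hle _).2 ⟨v, ?_, rfl⟩
    -- Convergence in the norm and in the form is convergence in `V`, so the domain of `T₀` is dense
    -- in `V`.
    have hsub : Set.range F.emb ⊆ closure (F.emb '' {x : T.domain | (x : H) ∈ T₀.domain}) := by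
      rintro _ ⟨x, rfl⟩
      obtain ⟨s, hs, h1, h2⟩ := happ x
      refine mem_closure_of_tendsto (f := fun n => F.emb (s n)) (b := atTop) ?_
        (Eventually.of_forall fun n => ⟨_, hs n, rfl⟩)
      have h3 : Tendsto (fun n => ((‖F.emb (x - s n)‖ ^ 2 : ℝ) : ℂ)) atTop (𝓝 0) := by
        simp only [F.norm_emb_sq]
        have h4 : Tendsto (fun n => ‖((x - s n : T.domain) : H)‖ ^ 2) atTop (𝓝 0) := by
          simpa using ((tendsto_const_nhds (x := (x : H))).sub h1).norm.pow 2
        simpa using h2.add (h4.ofReal.const_mul ((1 - c : ℝ) : ℂ))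
      have h5 := ((Complex.continuous_re.tendsto _).comp h3).sqrt
      rw [tendsto_iff_norm_sub_tendsto_zero]
      simpa [Function.comp_def, ← Complex.ofReal_pow, Real.sqrt_sq, norm_sub_rev] using h5
    exact closure_minimal hsub isClosed_closure (F.dense_emb v)
  -- `A` is a self-adjoint extension of `T₀` inside its form domain, so uniqueness identifies it
  -- with the Friedrichs extension of `T₀`.
  obtain ⟨A₀, hA₀⟩ := exists_isFriedrichsExtension hs₀ hc₀
  have : A = A₀ := hA₀.eq_of_isSelfAdjoint hT₀ hs₀ hc₀ (hle.trans (hA.le hT hs))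
    (hA.isSelfAdjoint hT hs hc) fun x hx => hfd ((hA.2 x).1 hx).2
  exact this ▸ hA₀

end Friedrichs

/-! ### Algebraic identities for sums over pairs and triples. -/

section PairSums

theorem two_mul_sum_sum_Ioi {N : ℕ} {R : Type*} [CommRing R] {f : Fin N → Fin N → R}
    (hf : ∀ a b, f a b = f b a) :
    2 * ∑ a, ∑ b ∈ Finset.Ioi a, f a b = ∑ a, ∑ b, f a b - ∑ a, f a a := by
  have h1 : ∀ a, ∑ b, f a b = ∑ b ∈ Finset.Iio a, f a b + f a a + ∑ b ∈ Finset.Ioi a, f a b := by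
    intro a
    rw [← Finset.sum_filter_add_sum_filter_not Finset.univ (· < a), add_assoc]
    congr 1
    · exact Finset.sum_congr (by ext; simp) fun _ _ => rfl
    · rw [← Finset.sum_filter_add_sum_filter_not _ (· = a)]
      congr 1
      · rw [Finset.filter_filter, Finset.sum_eq_single a] <;> simp +contextual
      · refine Finset.sum_congr ?_ fun _ _ => rfl
        ext b
        simp only [Finset.mem_filter, Finset.mem_univ, true_and, Finset.mem_Ioi]
        grind
  have h2 : ∑ a, ∑ b ∈ Finset.Iio a, f a b = ∑ a, ∑ b ∈ Finset.Ioi a, f a b := by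
    rw [Finset.sum_comm' (s := Finset.univ) (t := fun a => Finset.Iio a) (t' := Finset.univ)
      (s' := fun b => Finset.Ioi b) (by simp)]
    exact Finset.sum_congr rfl fun a _ => Finset.sum_congr rfl fun b _ => hf _ _
  simp only [h1, Finset.sum_add_distrib, h2]
  ring

/-- The derivative in direction `j` of a product over pairs `a < b` of functions of `X_b - X_a` has
this shape; antisymmetry collects the pairs that contain `j` into one unordered sum. -/
theorem sum_sum_Ioi_antisymm_mul_sub {N : ℕ} {c : Fin N → Fin N → ℝ}
    (hc : ∀ a b, c a b = -c b a) (j : Fin N) :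
    ∑ a, ∑ b ∈ Finset.Ioi a, c a b * ((Pi.single j 1 : Fin N → ℝ) b - (Pi.single j 1 : Fin N → ℝ) a)
      = ∑ a, c a j := by
  have h := two_mul_sum_sum_Ioi (f := fun a b : Fin N => c a b *
    ((Pi.single j 1 : Fin N → ℝ) b - (Pi.single j 1 : Fin N → ℝ) a)) fun a b => by rw [hc]; ring
  have h1 : ∑ a, ∑ b, c a b * ((Pi.single j 1 : Fin N → ℝ) b - (Pi.single j 1 : Fin N → ℝ) a)
      = ∑ a, c a j - ∑ b, c j b := by
    simp only [mul_sub, Finset.sum_sub_distrib]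
    congr 1
    · exact Finset.sum_congr rfl fun a _ => by simp [Pi.single_apply]
    · rw [Finset.sum_comm]
      exact Finset.sum_congr rfl fun a _ => by simp [Pi.single_apply]
  have h2 : ∑ b, c j b = -∑ a, c a j := by
    rw [← Finset.sum_neg_distrib]; exact Finset.sum_congr rfl fun a _ => hc _ _
  simp only [sub_self, mul_zero, Finset.sum_const_zero, h1, h2] at h
  linarith

/-- The three-body identity behind the ground state equation. -/
theorem three_body_sum {N : ℕ} (M : Fin N → ℝ) {X : Fin N → ℝ} (hX : Function.Injective X) :
    ∑ j, ∑ k, ∑ l, M j * M k * M l * ((X j - X k)⁻¹ * (X j - X l)⁻¹)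
      = ∑ j, ∑ k, M j * M k ^ 2 * ((X j - X k)⁻¹) ^ 2 := by
  classical
  set r : Fin N → Fin N → ℝ := fun j k => (X j - X k)⁻¹ with hr
  change ∑ j, ∑ k, ∑ l, M j * M k * M l * (r j k * r j l) = ∑ j, ∑ k, M j * M k ^ 2 * r j k ^ 2
  -- For distinct indices the cyclic sum vanishes. When two of them coincide, the convention `0⁻¹ =
  -- 0` leaves a single square, and when all three coincide both sides are zero.
  have hcyc : ∀ j k l, r j k * r j l + r k j * r k l + r l j * r l k
      = (if l = k then r j k ^ 2 else 0) + (if j = l then r k l ^ 2 else 0)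
        + (if k = j then r l j ^ 2 else 0) := by
    intro j k l
    by_cases h1 : l = k
    · subst h1
      by_cases h2 : j = l
      · subst h2; simp [hr]
      · have : l ≠ j := fun h => h2 h.symm
        simp [hr, h2, this, sq]
    · by_cases h2 : j = l
      · subst h2
        have : k ≠ j := fun h => h1 h.symm
        simp [hr, h1, this, sq]
      · by_cases h3 : k = j
        · subst h3; simp [hr, h1, h2, sq]
        · simp only [h1, h2, h3, if_false, add_zero, hr]
          have e1 : X j - X k ≠ 0 := sub_ne_zero.2 fun h => h3 (hX h).symm
          have e2 : X j - X l ≠ 0 := sub_ne_zero.2 fun h => h2 (hX h)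
          have e3 : X l - X k ≠ 0 := sub_ne_zero.2 fun h => h1 (hX h)
          rw [← neg_sub (X j) (X k), ← neg_sub (X j) (X l), ← neg_sub (X l) (X k)]
          simp only [inv_neg]
          field_simp
          ring
  have hS : ∑ j, ∑ k, ∑ l, M j * M k * M l *
      (r j k * r j l + r k j * r k l + r l j * r l k)
      = 3 * ∑ j, ∑ k, ∑ l, M j * M k * M l * (r j k * r j l) := by
    have s2 : ∑ j, ∑ k, ∑ l, M j * M k * M l * (r k j * r k l)
        = ∑ j, ∑ k, ∑ l, M j * M k * M l * (r j k * r j l) := by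
      rw [Finset.sum_comm]
      exact Finset.sum_congr rfl fun j _ => Finset.sum_congr rfl fun k _ =>
        Finset.sum_congr rfl fun l _ => by ring
    have s3 : ∑ j, ∑ k, ∑ l, M j * M k * M l * (r l j * r l k)
        = ∑ j, ∑ k, ∑ l, M j * M k * M l * (r j k * r j l) := by
      rw [Finset.sum_congr rfl fun j _ => Finset.sum_comm, Finset.sum_comm]
      exact Finset.sum_congr rfl fun j _ => Finset.sum_congr rfl fun k _ =>
        Finset.sum_congr rfl fun l _ => by ring
    simp only [mul_add, Finset.sum_add_distrib, s2, s3]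
    ring
  have hS' : ∑ j, ∑ k, ∑ l, M j * M k * M l *
      (r j k * r j l + r k j * r k l + r l j * r l k)
      = 3 * ∑ j, ∑ k, M j * M k ^ 2 * r j k ^ 2 := by
    simp only [hcyc]
    have s1 : ∑ j, ∑ k, ∑ l, M j * M k * M l * (if l = k then r j k ^ 2 else 0)
        = ∑ j, ∑ k, M j * M k ^ 2 * r j k ^ 2 := by
      simp only [mul_ite, mul_zero, Finset.sum_ite_eq', Finset.mem_univ, if_true]
      exact Finset.sum_congr rfl fun j _ => Finset.sum_congr rfl fun k _ => by ring
    have s2 : ∑ j, ∑ k, ∑ l, M j * M k * M l * (if j = l then r k l ^ 2 else 0)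
        = ∑ j, ∑ k, M j * M k ^ 2 * r j k ^ 2 := by
      simp only [mul_ite, mul_zero, Finset.sum_ite_eq, Finset.mem_univ, if_true]
      rw [Finset.sum_comm]
      exact Finset.sum_congr rfl fun j _ => Finset.sum_congr rfl fun k _ => by ring
    have s3 : ∑ j, ∑ k, ∑ l, M j * M k * M l * (if k = j then r l j ^ 2 else 0)
        = ∑ j, ∑ k, M j * M k ^ 2 * r j k ^ 2 := by
      rw [Finset.sum_congr rfl fun j _ => Finset.sum_comm]
      simp only [mul_ite, mul_zero, Finset.sum_ite_eq', Finset.mem_univ, if_true]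
      rw [Finset.sum_comm]
      exact Finset.sum_congr rfl fun j _ => Finset.sum_congr rfl fun k _ => by ring
    simp only [mul_add, Finset.sum_add_distrib, s1, s2, s3]
    ring
  rw [hS] at hS'
  linarith

end PairSums

/-! ### Smoothness, zeros and first derivatives of `Φ₀`. -/

section Calculus

/-- With each derivative written as the factor times `l i`, the product rule needs neither division
nor non-vanishing factors. -/
theorem hasDerivAt_finset_prod_of_log {𝔸 : Type*} [NormedCommRing 𝔸] [NormedAlgebra ℝ 𝔸]
    {ι : Type*} (s : Finset ι) {f : ι → ℝ → 𝔸} {l : ι → 𝔸} {x : ℝ} (h : ∀ i ∈ s, HasDerivAt (f i) (f i x * l i) x) :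
    HasDerivAt (fun t => ∏ i ∈ s, f i t) ((∏ i ∈ s, f i x) * ∑ i ∈ s, l i) x := by
  classical
  induction s using Finset.induction_on with
  | empty => simpa using hasDerivAt_const x (1 : 𝔸)
  | insert a s ha ih =>
    simp only [Finset.prod_insert ha, Finset.sum_insert ha]
    convert! (h a (by simp)).mul (ih fun i hi => h i (by simp [hi])) using 1
    ring

theorem hasDerivAt_ofReal_cpow_log {t : ℝ} (ht : t ≠ 0) (α : ℝ) :
    HasDerivAt (fun s : ℝ => (s : ℂ) ^ (α : ℂ)) ((t : ℂ) ^ (α : ℂ) * ((α / t : ℝ) : ℂ)) t := by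
  have ht' : (t : ℂ) ≠ 0 := Complex.ofReal_ne_zero.2 ht
  rcases eq_or_ne α 0 with rfl | hα
  · simpa using hasDerivAt_const t (1 : ℂ)
  · have hα' : (α : ℂ) ≠ 0 := Complex.ofReal_ne_zero.2 hα
    convert! hasDerivAt_ofReal_cpow_const ht hα' using 1
    rw [Complex.cpow_sub _ _ ht', Complex.cpow_one]
    push_cast
    ring

/-- The branch cut does no harm along the real line: for negative `s` the power is `(-s) ^ α` times
a constant phase. -/
theorem contDiffAt_ofReal_cpow {t : ℝ} (ht : t ≠ 0) (α : ℝ) :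
    ContDiffAt ℝ ∞ (fun s : ℝ => (s : ℂ) ^ (α : ℂ)) t := by
  rcases lt_or_gt_of_ne ht with h | h
  · have h1 : ContDiffAt ℝ ∞ (fun s : ℝ => (((-s) ^ α : ℝ) : ℂ) *
        Complex.exp (Real.pi * Complex.I * α)) t := by
      refine ContDiffAt.mul ?_ contDiffAt_const
      exact Complex.ofRealCLM.contDiff.contDiffAt.comp t
        (contDiffAt_id.neg.rpow_const_of_ne (by simpa using ht))
    refine h1.congr_of_eventuallyEq ?_
    filter_upwards [gt_mem_nhds h] with s hs
    rw [Complex.ofReal_cpow_of_nonpos hs.le, Complex.ofReal_cpow (by linarith)]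
    push_cast; rfl
  · have h1 : ContDiffAt ℝ ∞ (fun s : ℝ => ((s ^ α : ℝ) : ℂ)) t :=
      Complex.ofRealCLM.contDiff.contDiffAt.comp t (contDiffAt_id.rpow_const_of_ne ht)
    refine h1.congr_of_eventuallyEq ?_
    filter_upwards [lt_mem_nhds h] with s hs
    rw [Complex.ofReal_cpow hs.le]

theorem isOpen_configSpace (N : ℕ) : IsOpen (configSpace N) := by
  have : configSpace N = ⋂ j, ⋂ k, {X | j ≠ k → X j ≠ X k} := by
    ext X
    simp only [configSpace, Set.mem_ofPred_eq, Set.mem_iInter, Function.Injective]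
    exact forall₂_congr fun j k => not_imp_not.symm
  rw [this]
  refine isOpen_iInter_of_finite fun j => isOpen_iInter_of_finite fun k => ?_
  by_cases h : j = k
  · simp [h]
  · simpa [h] using isOpen_ne_fun (continuous_apply j) (continuous_apply k)

/-- Each collision hyperplane is the kernel of a non-zero linear form, hence a null set. -/
theorem ae_mem_configSpace (N : ℕ) : ∀ᵐ X ∂(volume : Measure (Fin N → ℝ)), X ∈ configSpace N := by
  have h : ∀ j k : Fin N, j ≠ k → ∀ᵐ X ∂(volume : Measure (Fin N → ℝ)), X j ≠ X k := by
    intro j k hjk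
    let L : (Fin N → ℝ) →ₗ[ℝ] ℝ := LinearMap.proj (R := ℝ) (φ := fun _ => ℝ) j - LinearMap.proj k
    have hL : LinearMap.ker L ≠ ⊤ := by
      rw [Ne, LinearMap.ker_eq_top]
      intro h
      have := congrArg (fun f => f (Pi.single j 1)) h
      simp [L, hjk.symm] at this
    have := Measure.addHaar_submodule (volume : Measure (Fin N → ℝ)) _ hL
    rw [ae_iff]
    convert this using 2
    ext X
    simp [L, sub_eq_zero]
  have h' : ∀ᵐ X ∂(volume : Measure (Fin N → ℝ)), ∀ j k : Fin N, j ≠ k → X j ≠ X k := by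
    rw [ae_all_iff]; intro j; rw [ae_all_iff]; intro k
    by_cases hjk : j = k
    · simp [hjk]
    · filter_upwards [h j k hjk] with X hX _ using hX
  filter_upwards [h'] with X hX j k hjk
  by_contra hne
  exact hX j k hne hjk

variable {N : ℕ} {m : Fin N → ℝ} {κ : ℝ}

theorem sub_ne_zero_of_mem_configSpace {X : Fin N → ℝ} (hX : X ∈ configSpace N) {j k : Fin N}
    (h : j ≠ k) : X j - X k ≠ 0 :=
  sub_ne_zero.2 fun e => h (hX e)

/-- The logarithmic derivative of the ground state in the direction `j`. -/
def logGrad (m : Fin N → ℝ) (κ : ℝ) (j : Fin N) (X : Fin N → ℝ) : ℝ :=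
  -(m j * X j) + ∑ k, κ * m j * m k * (X j - X k)⁻¹

theorem contDiffOn_groundStateFun (m : Fin N → ℝ) (κ : ℝ) :
    ContDiffOn ℝ ∞ (groundStateFun m κ) (configSpace N) := by
  intro X hX
  refine ContDiffAt.contDiffWithinAt ?_
  unfold groundStateFun
  refine ContDiffAt.mul (contDiffAt_prod fun j _ => ?_)
    (contDiffAt_prod fun j _ => contDiffAt_prod fun k hk => ?_)
  · exact Complex.ofRealCLM.contDiff.contDiffAt.comp X
      (f := fun X : Fin N → ℝ => Real.exp (-(m j * X j ^ 2 / 2))) (by fun_prop)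
  · exact (contDiffAt_ofReal_cpow (sub_ne_zero_of_mem_configSpace hX (Finset.mem_Ioi.1 hk).ne')
      _).comp X (f := fun X : Fin N → ℝ => X k - X j) (by fun_prop)

theorem groundStateFun_ne_zero {X : Fin N → ℝ} (hX : X ∈ configSpace N) :
    groundStateFun m κ X ≠ 0 := by
  unfold groundStateFun
  refine mul_ne_zero (Finset.prod_ne_zero_iff.2 fun j _ => ?_)
    (Finset.prod_ne_zero_iff.2 fun j _ => Finset.prod_ne_zero_iff.2 fun k hk => ?_)
  · exact Complex.ofReal_ne_zero.2 (Real.exp_pos _).ne'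
  · rw [Complex.cpow_def_of_ne_zero]
    · exact Complex.exp_ne_zero _
    · exact Complex.ofReal_ne_zero.2
        (sub_ne_zero_of_mem_configSpace hX (Finset.mem_Ioi.1 hk).ne')

theorem hasLineDerivAt_groundStateFun {X : Fin N → ℝ} (hX : X ∈ configSpace N) (i : Fin N) :
    HasLineDerivAt ℝ (groundStateFun m κ) (groundStateFun m κ X * (logGrad m κ i X : ℂ)) X
      (Pi.single i 1) := by
  set e : Fin N → ℝ := Pi.single i 1 with he
  have hl : ((logGrad m κ i X : ℝ) : ℂ) = (∑ j, ((-(m j * X j * e j) : ℝ) : ℂ))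
      + ∑ j, ∑ k ∈ Finset.Ioi j, ((κ * m j * m k / (X k - X j) * (e k - e j) : ℝ) : ℂ) := by
    norm_cast
    rw [sum_sum_Ioi_antisymm_mul_sub (c := fun j k => κ * m j * m k / (X k - X j)), logGrad]
    · congr 1
      · simp [he, Pi.single_apply]
      · exact Finset.sum_congr rfl fun k _ => by rw [div_eq_mul_inv]; ring
    · intro a b
      rw [← neg_sub (X a) (X b), div_neg]; ring
  rw [hl, HasLineDerivAt]
  unfold groundStateFun
  have h1 : HasDerivAt (fun t : ℝ => ∏ j, ((Real.exp (-(m j * (X + t • e) j ^ 2 / 2)) : ℝ) : ℂ))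
      ((∏ j, ((Real.exp (-(m j * X j ^ 2 / 2)) : ℝ) : ℂ)) *
        ∑ j, ((-(m j * X j * e j) : ℝ) : ℂ)) 0 := by
    have := hasDerivAt_finset_prod_of_log (x := 0) Finset.univ
      (f := fun j (t : ℝ) => ((Real.exp (-(m j * (X + t • e) j ^ 2 / 2)) : ℝ) : ℂ))
      (l := fun j => ((-(m j * X j * e j) : ℝ) : ℂ)) ?_
    · simpa using this
    · intro j _
      rw [← Complex.ofReal_mul]
      refine HasDerivAt.ofReal_comp ?_
      have hlin : HasDerivAt (fun t : ℝ => (X + t • e) j) (e j) 0 := by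
        simpa using ((hasDerivAt_id (0 : ℝ)).mul_const (e j)).const_add (X j)
      have := ((((hlin.pow 2).const_mul (m j)).div_const 2).neg).exp
      convert! this using 1
      simp
      ring
  have h2 : HasDerivAt (fun t : ℝ => ∏ j, ∏ k ∈ Finset.Ioi j,
        (((X + t • e) k - (X + t • e) j : ℝ) : ℂ) ^ ((κ * m j * m k : ℝ) : ℂ))
      ((∏ j, ∏ k ∈ Finset.Ioi j, ((X k - X j : ℝ) : ℂ) ^ ((κ * m j * m k : ℝ) : ℂ)) *
        ∑ j, ∑ k ∈ Finset.Ioi j, ((κ * m j * m k / (X k - X j) * (e k - e j) : ℝ) : ℂ)) 0 := by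
    have := hasDerivAt_finset_prod_of_log (x := 0) Finset.univ
      (f := fun j (t : ℝ) => ∏ k ∈ Finset.Ioi j,
        (((X + t • e) k - (X + t • e) j : ℝ) : ℂ) ^ ((κ * m j * m k : ℝ) : ℂ))
      (l := fun j => ∑ k ∈ Finset.Ioi j,
        ((κ * m j * m k / (X k - X j) * (e k - e j) : ℝ) : ℂ)) ?_
    · simpa using this
    · intro j _
      refine hasDerivAt_finset_prod_of_log _ fun k hk => ?_
      have hlin : HasDerivAt (fun t : ℝ => (X + t • e) k - (X + t • e) j) (e k - e j) 0 := by
        have h : ∀ i, HasDerivAt (fun t : ℝ => (X + t • e) i) (e i) 0 := fun i => by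
          simpa using ((hasDerivAt_id (0 : ℝ)).mul_const (e i)).const_add (X i)
        exact (h k).sub (h j)
      have hne := sub_ne_zero_of_mem_configSpace hX (Finset.mem_Ioi.1 hk).ne'
      have h0 : (X + (0 : ℝ) • e) k - (X + (0 : ℝ) • e) j = X k - X j := by simp
      have := (hasDerivAt_ofReal_cpow_log hne (κ * m j * m k))
      rw [← h0] at this
      convert! this.scomp (0 : ℝ) hlin using 1
      rw [h0, Complex.real_smul]
      push_cast
      ring
  convert! h1.mul h2 using 1
  simp
  ring

end Calculus

/-! ### The ground state equation and conjugation by `Φ₀`. -/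

section Hamiltonian

variable {N : ℕ} {m : Fin N → ℝ} {κ : ℝ}

/-- Symmetrizing in `j` and `k` replaces `X_j / (X_j - X_k)` by a total of one per off-diagonal
pair; the diagonal contributes zero since `0⁻¹ = 0`. -/
theorem sum_sum_mul_sub_inv {X : Fin N → ℝ} (hX : X ∈ configSpace N) (m : Fin N → ℝ) :
    2 * ∑ j, ∑ k, m j * m k * X j * (X j - X k)⁻¹ = (∑ j, m j) ^ 2 - ∑ j, m j ^ 2 := by
  have h1 : ∑ j, ∑ k, m j * m k * X j * (X j - X k)⁻¹
      = ∑ j, ∑ k, m j * m k * (-X k) * (X j - X k)⁻¹ := by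
    rw [Finset.sum_comm]
    refine Finset.sum_congr rfl fun j _ => Finset.sum_congr rfl fun k _ => ?_
    rw [← neg_sub (X j) (X k), inv_neg]; ring
  have h2 : ∀ j k, m j * m k * X j * (X j - X k)⁻¹ + m j * m k * (-X k) * (X j - X k)⁻¹
      = m j * m k - if j = k then m j ^ 2 else 0 := by
    intro j k
    by_cases h : j = k
    · subst h; simp [sq]
    · have := sub_ne_zero_of_mem_configSpace hX h
      simp only [h, if_false]
      field_simp
      ring
  rw [two_mul]
  conv_lhs => rw [h1]
  conv_lhs => enter [1]; rw [← h1]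
  simp only [← Finset.sum_add_distrib, h2, Finset.sum_sub_distrib, Finset.sum_ite_eq,
    Finset.mem_univ, if_true]
  rw [sq, Finset.sum_mul_sum]

/-- The derivative of `logGrad m κ j` in the direction `j`. -/
def logGradDeriv (m : Fin N → ℝ) (κ : ℝ) (j : Fin N) (X : Fin N → ℝ) : ℝ :=
  -m j - ∑ k, κ * m j * m k * ((X j - X k)⁻¹) ^ 2

/-- Write `L_j = m_j (-X_j + κ ∑ m_k r_jk)`. In the square, `X_j²` cancels the harmonic potential,
the cross term gives `κ ((∑ m)² - ∑ m²)`, and the squared pair sum reduces to the two-body sum `W`.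
Together with the two-body sum `Q` from `∂_j L_j`, this cancels the interaction; the terms `-m_j` of
`∂_j L_j` contribute `N`. -/
theorem riccati_identity (hm : ∀ j, m j ≠ 0) {X : Fin N → ℝ} (hX : X ∈ configSpace N) :
    -(∑ j, 1 / m j * (logGrad m κ j X ^ 2 + logGradDeriv m κ j X)) + ∑ j, m j * X j ^ 2
      + κ * ∑ j, ∑ k ∈ Finset.Ioi j,
        (κ * m j * m k - 1) * (m j + m k) * (1 / (X j - X k) ^ 2) = groundEnergy m κ := by
  set r : Fin N → Fin N → ℝ := fun j k => (X j - X k)⁻¹ with hr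
  have hrs : ∀ j k, r j k ^ 2 = r k j ^ 2 := fun j k => by
    simp only [hr]; rw [← neg_sub (X k) (X j), inv_neg, neg_sq]
  set W := ∑ j, ∑ k, m j * m k ^ 2 * r j k ^ 2 with hW
  set Q := ∑ j, ∑ k, m k * r j k ^ 2 with hQ
  have hW' : ∑ j, ∑ k, m k * m j ^ 2 * r j k ^ 2 = W := by
    rw [Finset.sum_comm]
    exact Finset.sum_congr rfl fun j _ => Finset.sum_congr rfl fun k _ => by rw [hrs]
  have hQ' : ∑ j, m j * ∑ k, r j k ^ 2 = Q := by
    simp only [Finset.mul_sum]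
    rw [Finset.sum_comm]
    exact Finset.sum_congr rfl fun j _ => Finset.sum_congr rfl fun k _ => by rw [hrs]
  have hS : 2 * ∑ j, ∑ k ∈ Finset.Ioi j,
      (κ * m j * m k - 1) * (m j + m k) * (1 / (X j - X k) ^ 2) = 2 * κ * W - 2 * Q := by
    rw [two_mul_sum_sum_Ioi (f := fun j k =>
      (κ * m j * m k - 1) * (m j + m k) * (1 / (X j - X k) ^ 2))]
    · have : ∀ j k, (κ * m j * m k - 1) * (m j + m k) * (1 / (X j - X k) ^ 2)
          = κ * (m k * m j ^ 2 * r j k ^ 2) + κ * (m j * m k ^ 2 * r j k ^ 2)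
            - m j * r j k ^ 2 - m k * r j k ^ 2 := by
        intro j k
        simp only [hr]
        rw [one_div, ← inv_pow]
        ring
      simp only [this, Finset.sum_sub_distrib, Finset.sum_add_distrib, ← Finset.mul_sum, hW', hQ',
        ← hW, ← hQ]
      simp [hr]
      ring
    · intro j k
      rw [← neg_sub (X k) (X j), neg_sq]; ring
  have h3 : ∑ j, m j * (∑ k, m k * r j k) ^ 2 = W := by
    rw [hW, ← three_body_sum m hX]
    refine Finset.sum_congr rfl fun j _ => ?_
    rw [sq, Finset.sum_mul_sum, Finset.mul_sum]
    refine Finset.sum_congr rfl fun k _ => ?_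
    rw [Finset.mul_sum]
    exact Finset.sum_congr rfl fun l _ => by simp only [hr]; ring
  have h2 := sum_sum_mul_sub_inv hX m
  have hj : ∀ j, 1 / m j * (logGrad m κ j X ^ 2 + logGradDeriv m κ j X)
      = m j * X j ^ 2 - 2 * κ * ∑ k, m j * m k * X j * r j k + κ ^ 2 * (m j * (∑ k, m k * r j k) ^ 2)
        - 1 - κ * ∑ k, m k * r j k ^ 2 := by
    intro j
    have e1 : logGrad m κ j X = m j * (-X j + κ * ∑ k, m k * r j k) := by
      simp only [logGrad, mul_add, Finset.mul_sum, hr]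
      congr 1
      · ring
      · exact Finset.sum_congr rfl fun k _ => by ring
    have e2 : logGradDeriv m κ j X = m j * (-1 - κ * ∑ k, m k * r j k ^ 2) := by
      simp only [logGradDeriv, mul_sub, Finset.mul_sum, hr]
      congr 1
      · ring
      · exact Finset.sum_congr rfl fun k _ => by ring
    have e3 : ∑ k, m j * m k * X j * r j k = m j * X j * ∑ k, m k * r j k := by
      rw [Finset.mul_sum]; exact Finset.sum_congr rfl fun k _ => by ring
    rw [e1, e2, e3]
    have := hm j
    field_simp
    ring
  have hr2 : ∑ j, ∑ k, m j * m k * X j * (X j - X k)⁻¹ = ∑ j, ∑ k, m j * m k * X j * r j k := rfl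
  rw [hr2] at h2
  simp only [hj, Finset.sum_sub_distrib, Finset.sum_add_distrib, ← Finset.mul_sum, h3, ← hQ,
    groundEnergy]
  linear_combination κ * h2 + κ / 2 * hS

theorem hasLineDerivAt_mul {E : Type*} [NormedAddCommGroup E] [NormedSpace ℝ E] {f g : E → ℂ}
    {f' g' : ℂ} {x v : E} (hf : HasLineDerivAt ℝ f f' x v) (hg : HasLineDerivAt ℝ g g' x v) :
    HasLineDerivAt ℝ (fun y => f y * g y) (f' * g x + f x * g') x v := by
  have := HasDerivAt.fun_mul hf hg
  simpa [HasLineDerivAt] using this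

theorem hasLineDerivAt_add {E : Type*} [NormedAddCommGroup E] [NormedSpace ℝ E] {f g : E → ℂ}
    {f' g' : ℂ} {x v : E} (hf : HasLineDerivAt ℝ f f' x v) (hg : HasLineDerivAt ℝ g g' x v) :
    HasLineDerivAt ℝ (fun y => f y + g y) (f' + g') x v :=
  HasDerivAt.add hf hg

theorem partialDeriv_eq_fderiv {g : (Fin N → ℝ) → ℂ} (hg : ContDiff ℝ ∞ g) (j : Fin N) :
    partialDeriv j g = fun X => fderiv ℝ g X (Pi.single j 1) :=
  funext fun X => ((hg.differentiable (by simp)) X).lineDeriv_eq_fderiv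

theorem contDiff_partialDeriv {g : (Fin N → ℝ) → ℂ} (hg : ContDiff ℝ ∞ g) (j : Fin N) :
    ContDiff ℝ ∞ (partialDeriv j g) := by
  rw [partialDeriv_eq_fderiv hg]
  exact (hg.fderiv_right (m := ∞) (by simp)).clm_apply contDiff_const

theorem hasLineDerivAt_partialDeriv {g : (Fin N → ℝ) → ℂ} (hg : ContDiff ℝ ∞ g) (j : Fin N)
    (X : Fin N → ℝ) : HasLineDerivAt ℝ g (partialDeriv j g X) X (Pi.single j 1) :=
  ((hg.differentiable (by simp)) X).lineDifferentiableAt.hasLineDerivAt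

theorem hasLineDerivAt_logGrad {X : Fin N → ℝ} (hX : X ∈ configSpace N) (j : Fin N) :
    HasLineDerivAt ℝ (fun X => (logGrad m κ j X : ℂ)) (logGradDeriv m κ j X : ℂ) X
      (Pi.single j 1) := by
  refine HasDerivAt.ofReal_comp ?_
  have h : ∀ i, HasDerivAt (fun t : ℝ => (X + t • (Pi.single j 1 : Fin N → ℝ)) i)
      ((Pi.single j 1 : Fin N → ℝ) i) 0 := fun i => by
    simpa using ((hasDerivAt_id (0 : ℝ)).mul_const ((Pi.single j 1 : Fin N → ℝ) i)).const_add (X i)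
  unfold logGrad logGradDeriv
  rw [sub_eq_add_neg, ← Finset.sum_neg_distrib]
  refine HasDerivAt.add ?_ (HasDerivAt.fun_sum fun k _ => ?_)
  · simpa using ((h j).const_mul (m j)).fun_neg
  · by_cases hk : k = j
    · subst hk
      simpa using hasDerivAt_const (0 : ℝ) (0 : ℝ)
    · have hne := sub_ne_zero_of_mem_configSpace hX (Ne.symm hk)
      have := (((h j).sub (h k)).inv (by simpa using hne)).const_mul (κ * m j * m k)
      convert! this using 1
      simp [hk, div_eq_mul_inv]

/-- The operator `Φ₀⁻¹ (𝓗 - 𝓔₀) Φ₀`. -/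
def gaugedOp (m : Fin N → ℝ) (κ : ℝ) (g : (Fin N → ℝ) → ℂ) (X : Fin N → ℝ) : ℂ :=
  -∑ j, ((1 / m j : ℝ) : ℂ) * (partialDeriv j (partialDeriv j g) X
    + 2 * (logGrad m κ j X : ℂ) * partialDeriv j g X)

/-- By the product rule the zeroth-order coefficient is the left side of `riccati_identity`, a
constant. Taking `g = 1` gives the eigenvalue equation. -/
theorem hamiltonian_groundStateFun_mul (hm : ∀ j, m j ≠ 0) {g : (Fin N → ℝ) → ℂ}
    (hg : ContDiff ℝ ∞ g) {X : Fin N → ℝ} (hX : X ∈ configSpace N) :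
    hamiltonian m κ (fun X => groundStateFun m κ X * g X) X
      = (groundEnergy m κ : ℂ) * (groundStateFun m κ X * g X)
        + groundStateFun m κ X * gaugedOp m κ g X := by
  have h1 : ∀ j, ∀ Y ∈ configSpace N, HasLineDerivAt ℝ (fun X => groundStateFun m κ X * g X)
      (groundStateFun m κ Y * ((logGrad m κ j Y : ℂ) * g Y + partialDeriv j g Y)) Y
      (Pi.single j 1) := by
    intro j Y hY
    convert! hasLineDerivAt_mul (hasLineDerivAt_groundStateFun hY j)
      (hasLineDerivAt_partialDeriv hg j Y) using 1
    ring
  have h2 : ∀ j, partialDeriv j (partialDeriv j (fun X => groundStateFun m κ X * g X)) X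
      = groundStateFun m κ X * (((logGrad m κ j X ^ 2 + logGradDeriv m κ j X : ℝ) : ℂ) * g X
        + (partialDeriv j (partialDeriv j g) X
          + 2 * (logGrad m κ j X : ℂ) * partialDeriv j g X)) := by
    intro j
    -- The formula for the first derivative is needed on a neighbourhood, as it is differentiated
    -- once more.
    have he : partialDeriv j (fun X => groundStateFun m κ X * g X) =ᶠ[𝓝 X] fun Y =>
        groundStateFun m κ Y * ((logGrad m κ j Y : ℂ) * g Y + partialDeriv j g Y) := by
      filter_upwards [(isOpen_configSpace N).mem_nhds hX] with Y hY using (h1 j Y hY).lineDeriv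
    have h3 := hasLineDerivAt_mul (hasLineDerivAt_groundStateFun (κ := κ) (m := m) hX j)
      (hasLineDerivAt_add (hasLineDerivAt_mul (hasLineDerivAt_logGrad (κ := κ) (m := m) hX j)
        (hasLineDerivAt_partialDeriv hg j X))
        (hasLineDerivAt_partialDeriv (contDiff_partialDeriv hg j) j X))
    refine (h3.congr_of_eventuallyEq he).lineDeriv.trans ?_
    push_cast
    ring
  have h4 := congrArg (fun x : ℝ => (x : ℂ)) (riccati_identity (κ := κ) hm hX)
  simp only [Complex.ofReal_add, Complex.ofReal_neg, Complex.ofReal_mul] at h4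
  unfold hamiltonian gaugedOp
  simp only [h2]
  have h5 : ∑ j, ((1 / m j : ℝ) : ℂ) * (groundStateFun m κ X *
      (((logGrad m κ j X ^ 2 + logGradDeriv m κ j X : ℝ) : ℂ) * g X
        + (partialDeriv j (partialDeriv j g) X
          + 2 * (logGrad m κ j X : ℂ) * partialDeriv j g X)))
      = groundStateFun m κ X * g X *
        ((∑ j, 1 / m j * (logGrad m κ j X ^ 2 + logGradDeriv m κ j X) : ℝ) : ℂ)
        + groundStateFun m κ X * ∑ j, ((1 / m j : ℝ) : ℂ) * (partialDeriv j (partialDeriv j g) X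
          + 2 * (logGrad m κ j X : ℂ) * partialDeriv j g X) := by
    rw [Complex.ofReal_sum, Finset.mul_sum, Finset.mul_sum, ← Finset.sum_add_distrib]
    refine Finset.sum_congr rfl fun j _ => ?_
    push_cast
    ring
  rw [h5]
  simp only [Complex.ofReal_mul]
  linear_combination (groundStateFun m κ X * g X) * h4

theorem gaugedOp_one (X : Fin N → ℝ) : gaugedOp m κ (fun _ => 1) X = 0 := by
  have h : ∀ (c : ℂ) (j : Fin N), partialDeriv j (fun _ : Fin N → ℝ => c) = fun _ => 0 :=
    fun c j => funext fun X => by simp [partialDeriv, lineDeriv]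
  simp [gaugedOp, h]

theorem hamiltonian_groundStateFun (hm : ∀ j, m j ≠ 0) {X : Fin N → ℝ} (hX : X ∈ configSpace N) :
    hamiltonian m κ (groundStateFun m κ) X
      = (groundEnergy m κ : ℂ) * groundStateFun m κ X := by
  have := hamiltonian_groundStateFun_mul (κ := κ) hm (g := fun _ => 1) contDiff_const hX
  simpa [gaugedOp_one] using this

end Hamiltonian

/-! ### Logarithmic cutoffs near the collision hyperplanes. -/

section CollisionCutoff

theorem exists_bound_deriv_smoothTransition :
    ∃ C : ℝ, 0 ≤ C ∧ ∀ t, |deriv Real.smoothTransition t| ≤ C := by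
  have hc : Continuous (deriv Real.smoothTransition) :=
    (Real.smoothTransition.contDiff (n := 1)).continuous_deriv (by simp)
  obtain ⟨C, hC⟩ := isCompact_Icc.exists_bound_of_continuousOn (s := Set.Icc (0 : ℝ) 1)
    hc.continuousOn
  refine ⟨max C 0, le_max_right _ _, fun t => ?_⟩
  by_cases ht : t ∈ Set.Icc (0 : ℝ) 1
  · exact (hC t ht).trans (le_max_left _ _)
  · have : deriv Real.smoothTransition t = 0 := by
      rcases not_and_or.1 ht with h | h
      · have : Real.smoothTransition =ᶠ[𝓝 t] fun _ => 0 := by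
          filter_upwards [gt_mem_nhds (not_le.1 h)] with s hs
            using Real.smoothTransition.zero_of_nonpos hs.le
        rw [this.deriv_eq]; simp
      · have : Real.smoothTransition =ᶠ[𝓝 t] fun _ => 1 := by
          filter_upwards [lt_mem_nhds (not_le.1 h)] with s hs
            using Real.smoothTransition.one_of_one_le hs.le
        rw [this.deriv_eq]; simp
    rw [this]; simp

theorem deriv_smoothTransition_of_nonpos {t : ℝ} (ht : t < 0) :
    deriv Real.smoothTransition t = 0 := by
  have : Real.smoothTransition =ᶠ[𝓝 t] fun _ => 0 := by
    filter_upwards [gt_mem_nhds ht] with s hs using Real.smoothTransition.zero_of_nonpos hs.le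
  rw [this.deriv_eq]; simp

/-- A smooth function that vanishes on `t ≤ exp (-2 (n + 1))` and equals one on
`exp (-(n + 1)) ≤ t`, with logarithmic derivative `O(1 / n)`. -/
def logCutoff (n : ℕ) (t : ℝ) : ℝ :=
  -- The separate case matters at collisions: `Real.log 0 = 0` would give the value one there.
  if t ≤ 0 then 0 else Real.smoothTransition (2 + Real.log t / (n + 1))

theorem logCutoff_eq_zero {n : ℕ} {t : ℝ} (ht : t ≤ Real.exp (-2 * (n + 1))) :
    logCutoff n t = 0 := by
  unfold logCutoff
  split_ifs with h
  · rfl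
  · refine Real.smoothTransition.zero_of_nonpos ?_
    have h1 : Real.log t ≤ -2 * (n + 1) := by
      rw [← Real.log_exp (-2 * ((n : ℝ) + 1))]; exact Real.log_le_log (not_le.1 h) ht
    have h2 : (0 : ℝ) < n + 1 := by positivity
    have : Real.log t / (n + 1) ≤ -2 := by rwa [div_le_iff₀ h2]
    linarith

theorem logCutoff_eventuallyEq {n : ℕ} {t : ℝ} (ht : 0 < t) :
    logCutoff n =ᶠ[𝓝 t] fun s => Real.smoothTransition (2 + Real.log s / (n + 1)) := by
  filter_upwards [lt_mem_nhds ht] with s hs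
  simp [logCutoff, hs]

theorem contDiff_logCutoff (n : ℕ) : ContDiff ℝ ∞ (logCutoff n) := by
  rw [contDiff_iff_contDiffAt]
  intro t
  rcases lt_or_ge 0 t with ht | ht
  · refine ContDiffAt.congr_of_eventuallyEq ?_ (logCutoff_eventuallyEq ht)
    exact Real.smoothTransition.contDiff.contDiffAt.comp t
      (contDiffAt_const.add ((Real.contDiffAt_log.2 ht.ne').div_const _))
  · refine (contDiffAt_const (c := (0 : ℝ))).congr_of_eventuallyEq ?_
    filter_upwards [gt_mem_nhds (ht.trans_lt (Real.exp_pos (-2 * ((n : ℝ) + 1))))] with s hs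
      using logCutoff_eq_zero hs.le

theorem hasDerivAt_logCutoff (n : ℕ) {t : ℝ} (ht : 0 < t) :
    HasDerivAt (logCutoff n)
      (deriv Real.smoothTransition (2 + Real.log t / (n + 1)) / (n + 1) * t⁻¹) t := by
  have h1 : HasDerivAt Real.smoothTransition _ (2 + Real.log t / (n + 1)) :=
    ((Real.smoothTransition.contDiff (n := 1)).differentiable (by simp) _).hasDerivAt
  have h2 := ((Real.hasDerivAt_log ht.ne').div_const ((n : ℝ) + 1)).const_add 2
  refine HasDerivAt.congr_of_eventuallyEq ?_ (logCutoff_eventuallyEq ht)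
  convert! h1.comp t h2 using 1
  field_simp

variable {N : ℕ}

/-- The square of the Vandermonde determinant. -/
def discr (X : Fin N → ℝ) : ℝ := ∏ j, ∏ k ∈ Finset.Ioi j, (X k - X j) ^ 2

theorem discr_pos {X : Fin N → ℝ} (hX : X ∈ configSpace N) : 0 < discr X :=
  Finset.prod_pos fun _ _ => Finset.prod_pos fun _ hk =>
    sq_pos_of_ne_zero (sub_ne_zero_of_mem_configSpace hX (Finset.mem_Ioi.1 hk).ne')

theorem discr_eq_zero {X : Fin N → ℝ} (hX : X ∉ configSpace N) : discr X = 0 := by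
  simp only [configSpace, Set.mem_ofPred_eq, Function.Injective, not_forall] at hX
  obtain ⟨a, b, hab, hne⟩ := hX
  wlog h : a < b generalizing a b
  · exact this b a hab.symm (Ne.symm hne) (lt_of_le_of_ne (not_lt.1 h) (Ne.symm hne))
  · exact Finset.prod_eq_zero (Finset.mem_univ a)
      (Finset.prod_eq_zero (Finset.mem_Ioi.2 h) (by simp [hab]))

theorem contDiff_discr : ContDiff ℝ ∞ (discr (N := N)) := by
  unfold discr
  exact contDiff_prod fun j _ => contDiff_prod fun k _ => by fun_prop

theorem hasLineDerivAt_discr {X : Fin N → ℝ} (hX : X ∈ configSpace N) (i : Fin N) :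
    HasLineDerivAt ℝ discr (discr X * (2 * ∑ k, (X i - X k)⁻¹)) X (Pi.single i 1) := by
  set e : Fin N → ℝ := Pi.single i 1 with he
  have hl : 2 * ∑ k, (X i - X k)⁻¹
      = ∑ j, ∑ k ∈ Finset.Ioi j, (2 * (X k - X j)⁻¹ * (e k - e j)) := by
    rw [sum_sum_Ioi_antisymm_mul_sub (c := fun j k => 2 * (X k - X j)⁻¹), Finset.mul_sum]
    intro a b
    rw [← neg_sub (X a) (X b), inv_neg]; ring
  rw [hl, HasLineDerivAt]
  unfold discr
  have := hasDerivAt_finset_prod_of_log (x := 0) Finset.univ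
    (f := fun j (t : ℝ) => ∏ k ∈ Finset.Ioi j, ((X + t • e) k - (X + t • e) j) ^ 2)
    (l := fun j => ∑ k ∈ Finset.Ioi j, (2 * (X k - X j)⁻¹ * (e k - e j))) ?_
  · simpa using this
  · intro j _
    refine hasDerivAt_finset_prod_of_log _ fun k hk => ?_
    have hlin : HasDerivAt (fun t : ℝ => (X + t • e) k - (X + t • e) j) (e k - e j) 0 := by
      have h : ∀ i, HasDerivAt (fun t : ℝ => (X + t • e) i) (e i) 0 := fun i => by
        simpa using ((hasDerivAt_id (0 : ℝ)).mul_const (e i)).const_add (X i)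
      exact (h k).sub (h j)
    have hne := sub_ne_zero_of_mem_configSpace hX (Finset.mem_Ioi.1 hk).ne'
    convert! hlin.pow 2 using 1
    simp
    field_simp

/-- A smooth cutoff that vanishes near the collision hyperplanes. -/
def collisionCutoff (n : ℕ) (X : Fin N → ℝ) : ℝ := logCutoff n (discr X)

theorem contDiff_collisionCutoff (n : ℕ) : ContDiff ℝ ∞ (collisionCutoff (N := N) n) :=
  (contDiff_logCutoff n).comp contDiff_discr

theorem collisionCutoff_mem_Icc (n : ℕ) (X : Fin N → ℝ) :
    collisionCutoff n X ∈ Set.Icc (0 : ℝ) 1 := by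
  unfold collisionCutoff logCutoff
  split_ifs
  · simp
  · exact ⟨Real.smoothTransition.nonneg _, Real.smoothTransition.le_one _⟩

theorem tsupport_collisionCutoff_subset (n : ℕ) :
    tsupport (collisionCutoff (N := N) n) ⊆ configSpace N := by
  have h : tsupport (collisionCutoff (N := N) n) ⊆ {X | Real.exp (-2 * (n + 1)) ≤ discr X} := by
    refine closure_minimal (fun X hX => ?_)
      (isClosed_le continuous_const contDiff_discr.continuous)
    by_contra hlt
    exact hX (logCutoff_eq_zero (not_le.1 hlt).le)
  intro X hX
  by_contra hc
  have := h hX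
  rw [Set.mem_ofPred_eq, discr_eq_zero hc] at this
  exact absurd this (not_le.2 (Real.exp_pos _))

theorem tendsto_collisionCutoff {X : Fin N → ℝ} (hX : X ∈ configSpace N) :
    Tendsto (fun n => collisionCutoff n X) atTop (𝓝 1) := by
  have h1 : Tendsto (fun n : ℕ => 2 + Real.log (discr X) / ((n : ℝ) + 1)) atTop (𝓝 2) := by
    have h2 : Tendsto (fun n : ℕ => (n : ℝ) + 1) atTop atTop :=
      tendsto_atTop_add_const_right _ _ tendsto_natCast_atTop_atTop
    simpa using (tendsto_const_nhds (x := (2 : ℝ))).add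
      ((tendsto_const_nhds (x := Real.log (discr X))).div_atTop h2)
  refine tendsto_const_nhds.congr' ?_
  filter_upwards [h1.eventually (lt_mem_nhds (show (1 : ℝ) < 2 by norm_num))] with n hn
  rw [collisionCutoff, logCutoff, if_neg (not_le.2 (discr_pos hX)),
    Real.smoothTransition.one_of_one_le hn.le]

/-- `log (discr X)` has derivative `2 ∑ 1/(X_i - X_k)`. The scalar `b` is the same for all
directions, so the collision condition can cancel the poles in Green's formula; it vanishes for
small discriminant, which bounds the gaps from below in the capacity estimate. -/
theorem exists_hasLineDerivAt_collisionCutoff (N : ℕ) : ∃ C : ℝ, 0 ≤ C ∧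
    ∀ (n : ℕ) (X : Fin N → ℝ), X ∈ configSpace N → ∃ b : ℝ, |b| ≤ C ∧
      (discr X < Real.exp (-2 * (n + 1)) → b = 0) ∧
      ∀ i, HasLineDerivAt ℝ (collisionCutoff n) (b / (n + 1) * ∑ k, (X i - X k)⁻¹) X
        (Pi.single i 1) := by
  obtain ⟨C, hC, hb⟩ := exists_bound_deriv_smoothTransition
  refine ⟨2 * C, by positivity, fun n X hX =>
    ⟨2 * deriv Real.smoothTransition (2 + Real.log (discr X) / (n + 1)), ?_, fun h => ?_,
      fun i => ?_⟩⟩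
  · rw [abs_mul, abs_two]
    exact mul_le_mul_of_nonneg_left (hb _) zero_le_two
  · rw [deriv_smoothTransition_of_nonpos, mul_zero]
    have h1 : Real.log (discr X) < -2 * (n + 1) := by
      rw [← Real.log_exp (-2 * ((n : ℝ) + 1))]; exact Real.log_lt_log (discr_pos hX) h
    have h2 : (0 : ℝ) < n + 1 := by positivity
    have : Real.log (discr X) / (n + 1) < -2 := by rwa [div_lt_iff₀ h2]
    linarith
  · have h0 : X + (0 : ℝ) • (Pi.single i 1 : Fin N → ℝ) = X := by simp
    have hd := hasDerivAt_logCutoff n (discr_pos hX)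
    have h1 := hasLineDerivAt_discr hX i
    rw [HasLineDerivAt] at h1 ⊢
    have h2 : HasDerivAt (logCutoff n) _ (discr (X + (0 : ℝ) • (Pi.single i 1 : Fin N → ℝ))) :=
      h0.symm ▸ hd
    convert! h2.comp (0 : ℝ) h1 using 1
    rw [h0]
    have := (discr_pos hX).ne'
    field_simp

end CollisionCutoff

/-! ### Bounds for the conjugated operator and integration by parts. -/

section Green

open scoped ComplexConjugate

variable {N : ℕ} {m : Fin N → ℝ} {κ : ℝ}

theorem hasCompactSupport_partialDeriv {g : (Fin N → ℝ) → ℂ} (hg : ContDiff ℝ ∞ g)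
    (hc : HasCompactSupport g) (j : Fin N) : HasCompactSupport (partialDeriv j g) := by
  rw [partialDeriv_eq_fderiv hg]
  exact hc.fderiv_apply ℝ _

theorem exists_norm_le_of_hasCompactSupport {E : Type*} [TopologicalSpace E] {g : E → ℂ}
    (hg : Continuous g) (hc : HasCompactSupport g) : ∃ C, 0 ≤ C ∧ ∀ x, ‖g x‖ ≤ C := by
  obtain ⟨C, hC⟩ := hg.bounded_above_of_compact_support hc
  exact ⟨max C 0, le_max_right _ _, fun x => (hC x).trans (le_max_left _ _)⟩

/-- The condition on collision hyperplanes in the definition of `initialDomain`. -/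
def CollisionCompatible (m : Fin N → ℝ) (g : (Fin N → ℝ) → ℂ) : Prop :=
  ∀ (j k : Fin N) (X : Fin N → ℝ), X j = X k →
    (m k : ℂ) * partialDeriv j g X = (m j : ℂ) * partialDeriv k g X

/-- The difference is smooth with compact support, hence Lipschitz, and it vanishes at the point
obtained by replacing `X_j` with `X_k`, which is at distance `|X_j - X_k|` in the sup norm. -/
theorem CollisionCompatible.exists_norm_le {g : (Fin N → ℝ) → ℂ} (hg : ContDiff ℝ ∞ g)
    (hc : HasCompactSupport g) (h : CollisionCompatible m g) :
    ∃ C, 0 ≤ C ∧ ∀ j k X,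
      ‖(m k : ℂ) * partialDeriv j g X - (m j : ℂ) * partialDeriv k g X‖ ≤ C * |X j - X k| := by
  have key : ∀ j k, ∃ C : ℝ, 0 ≤ C ∧ ∀ X,
      ‖(m k : ℂ) * partialDeriv j g X - (m j : ℂ) * partialDeriv k g X‖ ≤ C * |X j - X k| := by
    intro j k
    by_cases hjk : j = k
    · exact ⟨0, le_rfl, fun X => by simp [hjk]⟩
    have h1 : ContDiff ℝ ∞ (fun X =>
        (m k : ℂ) * partialDeriv j g X - (m j : ℂ) * partialDeriv k g X) :=
      (contDiff_const.mul (contDiff_partialDeriv hg j)).sub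
        (contDiff_const.mul (contDiff_partialDeriv hg k))
    have h2 : HasCompactSupport (fun X =>
        (m k : ℂ) * partialDeriv j g X - (m j : ℂ) * partialDeriv k g X) :=
      ((hasCompactSupport_partialDeriv hg hc j).mul_left).sub
        (hasCompactSupport_partialDeriv hg hc k).mul_left
    obtain ⟨C, hC⟩ := h1.lipschitzWith_of_hasCompactSupport h2 (by simp)
    refine ⟨C, C.2, fun X => ?_⟩
    have h3 := hC.dist_le_mul X (Function.update X j (X k))
    have h4 : (m k : ℂ) * partialDeriv j g (Function.update X j (X k))
        - (m j : ℂ) * partialDeriv k g (Function.update X j (X k)) = 0 :=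
      sub_eq_zero.2 (h j k _ (by simp [Function.update_of_ne (Ne.symm hjk)]))
    rw [dist_eq_norm, h4, sub_zero] at h3
    refine h3.trans (mul_le_mul_of_nonneg_left ?_ C.2)
    refine (dist_pi_le_iff (abs_nonneg _)).2 fun i => ?_
    by_cases hi : i = j
    · subst hi; simp [Real.dist_eq]
    · simp [hi]
  choose C hC0 hC using key
  refine ⟨∑ j, ∑ k, C j k, Finset.sum_nonneg fun j _ => Finset.sum_nonneg fun k _ => hC0 j k,
    fun j k X => (hC j k X).trans (mul_le_mul_of_nonneg_right ?_ (abs_nonneg _))⟩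
  exact (Finset.single_le_sum (f := fun k => C j k) (fun k _ => hC0 j k) (Finset.mem_univ k)).trans
    (Finset.single_le_sum (f := fun j => ∑ k, C j k)
      (fun j _ => Finset.sum_nonneg fun k _ => hC0 j k) (Finset.mem_univ j))

/-- Exchanging `j` and `k` and averaging turns the singular sum into half the sum of `c_jk (m_k v_j
- m_j v_k) / (X_j - X_k)`, where the hypothesis cancels every pole. -/
theorem norm_sum_sum_inv_sub_le {c : Fin N → Fin N → ℝ} (hc : ∀ j k, c j k = c k j)
    {v : Fin N → ℂ} {C : ℝ} (hC : 0 ≤ C) {X : Fin N → ℝ}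
    (hv : ∀ j k, ‖(m k : ℂ) * v j - (m j : ℂ) * v k‖ ≤ C * |X j - X k|) :
    ‖∑ j, ∑ k, ((c j k * m k * (X j - X k)⁻¹ : ℝ) : ℂ) * v j‖ ≤ ∑ j, ∑ k, |c j k| * C := by
  set S := ∑ j, ∑ k, ((c j k * m k * (X j - X k)⁻¹ : ℝ) : ℂ) * v j with hS
  have h1 : S = ∑ j, ∑ k, -((c j k * m j * (X j - X k)⁻¹ : ℝ) : ℂ) * v k := by
    rw [hS, Finset.sum_comm]
    refine Finset.sum_congr rfl fun j _ => Finset.sum_congr rfl fun k _ => ?_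
    rw [hc, ← neg_sub (X j) (X k), inv_neg]
    push_cast; ring
  have h2 : 2 * S = ∑ j, ∑ k, ((c j k * (X j - X k)⁻¹ : ℝ) : ℂ)
      * ((m k : ℂ) * v j - (m j : ℂ) * v k) := by
    rw [two_mul]
    conv_lhs => enter [2]; rw [h1]
    rw [hS]
    simp only [← Finset.sum_add_distrib]
    refine Finset.sum_congr rfl fun j _ => Finset.sum_congr rfl fun k _ => ?_
    push_cast; ring
  have h3 : ‖2 * S‖ ≤ ∑ j, ∑ k, |c j k| * C := by
    rw [h2]
    refine (norm_sum_le _ _).trans (Finset.sum_le_sum fun j _ =>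
      (norm_sum_le _ _).trans (Finset.sum_le_sum fun k _ => ?_))
    rw [norm_mul, Complex.norm_real, Real.norm_eq_abs, abs_mul, mul_assoc]
    refine mul_le_mul_of_nonneg_left ?_ (abs_nonneg _)
    refine (mul_le_mul_of_nonneg_left (hv j k) (abs_nonneg _)).trans ?_
    rw [abs_inv, mul_left_comm]
    exact mul_le_of_le_one_right hC (inv_mul_le_one)
  rw [norm_mul] at h3
  norm_num at h3
  linarith [norm_nonneg S]

/-- Everything except the pole terms is continuous with compact support; the poles are controlled by
symmetrization. Thus `𝓗 (Φ₀ g)` is `Φ₀` times a bounded function, almost everywhere. -/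
theorem exists_norm_gaugedOp_le (hm : ∀ j, m j ≠ 0) {g : (Fin N → ℝ) → ℂ} (hg : ContDiff ℝ ∞ g)
    (hc : HasCompactSupport g) (h : CollisionCompatible m g) (κ : ℝ) :
    ∃ B, 0 ≤ B ∧ ∀ X, ‖gaugedOp m κ g X‖ ≤ B := by
  obtain ⟨C, hC0, hC⟩ := h.exists_norm_le hg hc
  have hreg : Continuous fun X : Fin N → ℝ => -∑ j, ((1 / m j : ℝ) : ℂ) *
      (partialDeriv j (partialDeriv j g) X) + 2 * ∑ j, (X j : ℂ) * partialDeriv j g X := by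
    have h1 := fun j => (contDiff_partialDeriv hg j).continuous
    have h2 := fun j => (contDiff_partialDeriv (contDiff_partialDeriv hg j) j).continuous
    fun_prop
  have hregc : HasCompactSupport fun X : Fin N → ℝ => -∑ j, ((1 / m j : ℝ) : ℂ) *
      (partialDeriv j (partialDeriv j g) X) + 2 * ∑ j, (X j : ℂ) * partialDeriv j g X := by
    refine HasCompactSupport.intro hc fun X hX => ?_
    have h0 : ∀ j, partialDeriv j g =ᶠ[𝓝 X] fun _ => 0 := by
      intro j
      have : ∀ᶠ Y in 𝓝 X, g =ᶠ[𝓝 Y] fun _ => 0 :=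
        ((notMem_tsupport_iff_eventuallyEq.1 hX)).eventually_nhds
      filter_upwards [this] with Y hY
      rw [partialDeriv, hY.lineDeriv_eq]
      simp [lineDeriv]
    have h1 : ∀ j, partialDeriv j (partialDeriv j g) X = 0 := by
      intro j
      rw [partialDeriv, (h0 j).lineDeriv_eq]
      simp [lineDeriv]
    simp [h1, fun j => (h0 j).self_of_nhds]
  obtain ⟨B, hB0, hB⟩ := exists_norm_le_of_hasCompactSupport hreg hregc
  refine ⟨B + 2 * ∑ j : Fin N, ∑ k : Fin N, |κ| * C, by positivity, fun X => ?_⟩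
  have h1 : gaugedOp m κ g X = (-∑ j, ((1 / m j : ℝ) : ℂ) *
      (partialDeriv j (partialDeriv j g) X) + 2 * ∑ j, (X j : ℂ) * partialDeriv j g X)
      - 2 * ∑ j, ∑ k, ((κ * m k * (X j - X k)⁻¹ : ℝ) : ℂ) * partialDeriv j g X := by
    unfold gaugedOp
    simp only [← Finset.sum_neg_distrib, Finset.mul_sum, ← Finset.sum_add_distrib,
      ← Finset.sum_sub_distrib]
    refine Finset.sum_congr rfl fun j _ => ?_
    have h2 : (logGrad m κ j X : ℂ) = (m j : ℂ) * (-(X j : ℂ) +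
        ∑ k, ((κ * m k * (X j - X k)⁻¹ : ℝ) : ℂ)) := by
      simp only [logGrad, mul_add, Finset.mul_sum]
      push_cast
      congr 1
      · ring
      · exact Finset.sum_congr rfl fun k _ => by ring
    have hmj : (m j : ℂ) ≠ 0 := Complex.ofReal_ne_zero.2 (hm j)
    rw [h2, ← Finset.mul_sum, ← Finset.sum_mul]
    push_cast
    field_simp
    ring
  rw [h1]
  refine (norm_sub_le _ _).trans (add_le_add (hB X) ?_)
  rw [norm_mul, Complex.norm_ofNat]
  exact mul_le_mul_of_nonneg_left
    (norm_sum_sum_inv_sub_le (c := fun _ _ => κ) (fun _ _ => rfl) hC0 fun j k => hC j k X)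
    zero_le_two

theorem measurable_logGrad (j : Fin N) : Measurable (logGrad m κ j) := by
  unfold logGrad
  fun_prop

theorem measurable_gaugedOp {g : (Fin N → ℝ) → ℂ} (hg : ContDiff ℝ ∞ g) :
    Measurable (gaugedOp m κ g) := by
  unfold gaugedOp
  have h1 := fun j => (contDiff_partialDeriv hg j).continuous.measurable
  have h2 := fun j => (contDiff_partialDeriv (contDiff_partialDeriv hg j) j).continuous.measurable
  have h3 := fun j => measurable_logGrad (m := m) (κ := κ) j
  fun_prop

/-- The density `|Φ₀|²`. -/
def weight (m : Fin N → ℝ) (κ : ℝ) (X : Fin N → ℝ) : ℝ := ‖groundStateFun m κ X‖ ^ 2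

theorem weight_nonneg (X : Fin N → ℝ) : 0 ≤ weight m κ X := sq_nonneg _

theorem integrable_weight (hΦ : MemLp (groundStateFun m κ) 2 (volume : Measure (Fin N → ℝ))) :
    Integrable (weight m κ) := (memLp_two_iff_integrable_sq_norm hΦ.1).1 hΦ

theorem contDiffOn_weight : ContDiffOn ℝ ∞ (weight m κ) (configSpace N) :=
  (contDiffOn_groundStateFun m κ).norm_sq ℝ

theorem ofReal_weight (X : Fin N → ℝ) :
    (weight m κ X : ℂ) = conj (groundStateFun m κ X) * groundStateFun m κ X := by
  rw [Complex.conj_mul', weight]; push_cast; rfl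

theorem hasLineDerivAt_conj {E : Type*} [NormedAddCommGroup E] [NormedSpace ℝ E] {f : E → ℂ}
    {f' : ℂ} {x v : E} (hf : HasLineDerivAt ℝ f f' x v) :
    HasLineDerivAt ℝ (fun y => conj (f y)) (conj f') x v :=
  Complex.conjCLE.hasFDerivAt.comp_hasDerivAt (0 : ℝ) hf

theorem hasLineDerivAt_weight {X : Fin N → ℝ} (hX : X ∈ configSpace N) (i : Fin N) :
    HasLineDerivAt ℝ (fun X => (weight m κ X : ℂ)) (weight m κ X * (2 * (logGrad m κ i X : ℂ))) X
      (Pi.single i 1) := by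
  simp only [ofReal_weight]
  have h := hasLineDerivAt_groundStateFun (m := m) (κ := κ) hX i
  convert! hasLineDerivAt_mul (hasLineDerivAt_conj h) h using 1
  simp only [map_mul, Complex.conj_ofReal]
  ring

theorem contDiff_mul_of_tsupport_subset {χ : (Fin N → ℝ) → ℝ} (hχ : ContDiff ℝ ∞ χ)
    (hs : tsupport χ ⊆ configSpace N) {f : (Fin N → ℝ) → ℂ}
    (hf : ContDiffOn ℝ ∞ f (configSpace N)) : ContDiff ℝ ∞ fun X => (χ X : ℂ) * f X := by
  rw [contDiff_iff_contDiffAt]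
  intro X
  by_cases hX : X ∈ tsupport χ
  · exact (Complex.ofRealCLM.contDiff.contDiffAt.comp X hχ.contDiffAt).mul
      (hf.contDiffAt ((isOpen_configSpace N).mem_nhds (hs hX)))
  · refine (contDiffAt_const (c := (0 : ℂ))).congr_of_eventuallyEq ?_
    filter_upwards [notMem_tsupport_iff_eventuallyEq.1 hX] with Y hY
    simp [hY]

theorem integral_mul_partialDeriv_add {f g : (Fin N → ℝ) → ℂ} (hf : ContDiff ℝ ∞ f)
    (hg : ContDiff ℝ ∞ g) (hc : HasCompactSupport g) (j : Fin N) :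
    Integrable (fun X => f X * partialDeriv j g X + partialDeriv j f X * g X) ∧
      ∫ X, (f X * partialDeriv j g X + partialDeriv j f X * g X) = 0 := by
  have hf' := (contDiff_partialDeriv hf j).continuous
  have hg' := (contDiff_partialDeriv hg j).continuous
  have i1 : Integrable fun X => f X * partialDeriv j g X :=
    (hf.continuous.mul hg').integrable_of_hasCompactSupport
      (hasCompactSupport_partialDeriv hg hc j).mul_left
  have i2 : Integrable fun X => partialDeriv j f X * g X :=
    (hf'.mul hg.continuous).integrable_of_hasCompactSupport hc.mul_left
  have i3 : Integrable fun X => f X * g X :=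
    (hf.continuous.mul hg.continuous).integrable_of_hasCompactSupport hc.mul_left
  refine ⟨i1.add i2, ?_⟩
  rw [integral_add i1 i2]
  simp only [partialDeriv_eq_fderiv hf, partialDeriv_eq_fderiv hg] at i1 i2 ⊢
  rw [integral_mul_fderiv_eq_neg_fderiv_mul_of_integrable i2 i1 i3
    (fun x _ => hf.differentiable (by simp) x) (fun x _ => hg.differentiable (by simp) x)]
  ring

end Green

/-! ### Green's formula for the weighted Dirichlet form. -/

section GreenFormula

open scoped ComplexConjugate

variable {N : ℕ} {m : Fin N → ℝ} {κ : ℝ}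

/-- The density of the quadratic form of `𝓗 - 𝓔₀`, without the weight. -/
def gradProd (m : Fin N → ℝ) (h g : (Fin N → ℝ) → ℂ) (X : Fin N → ℝ) : ℂ :=
  ∑ j, ((1 / m j : ℝ) : ℂ) * (conj (partialDeriv j h X) * partialDeriv j g X)

theorem norm_gradProd_le {h g : (Fin N → ℝ) → ℂ} {A B : ℝ} {X : Fin N → ℝ}
    (h1 : ∀ j, ‖partialDeriv j h X‖ ≤ A) (h2 : ∀ j, ‖partialDeriv j g X‖ ≤ B) :
    ‖gradProd m h g X‖ ≤ (∑ j, |1 / m j|) * (A * B) := by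
  unfold gradProd
  rw [Finset.sum_mul]
  refine (norm_sum_le _ _).trans (Finset.sum_le_sum fun j _ => ?_)
  rw [norm_mul, Complex.norm_real, Real.norm_eq_abs, norm_mul, RCLike.norm_conj]
  exact mul_le_mul_of_nonneg_left
    (mul_le_mul (h1 j) (h2 j) (norm_nonneg _) ((norm_nonneg _).trans (h1 j))) (abs_nonneg _)

theorem exists_norm_partialDeriv_le {g : (Fin N → ℝ) → ℂ} (hg : ContDiff ℝ ∞ g)
    (hc : HasCompactSupport g) : ∃ C, 0 ≤ C ∧ ∀ j X, ‖partialDeriv j g X‖ ≤ C := by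
  have := fun j => exists_norm_le_of_hasCompactSupport (contDiff_partialDeriv hg j).continuous
    (hasCompactSupport_partialDeriv hg hc j)
  choose C hC0 hC using this
  exact ⟨∑ j, C j, Finset.sum_nonneg fun j _ => hC0 j, fun j X => (hC j X).trans
    (Finset.single_le_sum (f := C) (fun j _ => hC0 j) (Finset.mem_univ j))⟩

theorem hasLineDerivAt_ofReal {E : Type*} [NormedAddCommGroup E] [NormedSpace ℝ E] {f : E → ℝ}
    {f' : ℝ} {x v : E} (hf : HasLineDerivAt ℝ f f' x v) :
    HasLineDerivAt ℝ (fun y => (f y : ℂ)) (f' : ℂ) x v :=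
  HasDerivAt.ofReal_comp hf

/-- The logarithmic derivative of the weight is `2 L_j`, so differentiating it cancels the
first-order term of `gaugedOp`. Only the gradient product and a term with the gradient of the cutoff
survive. -/
theorem gaugedOp_ibp_pointwise {χ : (Fin N → ℝ) → ℝ} {h g : (Fin N → ℝ) → ℂ}
    (hh : ContDiff ℝ ∞ h) {X : Fin N → ℝ} (hX : X ∈ configSpace N)
    {χ' : Fin N → ℝ} (hχ' : ∀ j, HasLineDerivAt ℝ χ (χ' j) X (Pi.single j 1)) :
    (χ X : ℂ) * ((weight m κ X : ℂ) * conj (h X)) * gaugedOp m κ g X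
      + ∑ j, ((1 / m j : ℝ) : ℂ) *
        ((χ X : ℂ) * ((weight m κ X : ℂ) * conj (h X)) * partialDeriv j (partialDeriv j g) X
          + partialDeriv j (fun X => (χ X : ℂ) * ((weight m κ X : ℂ) * conj (h X))) X
            * partialDeriv j g X)
      = (weight m κ X : ℂ) * ((χ X : ℂ) * gradProd m h g X
        + conj (h X) * ∑ j, ((1 / m j : ℝ) : ℂ) * (χ' j * partialDeriv j g X)) := by
  have h1 : ∀ j, partialDeriv j (fun X => (χ X : ℂ) * ((weight m κ X : ℂ) * conj (h X))) X
      = (χ' j : ℂ) * ((weight m κ X : ℂ) * conj (h X))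
        + (χ X : ℂ) * ((weight m κ X : ℂ) * (2 * (logGrad m κ j X : ℂ)) * conj (h X)
          + (weight m κ X : ℂ) * conj (partialDeriv j h X)) := fun j =>
    (hasLineDerivAt_mul (hasLineDerivAt_ofReal (hχ' j)) (hasLineDerivAt_mul
      (hasLineDerivAt_weight hX j)
      (hasLineDerivAt_conj (hasLineDerivAt_partialDeriv hh j X)))).lineDeriv
  simp only [h1]
  unfold gaugedOp gradProd
  simp only [mul_neg, mul_add, Finset.mul_sum, ← Finset.sum_neg_distrib, ← Finset.sum_add_distrib]
  exact Finset.sum_congr rfl fun j _ => by ring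

/-- The cutoff vanishes near all collisions, so `χ |Φ₀|² conj h` is smooth on the whole space, and
the compact support of `g` removes boundary terms. -/
theorem integral_collisionCutoff_mul_gaugedOp {χ : (Fin N → ℝ) → ℝ} (hχ : ContDiff ℝ ∞ χ)
    (hs : tsupport χ ⊆ configSpace N) {h g : (Fin N → ℝ) → ℂ} (hh : ContDiff ℝ ∞ h)
    (hg : ContDiff ℝ ∞ g) (hc : HasCompactSupport g) :
    Integrable (fun X => ∑ j, ((1 / m j : ℝ) : ℂ) *
        ((χ X : ℂ) * ((weight m κ X : ℂ) * conj (h X)) * partialDeriv j (partialDeriv j g) X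
          + partialDeriv j (fun X => (χ X : ℂ) * ((weight m κ X : ℂ) * conj (h X))) X
            * partialDeriv j g X)) ∧
      ∫ X, ∑ j, ((1 / m j : ℝ) : ℂ) *
        ((χ X : ℂ) * ((weight m κ X : ℂ) * conj (h X)) * partialDeriv j (partialDeriv j g) X
          + partialDeriv j (fun X => (χ X : ℂ) * ((weight m κ X : ℂ) * conj (h X))) X
            * partialDeriv j g X) = 0 := by
  have hf : ContDiff ℝ ∞ fun X => (χ X : ℂ) * ((weight m κ X : ℂ) * conj (h X)) :=
    contDiff_mul_of_tsupport_subset hχ hs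
      ((Complex.ofRealCLM.contDiff.comp_contDiffOn contDiffOn_weight).mul
        (Complex.conjCLE.contDiff.comp hh).contDiffOn)
  have key := fun j => integral_mul_partialDeriv_add hf (contDiff_partialDeriv hg j)
    (hasCompactSupport_partialDeriv hg hc j) j
  refine ⟨integrable_finsetSum _ fun j _ => (key j).1.const_mul _, ?_⟩
  rw [integral_finsetSum _ fun j _ => (key j).1.const_mul _]
  exact Finset.sum_eq_zero fun j _ => by rw [integral_const_mul, (key j).2, mul_zero]

theorem norm_sum_inv_mul_collision_le (hm : ∀ j, m j ≠ 0) {C : ℝ} (hC0 : 0 ≤ C) {v : Fin N → ℂ}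
    {X : Fin N → ℝ} (hv : ∀ j k, ‖(m k : ℂ) * v j - (m j : ℂ) * v k‖ ≤ C * |X j - X k|) (b : ℝ) :
    ‖∑ j, ((1 / m j : ℝ) : ℂ) * (((b * ∑ k, (X j - X k)⁻¹ : ℝ) : ℂ) * v j)‖
      ≤ |b| * ∑ j, ∑ k, |1 / (m j * m k)| * C := by
  -- Writing `1/m_j` as `(1/(m_j m_k)) m_k` exhibits the symmetric coefficient required for
  -- symmetrization.
  have h1 : ∑ j, ((1 / m j : ℝ) : ℂ) * (((b * ∑ k, (X j - X k)⁻¹ : ℝ) : ℂ) * v j)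
      = (b : ℂ) * ∑ j, ∑ k, ((1 / (m j * m k) * m k * (X j - X k)⁻¹ : ℝ) : ℂ) * v j := by
    rw [Finset.mul_sum]
    refine Finset.sum_congr rfl fun j _ => ?_
    rw [← Finset.sum_mul, Complex.ofReal_mul, Complex.ofReal_sum, Finset.mul_sum,
      Finset.sum_mul, Finset.sum_mul, Finset.mul_sum, Finset.mul_sum]
    refine Finset.sum_congr rfl fun k _ => ?_
    have := Complex.ofReal_ne_zero.2 (hm j)
    have := Complex.ofReal_ne_zero.2 (hm k)
    push_cast
    field_simp
  rw [h1, norm_mul, Complex.norm_real, Real.norm_eq_abs]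
  exact mul_le_mul_of_nonneg_left (norm_sum_sum_inv_sub_le (fun j k => by rw [mul_comm (m j)])
    hC0 hv) (abs_nonneg _)

/-- **Green's formula**: the quadratic form of `𝓗 - 𝓔₀` is a weighted Dirichlet form. -/
theorem integral_weight_mul_gaugedOp (hm : ∀ j, m j ≠ 0)
    (hΦ : MemLp (groundStateFun m κ) 2 (volume : Measure (Fin N → ℝ)))
    {h g : (Fin N → ℝ) → ℂ} (hh : ContDiff ℝ ∞ h) {B : ℝ} (hB : ∀ X, ‖h X‖ ≤ B)
    (hB' : ∀ j X, ‖partialDeriv j h X‖ ≤ B)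
    (hg : ContDiff ℝ ∞ g) (hc : HasCompactSupport g) (hcol : CollisionCompatible m g) :
    ∫ X, (weight m κ X : ℂ) * (conj (h X) * gaugedOp m κ g X)
      = ∫ X, (weight m κ X : ℂ) * gradProd m h g X := by
  obtain ⟨C, hC0, hC⟩ := hcol.exists_norm_le hg hc
  obtain ⟨B₁, hB₁0, hB₁⟩ := exists_norm_gaugedOp_le hm hg hc hcol κ
  obtain ⟨B₂, hB₂0, hB₂⟩ := exists_norm_partialDeriv_le hg hc
  obtain ⟨B₃, hB₃0, hχ'⟩ := exists_hasLineDerivAt_collisionCutoff N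
  have hBn : 0 ≤ B := (norm_nonneg _).trans (hB 0)
  have hw := integrable_weight hΦ
  have hwm : AEStronglyMeasurable (fun X => (weight m κ X : ℂ)) volume :=
    Complex.continuous_ofReal.comp_aestronglyMeasurable hw.1
  have hconj : Continuous fun X => conj (h X) := Complex.continuous_conj.comp hh.continuous
  have hgm : AEStronglyMeasurable (gaugedOp m κ g) volume :=
    (measurable_gaugedOp hg).aestronglyMeasurable
  have hχc : ∀ n, Continuous fun X : Fin N → ℝ => (collisionCutoff n X : ℂ) := fun n =>
    Complex.continuous_ofReal.comp (contDiff_collisionCutoff n).continuous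
  have hχ1 : ∀ n (X : Fin N → ℝ), ‖(collisionCutoff n X : ℂ)‖ ≤ 1 := fun n X => by
    rw [Complex.norm_real, Real.norm_eq_abs, abs_of_nonneg (collisionCutoff_mem_Icc n X).1]
    exact (collisionCutoff_mem_Icc n X).2
  have hwn : ∀ X, ‖(weight m κ X : ℂ)‖ = weight m κ X := fun X => by
    rw [Complex.norm_real, Real.norm_of_nonneg (weight_nonneg X)]
  set F : ℕ → (Fin N → ℝ) → ℂ := fun n X =>
    (collisionCutoff n X : ℂ) * ((weight m κ X : ℂ) * conj (h X)) * gaugedOp m κ g X with hF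
  -- `F n` is the cut-off left side and `R n` a sum of total derivatives with zero integral; `F n +
  -- R n` is the cut-off form density plus an error.
  set R : ℕ → (Fin N → ℝ) → ℂ := fun n X => ∑ j, ((1 / m j : ℝ) : ℂ) *
        ((collisionCutoff n X : ℂ) * ((weight m κ X : ℂ) * conj (h X))
          * partialDeriv j (partialDeriv j g) X
          + partialDeriv j (fun X => (collisionCutoff n X : ℂ) *
            ((weight m κ X : ℂ) * conj (h X))) X * partialDeriv j g X) with hR
  have hRi : ∀ n, Integrable (R n) ∧ ∫ X, R n X = 0 := fun n =>
    integral_collisionCutoff_mul_gaugedOp (contDiff_collisionCutoff n)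
      (tsupport_collisionCutoff_subset n) hh hg hc
  have hFm : ∀ n, AEStronglyMeasurable (F n) volume := fun n =>
    ((hχc n).aestronglyMeasurable.mul (hwm.mul hconj.aestronglyMeasurable)).mul hgm
  have hFb : ∀ n X, ‖F n X‖ ≤ weight m κ X * (B * B₁) := by
    intro n X
    rw [hF, norm_mul, norm_mul, norm_mul, hwn, RCLike.norm_conj, mul_assoc, mul_assoc]
    refine (mul_le_of_le_one_left (by have := weight_nonneg (m := m) (κ := κ) X; positivity)
      (hχ1 n X)).trans ?_
    exact mul_le_mul_of_nonneg_left (mul_le_mul (hB X) (hB₁ X) (norm_nonneg _) hBn)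
      (weight_nonneg X)
  have hFi : ∀ n, Integrable (F n) := fun n =>
    (hw.mul_const (B * B₁)).mono' (hFm n) (Eventually.of_forall (hFb n))
  have hlimF : Tendsto (fun n => ∫ X, F n X) atTop
      (𝓝 (∫ X, (weight m κ X : ℂ) * (conj (h X) * gaugedOp m κ g X))) := by
    refine tendsto_integral_of_dominated_convergence _ hFm (hw.mul_const (B * B₁))
      (fun n => Eventually.of_forall (hFb n)) ?_
    filter_upwards [ae_mem_configSpace N] with X hX
    have := ((tendsto_collisionCutoff hX).ofReal.mul_const
      ((weight m κ X : ℂ) * conj (h X))).mul_const (gaugedOp m κ g X)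
    convert! this using 2
    push_cast
    ring
  set K := (∑ j, |1 / m j|) * (B * B₂) + B * (B₃ * ∑ j, ∑ k, |1 / (m j * m k)| * C) with hK
  -- The error `z` carries the gradient of the cutoff. Its poles cancel by the collision condition
  -- on `g`, leaving a bound of order `1/(n+1)` that is uniform in `X`.
  have hdecomp : ∀ n : ℕ, ∀ X ∈ configSpace N, ∃ z : ℂ,
      ‖z‖ ≤ B₃ / (n + 1) * ∑ j, ∑ k, |1 / (m j * m k)| * C ∧
      F n X + R n X = (weight m κ X : ℂ) *
        ((collisionCutoff n X : ℂ) * gradProd m h g X + conj (h X) * z) := by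
    intro n X hX
    obtain ⟨b, hb, -, hd⟩ := hχ' n X hX
    refine ⟨_, ?_, gaugedOp_ibp_pointwise hh hX hd⟩
    refine (norm_sum_inv_mul_collision_le hm hC0 (fun j k => hC j k X) _).trans ?_
    refine mul_le_mul_of_nonneg_right ?_
      (Finset.sum_nonneg fun j _ => Finset.sum_nonneg fun k _ => by positivity)
    have hn : (0 : ℝ) < n + 1 := by positivity
    rw [abs_div, abs_of_pos hn]
    gcongr
  have hlimR : Tendsto (fun n => ∫ X, (F n X + R n X)) atTop
      (𝓝 (∫ X, (weight m κ X : ℂ) * gradProd m h g X)) := by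
    refine tendsto_integral_of_dominated_convergence (fun X => weight m κ X * K)
      (fun n => (hFm n).add (hRi n).1.1) (hw.mul_const K) (fun n => ?_) ?_
    · filter_upwards [ae_mem_configSpace N] with X hX
      obtain ⟨z, hz, he⟩ := hdecomp n X hX
      rw [he, norm_mul, hwn]
      refine mul_le_mul_of_nonneg_left ?_ (weight_nonneg X)
      refine (norm_add_le _ _).trans (add_le_add ?_ ?_)
      · rw [norm_mul]
        exact (mul_le_of_le_one_left (norm_nonneg _) (hχ1 n X)).trans
          (norm_gradProd_le (fun j => hB' j X) fun j => hB₂ j X)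
      · rw [norm_mul, RCLike.norm_conj]
        refine mul_le_mul (hB X) (hz.trans (mul_le_mul_of_nonneg_right ?_ ?_)) (norm_nonneg _) hBn
        · exact div_le_self hB₃0 (by have : (0 : ℝ) ≤ n := n.cast_nonneg
                                     linarith)
        · exact Finset.sum_nonneg fun j _ => Finset.sum_nonneg fun k _ => by positivity
    · filter_upwards [ae_mem_configSpace N] with X hX
      choose z hz he using fun n => hdecomp n X hX
      simp only [he]
      have hz0 : Tendsto z atTop (𝓝 0) := by
        refine squeeze_zero_norm hz ?_
        have : Tendsto (fun n : ℕ => B₃ / ((n : ℝ) + 1)) atTop (𝓝 0) :=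
          tendsto_const_nhds.div_atTop
            (tendsto_atTop_add_const_right _ _ tendsto_natCast_atTop_atTop)
        simpa using this.mul_const (∑ j, ∑ k, |1 / (m j * m k)| * C)
      have h1 := (tendsto_collisionCutoff hX).ofReal.mul_const (gradProd m h g X)
      have := (h1.add (hz0.const_mul (conj (h X)))).const_mul (weight m κ X : ℂ)
      simpa using this
  refine tendsto_nhds_unique hlimF (hlimR.congr fun n => ?_)
  rw [integral_add (hFi n) (hRi n).1, (hRi n).2, add_zero]

end GreenFormula

/-! ### The operators in `L²` defined by `𝓗`. -/

section Realization

open scoped ComplexConjugate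

variable {N : ℕ} {m : Fin N → ℝ} {κ : ℝ}

/-- The pairs of classes of `f` and `P f` form a linear subspace, which is the graph of an operator
because `hnull` makes it single-valued. Linearity of `P` is needed only almost everywhere. -/
theorem exists_isRealization {P : ((Fin N → ℝ) → ℂ) → (Fin N → ℝ) → ℂ}
    {D : Set ((Fin N → ℝ) → ℂ)} (h0 : 0 ∈ D)
    (hL : ∀ f ∈ D, MemLp f 2 (volume : Measure (Fin N → ℝ)) ∧
      MemLp (P f) 2 (volume : Measure (Fin N → ℝ)))
    (hlin : ∀ f ∈ D, ∀ f' ∈ D, ∀ c : ℂ, f + c • f' ∈ D ∧ P (f + c • f') =ᵐ[volume] P f + c • P f')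
    (hnull : ∀ f ∈ D, f =ᵐ[volume] 0 → P f =ᵐ[volume] 0) :
    ∃ T, IsRealization P D T := by
  have hmk : ∀ (a b : L2 N × L2 N) (c : ℂ) (f f' : (Fin N → ℝ) → ℂ), f ∈ D → f' ∈ D →
      (a.1 =ᵐ[volume] f ∧ a.2 =ᵐ[volume] P f) → (b.1 =ᵐ[volume] f' ∧ b.2 =ᵐ[volume] P f') →
      ((a + c • b).1 =ᵐ[volume] f + c • f' ∧ (a + c • b).2 =ᵐ[volume] P (f + c • f')) := by
    intro a b c f f' hf hf' ha hb
    constructor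
    · refine (Lp.coeFn_add a.1 (c • b.1)).trans ?_
      exact ha.1.add ((Lp.coeFn_smul c b.1).trans (hb.1.const_smul c))
    · refine (Lp.coeFn_add a.2 (c • b.2)).trans ?_
      refine EventuallyEq.trans ?_ (hlin f hf f' hf' c).2.symm
      exact ha.2.add ((Lp.coeFn_smul c b.2).trans (hb.2.const_smul c))
  have hz : ((0 : L2 N × L2 N).1 =ᵐ[volume] (0 : (Fin N → ℝ) → ℂ) ∧
      (0 : L2 N × L2 N).2 =ᵐ[volume] P 0) :=
    ⟨Lp.coeFn_zero _ _ _, (Lp.coeFn_zero _ _ _).trans (hnull 0 h0 EventuallyEq.rfl).symm⟩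
  let G : Submodule ℂ (L2 N × L2 N) :=
    { carrier := {p | ∃ f ∈ D, p.1 =ᵐ[volume] f ∧ p.2 =ᵐ[volume] P f}
      zero_mem' := ⟨0, h0, hz⟩
      add_mem' := by
        rintro a b ⟨f, hf, ha⟩ ⟨f', hf', hb⟩
        refine ⟨f + (1 : ℂ) • f', (hlin f hf f' hf' 1).1, ?_⟩
        have := hmk a b 1 f f' hf hf' ha hb
        rwa [one_smul ℂ b] at this
      smul_mem' := by
        rintro c b ⟨f', hf', hb⟩
        refine ⟨0 + c • f', (hlin 0 h0 f' hf' c).1, ?_⟩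
        have := hmk 0 b c 0 f' h0 hf' hz hb
        rwa [zero_add (c • b)] at this }
  have huniq : ∀ f ∈ D, ∀ f' ∈ D, f =ᵐ[volume] f' → P f =ᵐ[volume] P f' := by
    intro f hf f' hf' h
    obtain ⟨h1, h2⟩ := hlin f hf f' hf' (-1)
    have h3 := hnull _ h1 (by filter_upwards [h] with X hX; simp [hX])
    filter_upwards [h2, h3] with X hX hX'
    rw [hX] at hX'
    simpa [← sub_eq_add_neg, sub_eq_zero] using hX'
  have hG : ∀ x ∈ G, x.1 = 0 → x.2 = 0 := by
    rintro ⟨u, v⟩ ⟨f, hf, hu, hv⟩ h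
    simp only at h hu hv ⊢
    subst h
    refine Lp.ext (hv.trans ((hnull f hf ?_).trans (Lp.coeFn_zero _ _ _).symm))
    exact hu.symm.trans (Lp.coeFn_zero _ _ _)
  refine ⟨G.toLinearPMap, fun u => ?_, fun u f hf hu => ?_⟩
  · rw [Submodule.toLinearPMap_domain, Submodule.mem_map]
    constructor
    · rintro ⟨⟨u, v⟩, ⟨f, hf, hu, -⟩, rfl⟩
      exact ⟨f, hf, hu⟩
    · rintro ⟨f, hf, hu⟩
      exact ⟨(u, (hL f hf).2.toLp), ⟨f, hf, hu, (hL f hf).2.coeFn_toLp⟩, rfl⟩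
  · obtain ⟨f', hf', hu', hv'⟩ := Submodule.mem_graph_toLinearPMap hG u
    exact hv'.trans (huniq f' hf' f hf (hu'.symm.trans hu))

theorem IsRealization.le {P : ((Fin N → ℝ) → ℂ) → (Fin N → ℝ) → ℂ}
    {D D₀ : Set ((Fin N → ℝ) → ℂ)} {T T₀ : L2 N →ₗ.[ℂ] L2 N} (hT : IsRealization P D T)
    (hT₀ : IsRealization P D₀ T₀) (h : D₀ ⊆ D) : T₀ ≤ T := by
  refine ⟨fun u hu => ?_, fun u v huv => ?_⟩
  · obtain ⟨f, hf, huf⟩ := (hT₀.1 u).1 hu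
    exact (hT.1 u).2 ⟨f, h hf, huf⟩
  · obtain ⟨f, hf, huf⟩ := (hT₀.1 u).1 u.2
    exact Lp.ext ((hT₀.2 u f hf huf).trans (hT.2 v f (h hf) (huv ▸ huf)).symm)

theorem partialDeriv_add_smul {g g' : (Fin N → ℝ) → ℂ} (hg : ContDiff ℝ ∞ g) (hg' : ContDiff ℝ ∞ g')
    (c : ℂ) (j : Fin N) :
    partialDeriv j (g + c • g') = partialDeriv j g + c • partialDeriv j g' := by
  funext X
  have h1 := hasLineDerivAt_partialDeriv hg j X
  have h2 : HasLineDerivAt ℝ (fun y => c • g' y) (c • partialDeriv j g' X) X (Pi.single j 1) :=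
    HasDerivAt.fun_const_smul c (hasLineDerivAt_partialDeriv hg' j X)
  exact (hasLineDerivAt_add h1 h2).lineDeriv

theorem hasLineDerivAt_const_zero {X v : Fin N → ℝ} :
    HasLineDerivAt ℝ (fun _ : Fin N → ℝ => (0 : ℂ)) 0 X v :=
  hasDerivAt_const _ _

theorem contDiff_add_smul {g g' : (Fin N → ℝ) → ℂ} (hg : ContDiff ℝ ∞ g) (hg' : ContDiff ℝ ∞ g')
    (c : ℂ) : ContDiff ℝ ∞ (g + c • g') :=
  hg.add (contDiff_const.smul hg')

theorem gaugedOp_add_smul {g g' : (Fin N → ℝ) → ℂ} (hg : ContDiff ℝ ∞ g) (hg' : ContDiff ℝ ∞ g')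
    (c : ℂ) (X : Fin N → ℝ) :
    gaugedOp m κ (g + c • g') X = gaugedOp m κ g X + c * gaugedOp m κ g' X := by
  unfold gaugedOp
  simp only [partialDeriv_add_smul hg hg', partialDeriv_add_smul (contDiff_partialDeriv hg _)
    (contDiff_partialDeriv hg' _), Pi.add_apply, Pi.smul_apply, smul_eq_mul, mul_neg,
    Finset.mul_sum, ← Finset.sum_neg_distrib, ← Finset.sum_add_distrib]
  exact Finset.sum_congr rfl fun j _ => by ring

/-- The smooth functions `g` such that `Φ₀ g` lies in `initialDomain`. -/
def smoothCore (m : Fin N → ℝ) : Submodule ℂ ((Fin N → ℝ) → ℂ) where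
  carrier := {g | ContDiff ℝ ∞ g ∧ HasCompactSupport g ∧ CollisionCompatible m g}
  zero_mem' := by
    refine ⟨contDiff_const, HasCompactSupport.zero, fun j k X _ => ?_⟩
    have : ∀ j, partialDeriv j (0 : (Fin N → ℝ) → ℂ) X = 0 := fun j =>
      hasLineDerivAt_const_zero.lineDeriv
    simp [this]
  add_mem' := by
    rintro g g' ⟨h1, h2, h3⟩ ⟨h1', h2', h3'⟩
    refine ⟨h1.add h1', h2.add h2', fun j k X hX => ?_⟩
    have := fun j => partialDeriv_add_smul h1 h1' 1 j
    simp only [one_smul] at this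
    simp only [this, Pi.add_apply, mul_add, h3 j k X hX, h3' j k X hX]
  smul_mem' := by
    rintro c g ⟨h1, h2, h3⟩
    refine ⟨contDiff_const.smul h1, h2.smul_left, fun j k X hX => ?_⟩
    have : ∀ j, partialDeriv j (c • g) X = c * partialDeriv j g X := fun j =>
      (HasDerivAt.const_smul c (hasLineDerivAt_partialDeriv h1 j X)).deriv
    simp only [this, mul_left_comm _ c, h3 j k X hX]

/-- The smooth functions with compact support away from the collision hyperplanes. -/
def testCore (N : ℕ) : Submodule ℂ ((Fin N → ℝ) → ℂ) where
  carrier := testFunctions N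
  zero_mem' := ⟨contDiff_const, HasCompactSupport.zero, by simp [tsupport]⟩
  add_mem' := by
    rintro g g' ⟨h1, h2, h3⟩ ⟨h1', h2', h3'⟩
    exact ⟨h1.add h1', h2.add h2', (tsupport_add _ _).trans (Set.union_subset h3 h3')⟩
  smul_mem' := by
    rintro c g ⟨h1, h2, h3⟩
    exact ⟨contDiff_const.smul h1, h2.smul_left,
      (closure_mono (Function.support_const_smul_subset c g)).trans h3⟩

theorem testCore_le (m : Fin N → ℝ) : testCore N ≤ smoothCore m := by
  rintro g ⟨h1, h2, h3⟩
  refine ⟨h1, h2, fun j k X hX => ?_⟩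
  by_cases hjk : j = k
  · rw [hjk]
  · have hX' : X ∉ tsupport g := fun h => hjk (h3 h hX)
    have : ∀ j, partialDeriv j g X = 0 := fun j => by
      rw [partialDeriv, (notMem_tsupport_iff_eventuallyEq.1 hX').lineDeriv_eq]
      exact hasLineDerivAt_const_zero.lineDeriv
    simp [this]

theorem initialDomain_eq (m : Fin N → ℝ) (κ : ℝ) :
    initialDomain m κ = (groundStateFun m κ * ·) '' (smoothCore m : Set _) := by
  ext f
  constructor
  · rintro ⟨g, h1, h2, h3, rfl⟩
    exact ⟨g, ⟨h1, h2, h3⟩, rfl⟩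
  · rintro ⟨g, ⟨h1, h2, h3⟩, rfl⟩
    exact ⟨g, h1, h2, h3, rfl⟩

theorem contDiff_mul_of_mem_testFunctions {g F : (Fin N → ℝ) → ℂ} (hg : g ∈ testFunctions N)
    (hF : ContDiffOn ℝ ∞ F (configSpace N)) : F * g ∈ testFunctions N := by
  obtain ⟨h1, h2, h3⟩ := hg
  refine ⟨?_, h2.mul_left, (closure_mono (Function.support_mul_subset_right _ _)).trans h3⟩
  rw [contDiff_iff_contDiffAt]
  intro X
  by_cases hX : X ∈ tsupport g
  · exact (hF.contDiffAt ((isOpen_configSpace N).mem_nhds (h3 hX))).mul h1.contDiffAt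
  · refine (contDiffAt_const (c := (0 : ℂ))).congr_of_eventuallyEq ?_
    filter_upwards [notMem_tsupport_iff_eventuallyEq.1 hX] with Y hY
    simp [hY]

/-- `Φ₀` is smooth and has no zeros off the hyperplanes, so multiplication by it permutes the test
functions. This places them in `initialDomain`. -/
theorem testFunctions_eq (m : Fin N → ℝ) (κ : ℝ) :
    testFunctions N = (groundStateFun m κ * ·) '' (testCore N : Set _) := by
  ext f
  constructor
  · intro hf
    refine ⟨(groundStateFun m κ)⁻¹ * f, contDiff_mul_of_mem_testFunctions hf
      ((contDiffOn_groundStateFun m κ).inv fun X hX => groundStateFun_ne_zero hX), ?_⟩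
    funext X
    by_cases hX : X ∈ configSpace N
    · simp [groundStateFun_ne_zero (m := m) (κ := κ) hX]
    · have : f X = 0 := by
        by_contra h
        exact hX (hf.2.2 (subset_tsupport _ h))
      simp [this]
  · rintro ⟨g, hg, rfl⟩
    exact contDiff_mul_of_mem_testFunctions hg (contDiffOn_groundStateFun m κ)

theorem memLp_groundStateFun_mul
    (hΦ : MemLp (groundStateFun m κ) 2 (volume : Measure (Fin N → ℝ))) {f : (Fin N → ℝ) → ℂ}
    (hf : AEStronglyMeasurable f (volume : Measure (Fin N → ℝ))) {B : ℝ} (hB : ∀ X, ‖f X‖ ≤ B) :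
    MemLp (groundStateFun m κ * f) 2 (volume : Measure (Fin N → ℝ)) := by
  refine hΦ.of_le_mul (c := B) (hΦ.1.mul hf) (Eventually.of_forall fun X => ?_)
  rw [Pi.mul_apply, norm_mul, mul_comm]
  exact mul_le_mul_of_nonneg_right (hB X) (norm_nonneg _)

theorem hamiltonian_ae_eq (hm : ∀ j, m j ≠ 0) {g : (Fin N → ℝ) → ℂ} (hg : ContDiff ℝ ∞ g) :
    hamiltonian m κ (groundStateFun m κ * g) =ᵐ[volume]
      (groundEnergy m κ : ℂ) • (groundStateFun m κ * g) + groundStateFun m κ * gaugedOp m κ g := by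
  filter_upwards [ae_mem_configSpace N] with X hX
  exact hamiltonian_groundStateFun_mul hm hg hX

theorem exists_isRealization_hamiltonian (hm : ∀ j, m j ≠ 0)
    (hΦ : MemLp (groundStateFun m κ) 2 (volume : Measure (Fin N → ℝ)))
    {S : Submodule ℂ ((Fin N → ℝ) → ℂ)} (hS : S ≤ smoothCore m) :
    ∃ T, IsRealization (hamiltonian m κ) ((groundStateFun m κ * ·) '' (S : Set _)) T := by
  refine exists_isRealization ⟨0, S.zero_mem, by simp⟩ ?_ ?_ ?_
  · rintro _ ⟨g, hg, rfl⟩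
    obtain ⟨h1, h2, h3⟩ := hS hg
    obtain ⟨B, -, hB⟩ := exists_norm_le_of_hasCompactSupport h1.continuous h2
    obtain ⟨B', -, hB'⟩ := exists_norm_gaugedOp_le hm h1 h2 h3 κ
    have i1 := memLp_groundStateFun_mul hΦ h1.continuous.aestronglyMeasurable hB
    have i2 := memLp_groundStateFun_mul hΦ
      (measurable_gaugedOp (m := m) (κ := κ) h1).aestronglyMeasurable hB'
    exact ⟨i1, (memLp_congr_ae (hamiltonian_ae_eq hm h1)).2 ((i1.const_smul _).add i2)⟩
  · rintro _ ⟨g, hg, rfl⟩ _ ⟨g', hg', rfl⟩ c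
    have he : groundStateFun m κ * g + c • (groundStateFun m κ * g')
        = groundStateFun m κ * (g + c • g') := by
      rw [mul_add, mul_smul_comm]
    have h1 := (hS hg).1
    have h1' := (hS hg').1
    refine ⟨⟨g + c • g', S.add_mem hg (S.smul_mem c hg'), he.symm⟩, ?_⟩
    simp only [he]
    filter_upwards [hamiltonian_ae_eq (κ := κ) hm h1, hamiltonian_ae_eq (κ := κ) hm h1',
      hamiltonian_ae_eq (κ := κ) hm (contDiff_add_smul h1 h1' c)] with X e1 e2 e3
    simp only [e1, e2, e3, Pi.add_apply, Pi.smul_apply, Pi.mul_apply, smul_eq_mul,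
      gaugedOp_add_smul h1 h1']
    ring
  · rintro _ ⟨g, hg, rfl⟩ h0
    have h1 := (hS hg).1
    -- `Φ₀` is non-zero almost everywhere, so `g` vanishes almost everywhere, and everywhere by
    -- continuity.
    have hg0 : g = 0 := by
      refine (Continuous.ae_eq_iff_eq (volume : Measure (Fin N → ℝ)) h1.continuous
        continuous_zero).1 ?_
      filter_upwards [h0, ae_mem_configSpace N] with X hX hX'
      exact (mul_eq_zero.1 hX).resolve_left (groundStateFun_ne_zero hX')
    filter_upwards [hamiltonian_ae_eq (κ := κ) hm h1] with X e1
    have e2 : gaugedOp m κ (0 : (Fin N → ℝ) → ℂ) X = 0 := by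
      have := gaugedOp_add_smul (m := m) (κ := κ) (g := 0) (g' := 0) contDiff_const contDiff_const
        (-1) X
      simpa using this
    rw [e1, hg0]
    simp [e2]

/-- A vector orthogonal to all test functions vanishes almost everywhere on the open set of
collision-free points, which has full measure. -/
theorem dense_domain_of_isRealization {P : ((Fin N → ℝ) → ℂ) → (Fin N → ℝ) → ℂ}
    {T : L2 N →ₗ.[ℂ] L2 N} (hT : IsRealization P (testFunctions N) T) :
    Dense (T.domain : Set (L2 N)) := by
  rw [Submodule.dense_iff_topologicalClosure_eq_top, Submodule.topologicalClosure_eq_top_iff,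
    Submodule.eq_bot_iff]
  intro u hu
  have hloc : LocallyIntegrableOn u (configSpace N) (volume : Measure (Fin N → ℝ)) :=
    ((Lp.memLp u).locallyIntegrable (by norm_num)).locallyIntegrableOn _
  have h0 := (isOpen_configSpace N).ae_eq_zero_of_integral_contDiff_smul_eq_zero hloc
    fun φ h1 h2 h3 => by
      have hc : ContDiff ℝ ∞ fun X => (φ X : ℂ) := Complex.ofRealCLM.contDiff.comp h1
      have hcs : HasCompactSupport fun X => (φ X : ℂ) := h2.comp_left Complex.ofReal_zero
      have hmem : MemLp (fun X => (φ X : ℂ)) 2 (volume : Measure (Fin N → ℝ)) :=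
        hc.continuous.memLp_of_hasCompactSupport hcs
      have hd : hmem.toLp ∈ T.domain := (hT.1 _).2 ⟨fun X => (φ X : ℂ), ⟨hc, hcs,
        (closure_mono (Function.support_comp_subset Complex.ofReal_zero φ)).trans h3⟩,
        hmem.coeFn_toLp⟩
      have h4 := hu _ hd
      rw [L2.inner_def] at h4
      refine Eq.trans (integral_congr_ae ?_) h4
      filter_upwards [hmem.coeFn_toLp] with X hX
      rw [hX, RCLike.inner_apply, Complex.conj_ofReal, Complex.real_smul, mul_comm]
  refine Lp.ext (EventuallyEq.trans ?_ (Lp.coeFn_zero _ _ _).symm)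
  filter_upwards [h0, ae_mem_configSpace N] with X hX hX' using hX hX'

theorem L2_norm_sq_eq (u : L2 N) : ‖u‖ ^ 2 = ∫ X, ‖u X‖ ^ 2 := by
  have h := inner_self_eq_ofReal u
  rw [L2.inner_def] at h
  simp only [inner_self_eq_ofReal] at h
  have h' := (integral_ofReal (𝕜 := ℂ) (μ := volume) (f := fun X => ‖u X‖ ^ 2)).symm.trans h
  exact (Complex.ofReal_injective h').symm

theorem tendsto_of_ae_eq_groundStateFun_mul
    (hΦ : MemLp (groundStateFun m κ) 2 (volume : Measure (Fin N → ℝ)))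
    {g : ℕ → (Fin N → ℝ) → ℂ} {g₀ : (Fin N → ℝ) → ℂ} (hg : ∀ n, Continuous (g n))
    (hg₀ : Continuous g₀) {B : ℝ} (hB : ∀ n X, ‖g n X - g₀ X‖ ≤ B)
    (hlim : ∀ X ∈ configSpace N, Tendsto (fun n => g n X) atTop (𝓝 (g₀ X)))
    {u : ℕ → L2 N} {u₀ : L2 N} (hu : ∀ n, u n =ᵐ[volume] groundStateFun m κ * g n)
    (hu₀ : u₀ =ᵐ[volume] groundStateFun m κ * g₀) : Tendsto u atTop (𝓝 u₀) := by
  have h1 : ∀ n, ‖u n - u₀‖ ^ 2 = ∫ X, weight m κ X * ‖g n X - g₀ X‖ ^ 2 := by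
    intro n
    rw [L2_norm_sq_eq]
    refine integral_congr_ae ?_
    filter_upwards [Lp.coeFn_sub (u n) u₀, hu n, hu₀] with X e1 e2 e3
    rw [e1, Pi.sub_apply, e2, e3, Pi.mul_apply, Pi.mul_apply, ← mul_sub, norm_mul, mul_pow, weight]
  have hw := integrable_weight hΦ
  have h2 : Tendsto (fun n => ‖u n - u₀‖ ^ 2) atTop (𝓝 0) := by
    simp only [h1]
    have : (0 : ℝ) = ∫ _ : Fin N → ℝ, (0 : ℝ) := by simp
    rw [this]
    refine tendsto_integral_of_dominated_convergence (fun X => weight m κ X * B ^ 2)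
      (fun n => hw.1.mul (((hg n).sub hg₀).norm.pow 2).aestronglyMeasurable) (hw.mul_const _)
      (fun n => Eventually.of_forall fun X => ?_) ?_
    · rw [norm_mul, Real.norm_of_nonneg (weight_nonneg X), norm_pow, norm_norm]
      exact mul_le_mul_of_nonneg_left (pow_le_pow_left₀ (norm_nonneg _) (hB n X) 2)
        (weight_nonneg X)
    · filter_upwards [ae_mem_configSpace N] with X hX
      have := (((hlim X hX).sub_const (g₀ X)).norm.pow 2).const_mul (weight m κ X)
      simpa using this
  have h3 := h2.sqrt
  rw [tendsto_iff_norm_sub_tendsto_zero]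
  simpa [Real.sqrt_sq] using h3

/-- `u` need not lie in the domain of `T`: `h` is only bounded with bounded derivatives, which
admits `h = 1` and `u = Φ₀`. -/
theorem inner_realization (hm : ∀ j, m j ≠ 0)
    (hΦ : MemLp (groundStateFun m κ) 2 (volume : Measure (Fin N → ℝ))) {T : L2 N →ₗ.[ℂ] L2 N}
    (hT : IsRealization (hamiltonian m κ) (initialDomain m κ) T) {u : L2 N} (v : T.domain)
    {h g : (Fin N → ℝ) → ℂ} (hh : ContDiff ℝ ∞ h) {B : ℝ} (hB : ∀ X, ‖h X‖ ≤ B)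
    (hB' : ∀ j X, ‖partialDeriv j h X‖ ≤ B) (hg : g ∈ smoothCore m)
    (hu : u =ᵐ[volume] groundStateFun m κ * h)
    (hv : (v : L2 N) =ᵐ[volume] groundStateFun m κ * g) :
    inner ℂ u (T v) = (groundEnergy m κ : ℂ) * inner ℂ u (v : L2 N)
      + ∫ X, (weight m κ X : ℂ) * gradProd m h g X := by
  obtain ⟨h1, h2, h3⟩ := hg
  obtain ⟨B', -, hB''⟩ := exists_norm_gaugedOp_le hm h1 h2 h3 κ
  have i2 := memLp_groundStateFun_mul hΦ
    (measurable_gaugedOp (m := m) (κ := κ) h1).aestronglyMeasurable hB''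
  have hTv : T v = (groundEnergy m κ : ℂ) • (v : L2 N) + i2.toLp := by
    refine Lp.ext ?_
    have e1 := hT.2 v _ ((initialDomain_eq m κ).symm ▸ ⟨g, ⟨h1, h2, h3⟩, rfl⟩) hv
    filter_upwards [e1, hamiltonian_ae_eq (κ := κ) hm h1, i2.coeFn_toLp, hv,
      Lp.coeFn_smul (groundEnergy m κ : ℂ) (v : L2 N),
      Lp.coeFn_add ((groundEnergy m κ : ℂ) • (v : L2 N)) i2.toLp] with X e1 e2 e3 e4 e5 e6
    rw [e1, e2, e6]
    simp only [Pi.add_apply, e5, e3, Pi.smul_apply, e4]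
  rw [hTv, inner_add_right, inner_smul_right,
    ← integral_weight_mul_gaugedOp hm hΦ hh hB hB' h1 h2 h3, L2.inner_def]
  congr 1
  refine integral_congr_ae ?_
  filter_upwards [i2.coeFn_toLp, hu] with X e1 e2
  rw [e1, e2, RCLike.inner_apply, Pi.mul_apply, Pi.mul_apply, map_mul, ofReal_weight]
  ring

end Realization

/-! ### Symmetry, the lower bound and the ground state. -/

section GroundState

open scoped ComplexConjugate

variable {N : ℕ} {m : Fin N → ℝ} {κ : ℝ}

theorem gradProd_self (g : (Fin N → ℝ) → ℂ) (X : Fin N → ℝ) :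
    gradProd m g g X = ((∑ j, 1 / m j * ‖partialDeriv j g X‖ ^ 2 : ℝ) : ℂ) := by
  unfold gradProd
  rw [Complex.ofReal_sum]
  refine Finset.sum_congr rfl fun j _ => ?_
  rw [Complex.conj_mul']
  push_cast; rfl

theorem conj_gradProd (h g : (Fin N → ℝ) → ℂ) (X : Fin N → ℝ) :
    conj (gradProd m h g X) = gradProd m g h X := by
  unfold gradProd
  rw [map_sum]
  refine Finset.sum_congr rfl fun j _ => ?_
  rw [map_mul, map_mul, Complex.conj_conj, Complex.conj_ofReal, mul_comm (conj _)]

theorem exists_norm_le_of_mem_smoothCore {g : (Fin N → ℝ) → ℂ} (hg : g ∈ smoothCore m) :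
    ∃ B, (∀ X, ‖g X‖ ≤ B) ∧ ∀ j X, ‖partialDeriv j g X‖ ≤ B := by
  obtain ⟨B, -, hB⟩ := exists_norm_le_of_hasCompactSupport hg.1.continuous hg.2.1
  obtain ⟨B', -, hB'⟩ := exists_norm_partialDeriv_le hg.1 hg.2.1
  exact ⟨max B B', fun X => (hB X).trans (le_max_left _ _),
    fun j X => (hB' j X).trans (le_max_right _ _)⟩

theorem exists_smoothCore_of_mem_domain {T : L2 N →ₗ.[ℂ] L2 N}
    (hT : IsRealization (hamiltonian m κ) (initialDomain m κ) T) (u : T.domain) :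
    ∃ g ∈ smoothCore m, (u : L2 N) =ᵐ[volume] groundStateFun m κ * g := by
  obtain ⟨f, hf, hu⟩ := (hT.1 u).1 u.2
  rw [initialDomain_eq] at hf
  obtain ⟨g, hg, rfl⟩ := hf
  exact ⟨g, hg, hu⟩

theorem isFormalAdjoint_of_isRealization (hm : ∀ j, m j ≠ 0)
    (hΦ : MemLp (groundStateFun m κ) 2 (volume : Measure (Fin N → ℝ))) {T : L2 N →ₗ.[ℂ] L2 N}
    (hT : IsRealization (hamiltonian m κ) (initialDomain m κ) T) : T.IsFormalAdjoint T := by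
  intro u v
  obtain ⟨h, hh, hu⟩ := exists_smoothCore_of_mem_domain hT u
  obtain ⟨g, hg, hv⟩ := exists_smoothCore_of_mem_domain hT v
  obtain ⟨B, hB, hB'⟩ := exists_norm_le_of_mem_smoothCore hh
  obtain ⟨C, hC, hC'⟩ := exists_norm_le_of_mem_smoothCore hg
  rw [inner_realization hm hΦ hT v hh.1 hB hB' hg hu hv, ← inner_conj_symm,
    inner_realization hm hΦ hT u hg.1 hC hC' hh hv hu, map_add, map_mul, Complex.conj_ofReal,
    inner_conj_symm, ← integral_conj]
  simp only [map_mul, Complex.conj_ofReal, conj_gradProd]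

theorem inner_self_realization (hm : ∀ j, m j ≠ 0)
    (hΦ : MemLp (groundStateFun m κ) 2 (volume : Measure (Fin N → ℝ))) {T : L2 N →ₗ.[ℂ] L2 N}
    (hT : IsRealization (hamiltonian m κ) (initialDomain m κ) T) (u : T.domain)
    {g : (Fin N → ℝ) → ℂ} (hg : g ∈ smoothCore m)
    (hu : (u : L2 N) =ᵐ[volume] groundStateFun m κ * g) :
    inner ℂ (u : L2 N) (T u) = ((groundEnergy m κ * ‖(u : L2 N)‖ ^ 2
      + ∫ X, weight m κ X * ∑ j, 1 / m j * ‖partialDeriv j g X‖ ^ 2 : ℝ) : ℂ) := by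
  obtain ⟨C, hC, hC'⟩ := exists_norm_le_of_mem_smoothCore hg
  rw [inner_realization hm hΦ hT u hg.1 hC hC' hg hu hu, inner_self_eq_ofReal,
    Complex.ofReal_add, Complex.ofReal_mul]
  congr 1
  refine Eq.trans ?_ (integral_ofReal (𝕜 := ℂ))
  refine integral_congr_ae (Eventually.of_forall fun X => ?_)
  simp only [gradProd_self]
  exact (Complex.ofReal_mul _ _).symm

theorem isBoundedBelowBy_of_isRealization (hm : ∀ j, 0 < m j)
    (hΦ : MemLp (groundStateFun m κ) 2 (volume : Measure (Fin N → ℝ))) {T : L2 N →ₗ.[ℂ] L2 N}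
    (hT : IsRealization (hamiltonian m κ) (initialDomain m κ) T) :
    IsBoundedBelowBy T (groundEnergy m κ) := by
  intro u
  obtain ⟨g, hg, hu⟩ := exists_smoothCore_of_mem_domain hT u
  rw [inner_self_realization (fun j => (hm j).ne') hΦ hT u hg hu, Complex.ofReal_re]
  refine le_add_of_nonneg_right (integral_nonneg fun X => mul_nonneg (weight_nonneg X)
    (Finset.sum_nonneg fun j _ => ?_))
  have := hm j
  positivity

/-- Smooth cutoffs to large balls that satisfy the condition on the collision hyperplanes. -/
def radialCutoff (m : Fin N → ℝ) (n : ℕ) (X : Fin N → ℝ) : ℂ :=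
  (Real.smoothTransition (2 - (∑ j, m j * X j ^ 2) / ((n : ℝ) + 1) ^ 2) : ℝ)

theorem contDiff_radialCutoff (n : ℕ) : ContDiff ℝ ∞ (radialCutoff m n) := by
  refine Complex.ofRealCLM.contDiff.comp (Real.smoothTransition.contDiff.comp ?_)
  fun_prop

theorem partialDeriv_radialCutoff (n : ℕ) (i : Fin N) (X : Fin N → ℝ) :
    partialDeriv i (radialCutoff m n) X =
      ((-(deriv Real.smoothTransition (2 - (∑ j, m j * X j ^ 2) / ((n : ℝ) + 1) ^ 2))
        * (2 * (m i * X i) / ((n : ℝ) + 1) ^ 2) : ℝ) : ℂ) := by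
  set e : Fin N → ℝ := Pi.single i 1 with he
  have hin : HasDerivAt (fun t : ℝ => 2 - (∑ j, m j * (X + t • e) j ^ 2) / ((n : ℝ) + 1) ^ 2)
      (-((2 * (m i * X i)) / ((n : ℝ) + 1) ^ 2)) 0 := by
    have h1 : HasDerivAt (fun t : ℝ => ∑ j, m j * (X + t • e) j ^ 2)
        (∑ j, m j * (2 * X j * e j)) 0 := by
      refine HasDerivAt.fun_sum fun j _ => ?_
      have hlin : HasDerivAt (fun t : ℝ => (X + t • e) j) (e j) 0 := by
        simpa using ((hasDerivAt_id (0 : ℝ)).mul_const (e j)).const_add (X j)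
      convert! (hlin.pow 2).const_mul (m j) using 1
      simp
    have h2 : ∑ j, m j * (2 * X j * e j) = 2 * (m i * X i) := by
      rw [Finset.sum_eq_single i]
      · simp [he]; ring
      · intro j _ hj; simp [he, hj]
      · simp
    rw [h2] at h1
    exact (h1.div_const _).const_sub 2
  have h0 : X + (0 : ℝ) • e = X := by simp
  have hθ : HasDerivAt Real.smoothTransition
      (deriv Real.smoothTransition (2 - (∑ j, m j * X j ^ 2) / ((n : ℝ) + 1) ^ 2))
      (2 - (∑ j, m j * (X + (0 : ℝ) • e) j ^ 2) / ((n : ℝ) + 1) ^ 2) := by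
    rw [h0]
    exact ((Real.smoothTransition.contDiff (n := 1)).differentiable (by simp) _).hasDerivAt
  have h3 := (hθ.comp (0 : ℝ) hin).ofReal_comp
  refine HasDerivAt.deriv (HasDerivAt.congr_deriv h3 ?_)
  congr 1
  ring

/-- A function of `∑ m_j X_j²` has gradient proportional to `(m_j X_j)`, so the collision condition
is automatic; this dictates the mass-weighted radius. -/
theorem radialCutoff_mem_smoothCore (hm : ∀ j, 0 < m j) (n : ℕ) :
    radialCutoff m n ∈ smoothCore m := by
  refine ⟨contDiff_radialCutoff n, ?_, fun j k X hX => ?_⟩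
  · have hL : (0 : ℝ) < ((n : ℝ) + 1) ^ 2 := by positivity
    -- On the support `X_i² ≤ 2 (n+1)² / m_i`, and `|x| ≤ 1 + x²`; summing over all indices gives
    -- one radius for all coordinates.
    refine HasCompactSupport.intro (isCompact_closedBall (0 : Fin N → ℝ)
      (∑ j, (1 + 2 * ((n : ℝ) + 1) ^ 2 / m j))) fun X hX => ?_
    by_contra h0
    refine hX (mem_closedBall_zero_iff.2 ?_)
    have hpos : ∀ j, 0 ≤ 1 + 2 * ((n : ℝ) + 1) ^ 2 / m j := fun j => by
      have := hm j; positivity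
    refine (pi_norm_le_iff_of_nonneg (Finset.sum_nonneg fun j _ => hpos j)).2 fun i => ?_
    refine le_trans ?_ (Finset.single_le_sum (fun j _ => hpos j) (Finset.mem_univ i))
    have hQ : ∑ j, m j * X j ^ 2 < 2 * ((n : ℝ) + 1) ^ 2 := by
      by_contra hQ
      refine h0 ?_
      rw [radialCutoff, Real.smoothTransition.zero_of_nonpos, Complex.ofReal_zero]
      rw [sub_nonpos, le_div_iff₀ hL]
      exact not_lt.1 hQ
    have h1 : m i * X i ^ 2 ≤ 2 * ((n : ℝ) + 1) ^ 2 :=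
      (Finset.single_le_sum (f := fun j => m j * X j ^ 2)
        (fun j _ => mul_nonneg (hm j).le (sq_nonneg _)) (Finset.mem_univ i)).trans hQ.le
    have h2 : X i ^ 2 ≤ 2 * ((n : ℝ) + 1) ^ 2 / m i := by
      rw [le_div_iff₀ (hm i)]; linarith
    rw [Real.norm_eq_abs]
    have h3 := sq_abs (X i)
    nlinarith [sq_nonneg (|X i| - 1 / 2)]
  · rw [partialDeriv_radialCutoff, partialDeriv_radialCutoff, hX]
    push_cast
    ring

/-- Where the derivative is non-zero the coordinates are `O(n+1)`, while the inner derivative is `2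
m_j X_j / (n+1)²`. -/
theorem exists_norm_partialDeriv_radialCutoff_le (hm : ∀ j, 0 < m j) :
    ∃ C, 0 ≤ C ∧ ∀ n j X, ‖partialDeriv j (radialCutoff m n) X‖ ≤ C / ((n : ℝ) + 1) := by
  obtain ⟨C, hC0, hC⟩ := exists_bound_deriv_smoothTransition
  have hs : 0 ≤ ∑ j, m j := Finset.sum_nonneg fun j _ => (hm j).le
  refine ⟨C * (2 * (∑ j, m j + 1)), by positivity, fun n i X => ?_⟩
  rw [partialDeriv_radialCutoff, Complex.norm_real, Real.norm_eq_abs, abs_mul, abs_neg]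
  have hL : (0 : ℝ) < (n : ℝ) + 1 := by positivity
  by_cases hQ : ∑ j, m j * X j ^ 2 ≤ 2 * ((n : ℝ) + 1) ^ 2
  · have h1 : m i * X i ^ 2 ≤ 2 * ((n : ℝ) + 1) ^ 2 :=
      (Finset.single_le_sum (f := fun j => m j * X j ^ 2)
        (fun j _ => mul_nonneg (hm j).le (sq_nonneg _)) (Finset.mem_univ i)).trans hQ
    -- Squaring, this follows from `m_i² X_i² ≤ 2 m_i (n+1)²` and `2 m_i ≤ (m_i + 1)²`.
    have h2 : |m i * X i| ≤ (m i + 1) * ((n : ℝ) + 1) := by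
      refine abs_le_of_sq_le_sq ?_ (mul_nonneg (by linarith [hm i]) hL.le)
      have := mul_le_mul_of_nonneg_left h1 (hm i).le
      nlinarith [mul_nonneg (add_nonneg zero_le_one (sq_nonneg (m i))) (sq_nonneg ((n : ℝ) + 1))]
    have h3 : m i ≤ ∑ j, m j :=
      Finset.single_le_sum (f := m) (fun j _ => (hm j).le) (Finset.mem_univ i)
    have h4 : |2 * (m i * X i) / ((n : ℝ) + 1) ^ 2| ≤ 2 * (∑ j, m j + 1) / ((n : ℝ) + 1) := by
      rw [abs_div, abs_mul, abs_two, abs_of_pos (pow_pos hL 2), div_le_div_iff₀ (pow_pos hL 2) hL]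
      have h5 : |m i * X i| ≤ (∑ j, m j + 1) * ((n : ℝ) + 1) :=
        h2.trans (mul_le_mul_of_nonneg_right (by linarith) hL.le)
      nlinarith
    refine (mul_le_mul (hC _) h4 (abs_nonneg _) hC0).trans (le_of_eq ?_)
    ring
  · rw [deriv_smoothTransition_of_nonpos, abs_zero, zero_mul]
    · positivity
    · rw [sub_neg, lt_div_iff₀ (pow_pos hL 2)]
      exact not_le.1 hQ

theorem norm_radialCutoff_le (n : ℕ) (X : Fin N → ℝ) : ‖radialCutoff m n X‖ ≤ 1 := by
  rw [radialCutoff, Complex.norm_real, Real.norm_of_nonneg (Real.smoothTransition.nonneg _)]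
  exact Real.smoothTransition.le_one _

theorem tendsto_radialCutoff (X : Fin N → ℝ) :
    Tendsto (fun n => radialCutoff m n X) atTop (𝓝 1) := by
  have h1 : Tendsto (fun n : ℕ => 2 - (∑ j, m j * X j ^ 2) / ((n : ℝ) + 1) ^ 2) atTop (𝓝 2) := by
    have h2 : Tendsto (fun n : ℕ => ((n : ℝ) + 1) ^ 2) atTop atTop :=
      (tendsto_pow_atTop two_ne_zero).comp
        (tendsto_atTop_add_const_right _ _ tendsto_natCast_atTop_atTop)
    simpa using (tendsto_const_nhds (x := (2 : ℝ))).sub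
      ((tendsto_const_nhds (x := ∑ j, m j * X j ^ 2)).div_atTop h2)
  refine tendsto_const_nhds.congr' ?_
  filter_upwards [h1.eventually (lt_mem_nhds (show (1 : ℝ) < 2 by norm_num))] with n hn
  rw [radialCutoff, Real.smoothTransition.one_of_one_le hn.le, Complex.ofReal_one]

/-- The approximants are `Φ₀` times radial cutoffs. The gradients of the cutoffs tend to zero
uniformly and `|Φ₀|²` is integrable, so the form of the differences tends to zero. -/
theorem toLp_groundStateFun_mem_formDomain (hm : ∀ j, 0 < m j)
    (hΦ : MemLp (groundStateFun m κ) 2 (volume : Measure (Fin N → ℝ))) {T : L2 N →ₗ.[ℂ] L2 N}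
    (hT : IsRealization (hamiltonian m κ) (initialDomain m κ) T) :
    hΦ.toLp ∈ formDomain T := by
  obtain ⟨C, hC0, hC⟩ := exists_norm_partialDeriv_radialCutoff_le hm
  have hmem := fun n => memLp_groundStateFun_mul hΦ
    (contDiff_radialCutoff (m := m) n).continuous.aestronglyMeasurable (norm_radialCutoff_le n)
  have hdom : ∀ n, (hmem n).toLp ∈ T.domain := fun n => (hT.1 _).2
    ⟨_, (initialDomain_eq m κ).symm ▸ ⟨_, radialCutoff_mem_smoothCore hm n, rfl⟩,
      (hmem n).coeFn_toLp⟩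
  set s : ℕ → T.domain := fun n => ⟨(hmem n).toLp, hdom n⟩ with hs
  have hlim : Tendsto (fun n => (s n : L2 N)) atTop (𝓝 hΦ.toLp) := by
    refine tendsto_of_ae_eq_groundStateFun_mul hΦ (g := fun n => radialCutoff m n)
      (g₀ := fun _ => 1) (B := 1 + 1) (fun n => (contDiff_radialCutoff n).continuous)
      continuous_const (fun n X => ?_) (fun X _ => tendsto_radialCutoff X)
      (fun n => (hmem n).coeFn_toLp) ?_
    · refine (norm_sub_le _ _).trans (add_le_add (norm_radialCutoff_le n X) (by simp))
    · filter_upwards [hΦ.coeFn_toLp] with X hX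
      simp [hX]
  refine ⟨s, hlim, ?_⟩
  have hw := integrable_weight hΦ
  have hform : ∀ p : ℕ × ℕ, inner ℂ ((s p.1 - s p.2 : T.domain) : L2 N) (T (s p.1 - s p.2))
      = ((groundEnergy m κ * ‖(s p.1 : L2 N) - s p.2‖ ^ 2
      + ∫ X, weight m κ X * ∑ j, 1 / m j *
        ‖partialDeriv j (radialCutoff m p.1 - radialCutoff m p.2) X‖ ^ 2 : ℝ) : ℂ) := by
    intro p
    refine inner_self_realization (fun j => (hm j).ne') hΦ hT _ ((smoothCore m).sub_mem
      (radialCutoff_mem_smoothCore hm p.1) (radialCutoff_mem_smoothCore hm p.2)) ?_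
    refine (Lp.coeFn_sub _ _).trans ?_
    rw [mul_sub]
    exact (hmem p.1).coeFn_toLp.sub (hmem p.2).coeFn_toLp
  simp only [hform]
  have hN : Tendsto (fun p : ℕ × ℕ => ‖(s p.1 : L2 N) - s p.2‖ ^ 2) atTop (𝓝 0) := by
    have := (cauchySeq_iff_tendsto_dist_atTop_0.1 hlim.cauchySeq).pow 2
    simpa [dist_eq_norm] using this
  have hz : Tendsto (fun n : ℕ => C / ((n : ℝ) + 1)) atTop (𝓝 0) :=
    tendsto_const_nhds.div_atTop
      (tendsto_atTop_add_const_right _ _ tendsto_natCast_atTop_atTop)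
  have hE : Tendsto (fun p : ℕ × ℕ => ∫ X, weight m κ X * ∑ j, 1 / m j *
      ‖partialDeriv j (radialCutoff m p.1 - radialCutoff m p.2) X‖ ^ 2) atTop (𝓝 0) := by
    have hup : Tendsto (fun p : ℕ × ℕ => ∫ X, weight m κ X * ∑ j, 1 / m j *
        (C / ((p.1 : ℝ) + 1) + C / ((p.2 : ℝ) + 1)) ^ 2) atTop (𝓝 0) := by
      simp only [integral_mul_const]
      have h1 : Tendsto (fun p : ℕ × ℕ => (C / ((p.1 : ℝ) + 1) + C / ((p.2 : ℝ) + 1)) ^ 2)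
          atTop (𝓝 0) := by
        rw [← prod_atTop_atTop_eq]
        simpa using ((hz.comp tendsto_fst).add (hz.comp tendsto_snd)).pow 2
      have h2 := (tendsto_finsetSum Finset.univ fun (j : Fin N) _ =>
        h1.const_mul (1 / m j)).const_mul (∫ X, weight m κ X)
      simpa using h2
    refine squeeze_zero (fun p => integral_nonneg fun X => mul_nonneg (weight_nonneg X)
      (Finset.sum_nonneg fun j _ => ?_)) (fun p => ?_) hup
    · have := hm j
      positivity
    · refine integral_mono_of_nonneg (Eventually.of_forall fun X => mul_nonneg (weight_nonneg X)
        (Finset.sum_nonneg fun j _ => ?_)) (hw.mul_const _) (Eventually.of_forall fun X => ?_)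
      · have := hm j
        positivity
      · refine mul_le_mul_of_nonneg_left (Finset.sum_le_sum fun j _ => ?_) (weight_nonneg X)
        have := hm j
        refine mul_le_mul_of_nonneg_left (pow_le_pow_left₀ (norm_nonneg _) ?_ 2) (by positivity)
        have h1 := partialDeriv_add_smul (contDiff_radialCutoff (m := m) p.1)
          (contDiff_radialCutoff (m := m) p.2) (-1) j
        rw [neg_one_smul, ← sub_eq_add_neg] at h1
        rw [h1, Pi.add_apply]
        refine (norm_add_le _ _).trans (add_le_add (hC _ _ _) ?_)
        simpa using hC p.2 j X
  have h0 : (0 : ℂ) = ((groundEnergy m κ * 0 + 0 : ℝ) : ℂ) := by simp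
  rw [h0]
  exact ((hN.const_mul _).add hE).ofReal

theorem isGroundState_toLp_groundStateFun (hm : ∀ j, 0 < m j)
    (hΦ : MemLp (groundStateFun m κ) 2 (volume : Measure (Fin N → ℝ))) {T A : L2 N →ₗ.[ℂ] L2 N}
    (hT : IsRealization (hamiltonian m κ) (initialDomain m κ) T)
    (hd : Dense (T.domain : Set (L2 N))) (hA : IsFriedrichsExtension T A)
    (hb : IsBoundedBelowBy A (groundEnergy m κ)) :
    IsGroundState A (groundEnergy m κ) hΦ.toLp := by
  -- Green's formula with `h = 1` has no gradient term, which is the weak eigenvalue equation.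
  have key : ∀ v : T.domain, inner ℂ ((groundEnergy m κ : ℂ) • hΦ.toLp) (v : L2 N)
      = inner ℂ hΦ.toLp (T v) := by
    intro v
    obtain ⟨g, hg, hv⟩ := exists_smoothCore_of_mem_domain hT v
    have hz : ∀ (j : Fin N) (X : Fin N → ℝ), partialDeriv j (fun _ => (1 : ℂ)) X = 0 := fun j X =>
      (hasDerivAt_const _ _).deriv
    rw [inner_realization (fun j => (hm j).ne') hΦ hT v (h := fun _ => 1) (B := 1) contDiff_const
      (by simp) (by simp [hz]) hg (by filter_upwards [hΦ.coeFn_toLp] with X hX; simp [hX]) hv]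
    rw [inner_smul_left, Complex.conj_ofReal]
    simp [gradProd, hz]
  have hadj : hΦ.toLp ∈ T†.domain := LinearPMap.mem_adjoint_domain_of_exists _ ⟨_, key⟩
  have hdom : hΦ.toLp ∈ A.domain :=
    (hA.2 _).2 ⟨hadj, toLp_groundStateFun_mem_formDomain hm hΦ hT⟩
  refine ⟨fun h0 => ?_, ⟨hdom, ?_⟩, hb⟩
  · have h1 : groundStateFun m κ =ᵐ[volume] 0 :=
      hΦ.coeFn_toLp.symm.trans (h0 ▸ Lp.coeFn_zero _ _ _)
    have h2 : ∀ᵐ _ : Fin N → ℝ, False := by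
      filter_upwards [h1, ae_mem_configSpace N] with X hX hX' using groundStateFun_ne_zero hX' hX
    exact (NeZero.ne (volume : Measure (Fin N → ℝ))) (by simpa using h2)
  · rw [hA.1.2 (y := ⟨_, hadj⟩) rfl]
    exact LinearPMap.adjoint_apply_eq hd _ key

end GroundState

/-! ### Zero capacity of the collision hyperplanes. -/

section Capacity

open scoped ComplexConjugate

variable {N : ℕ} {m : Fin N → ℝ} {κ : ℝ}

theorem integrable_indicator_inv_abs {δ M : ℝ} (hδ : 0 < δ) (hM : δ ≤ M) :
    Integrable (fun s : ℝ => (Set.Icc δ M).indicator (·⁻¹) |s|) ∧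
      ∫ s : ℝ, (Set.Icc δ M).indicator (·⁻¹) |s| = 2 * Real.log (M / δ) := by
  constructor
  · have hb : Integrable ((Set.Icc (-M) M).indicator fun _ : ℝ => δ⁻¹) :=
      (integrable_indicator_iff measurableSet_Icc).2 (integrableOn_const (by simp))
    refine hb.mono' ?_ (Eventually.of_forall fun s => ?_)
    · exact ((measurable_inv.indicator measurableSet_Icc).comp
        measurable_norm).aestronglyMeasurable
    · by_cases hs : |s| ∈ Set.Icc δ M
      · rw [Set.indicator_of_mem hs, norm_inv, norm_abs_eq_norm,
          Set.indicator_of_mem (show s ∈ Set.Icc (-M) M from abs_le.1 hs.2)]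
        exact inv_anti₀ hδ (by simpa using hs.1)
      · rw [Set.indicator_of_notMem hs, norm_zero]
        exact Set.indicator_nonneg (fun _ _ => (inv_pos.2 hδ).le) _
  · have hsub : Set.Icc δ M ⊆ Set.Ioi 0 := fun s hs => hδ.trans_le hs.1
    rw [integral_comp_abs, setIntegral_indicator measurableSet_Icc, Set.inter_eq_right.2 hsub, integral_Icc_eq_integral_Ioc,
      ← intervalIntegral.integral_of_le hM, integral_inv_of_pos hδ (hδ.trans_le hM)]

/-- The function `1 / |X_j - X_k|`, restricted to a cube and to `δ ≤ |X_j - X_k| ≤ M`, has integral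
`O(log (M / δ))`. -/
theorem exists_integrable_ge_inv_abs_sub {j k : Fin N} (hjk : j ≠ k) {δ M : ℝ} (hδ : 0 < δ)
    (hM : δ ≤ M) :
    ∃ Θ : (Fin N → ℝ) → ℝ, Integrable Θ ∧ (∀ X, 0 ≤ Θ X) ∧
      ∫ X, Θ X = (2 * M) ^ (N - 1) * (2 * Real.log (M / δ)) ∧
      ∀ X, (∀ i, |X i| ≤ M) → δ ≤ |X j - X k| → |X j - X k| ≤ M → |X j - X k|⁻¹ ≤ Θ X := by
  obtain ⟨hi, hint⟩ := integrable_indicator_inv_abs hδ hM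
  have hM0 : 0 < M := hδ.trans_le hM
  let f : Fin N → ℝ → ℝ := fun i => if i = j then fun s => (Set.Icc δ M).indicator (·⁻¹) |s|
    else (Set.Icc (-M) M).indicator fun _ => 1
  have hfi : ∀ i, Integrable (f i) := fun i => by
    by_cases h : i = j
    · simpa [f, h] using hi
    · simpa [f, h] using (integrable_indicator_iff (measurableSet_Icc (a := -M) (b := M))).2
        (integrableOn_const (C := (1 : ℝ)) (by simp))
  have hf0 : ∀ i s, 0 ≤ f i s := fun i s => by
    by_cases h : i = j
    · simp only [f, h, if_true]
      exact Set.indicator_nonneg (fun t ht => inv_nonneg.2 (hδ.le.trans ht.1)) _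
    · simp only [f, h, if_false]
      exact Set.indicator_nonneg (fun _ _ => zero_le_one) _
  -- The shear that replaces `X_j` by `X_j - X_k` preserves volume and turns the majorant into a
  -- product of functions of one coordinate.
  have hS := Real.volume_preserving_transvectionStruct
    (⟨j, k, hjk, -1⟩ : Matrix.TransvectionStruct (Fin N) ℝ)
  set S := Matrix.toLin' (Matrix.TransvectionStruct.toMatrix
    (⟨j, k, hjk, -1⟩ : Matrix.TransvectionStruct (Fin N) ℝ)) with hSdef
  have hSj : ∀ X, S X j = X j - X k := fun X => by
    simp [hSdef, Matrix.transvection, Matrix.single_mulVec, sub_eq_add_neg]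
  have hSi : ∀ X i, i ≠ j → S X i = X i := fun X i h => by
    simp [hSdef, Matrix.transvection, Matrix.single_mulVec, h]
  have hF : Integrable fun X : Fin N → ℝ => ∏ i, f i (X i) := Integrable.fintype_prod_dep hfi
  refine ⟨fun X => ∏ i, f i (S X i), (hS.integrable_comp hF.1).2 hF,
    fun X => Finset.prod_nonneg fun i _ => hf0 i _, ?_, fun X h1 h2 h3 => ?_⟩
  · have h4 : ∫ X, ∏ i, f i (S X i) = ∫ X : Fin N → ℝ, ∏ i, f i (X i) := by
      conv_rhs => rw [← hS.map_eq]
      exact (integral_map hS.measurable.aemeasurable (by rw [hS.map_eq]; exact hF.1)).symm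
    rw [h4, integral_fintype_prod_volume_eq_prod, ← Finset.mul_prod_erase _ _ (Finset.mem_univ j),
      mul_comm]
    congr 1
    · have : ∀ i ∈ Finset.univ.erase j, ∫ s, f i s = 2 * M := fun i hi => by
        have h := Finset.ne_of_mem_erase hi
        simp only [f, h, if_false]
        rw [integral_indicator measurableSet_Icc]
        simp [hM0.le]
        ring
      rw [Finset.prod_congr rfl this, Finset.prod_const, Finset.card_erase_of_mem
        (Finset.mem_univ j), Finset.card_univ, Fintype.card_fin]
    · simpa [f] using hint
  · have h4 : ∏ i, f i (S X i) = f j (S X j) := by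
      refine Finset.prod_eq_single j (fun i _ hi => ?_) (by simp)
      simp only [f, hi, if_false, hSi X i hi]
      exact Set.indicator_of_mem (show X i ∈ Set.Icc (-M) M from abs_le.1 (h1 i)) _
    change _ ≤ ∏ i, f i (S X i)
    rw [h4, hSj]
    simp only [f, if_true]
    exact (Set.indicator_of_mem (s := Set.Icc δ M) (f := (·⁻¹)) ⟨h2, h3⟩).ge

/-- One pair keeps its small factor `d` and all others are bounded crudely. This serves both the
weight and the discriminant. -/
theorem prod_prod_Ioi_le {f B : Fin N → Fin N → ℝ} {d : ℝ} (hf0 : ∀ a b, 0 ≤ f a b)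
    (hfB : ∀ a b, f a b ≤ B a b) {j k : Fin N} (hjk : j < k) (hs : f j k ≤ B j k * d) :
    ∏ a, ∏ b ∈ Finset.Ioi a, f a b ≤ (∏ a, ∏ b ∈ Finset.Ioi a, B a b) * d := by
  have h1 : ∀ a b, f a b ≤ B a b * (if a = j then if b = k then d else 1 else 1) := by
    intro a b
    split_ifs with h h'
    · rw [h, h']; exact hs
    · rw [mul_one]; exact hfB a b
    · rw [mul_one]; exact hfB a b
  have h2 : ∏ a, ∏ b ∈ Finset.Ioi a, (if a = j then if b = k then d else 1 else 1) = d := by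
    rw [Finset.prod_eq_single j]
    · simp [hjk]
    · intro a _ ha; simp [ha]
    · simp
  calc _ ≤ ∏ a, ∏ b ∈ Finset.Ioi a, B a b * (if a = j then if b = k then d else 1 else 1) :=
        Finset.prod_le_prod (fun a _ => Finset.prod_nonneg fun b _ => hf0 a b) fun a _ =>
          Finset.prod_le_prod (fun b _ => hf0 a b) fun b _ => h1 a b
    _ = _ := by simp only [Finset.prod_mul_distrib, h2]

/-- The pair `j, k` enters `|Φ₀|²` with exponent `2 κ m_j m_k ≥ 1`, so one power of the gap can be
split off; the Gaussian factors are at most one. The absolute value keeps the exponents non-negative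
also for `a = b`, where `hα` says nothing. -/
theorem weight_le (hm : ∀ j, 0 < m j) (hα : ∀ j k, j ≠ k → 1 / 2 ≤ κ * m j * m k) {M : ℝ}
    (hM : 1 ≤ M) {X : Fin N → ℝ} (hX : ∀ a b, |X a - X b| ≤ M) {j k : Fin N} (hjk : j ≠ k) :
    weight m κ X ≤ (∏ a, ∏ b ∈ Finset.Ioi a, M ^ (|κ * m a * m b| * 2)) * |X j - X k| := by
  wlog h : j < k generalizing j k
  · rw [abs_sub_comm]
    exact this hjk.symm (lt_of_le_of_ne (not_lt.1 h) hjk.symm)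
  have hw : weight m κ X ≤ ∏ a, ∏ b ∈ Finset.Ioi a, |X b - X a| ^ (|κ * m a * m b| * 2) := by
    have h1 : weight m κ X = (∏ j, Real.exp (-(m j * X j ^ 2 / 2))) ^ 2 *
        ∏ a, ∏ b ∈ Finset.Ioi a, |X b - X a| ^ (|κ * m a * m b| * 2) := by
      rw [weight, groundStateFun, norm_mul, mul_pow, norm_prod, norm_prod]
      congr 1
      · congr 1
        exact Finset.prod_congr rfl fun a _ => by
          rw [Complex.norm_real, Real.norm_of_nonneg (Real.exp_pos _).le]
      · rw [← Finset.prod_pow]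
        refine Finset.prod_congr rfl fun a _ => ?_
        rw [norm_prod, ← Finset.prod_pow]
        refine Finset.prod_congr rfl fun b hb => ?_
        have hpos : 0 ≤ κ * m a * m b := by
          have := hα a b (Finset.mem_Ioi.1 hb).ne
          linarith
        rw [Complex.norm_cpow_real, Complex.norm_real, Real.norm_eq_abs, abs_of_nonneg hpos,
          Real.rpow_mul (abs_nonneg _) (κ * m a * m b), Real.rpow_two]
    rw [h1]
    refine mul_le_of_le_one_left (Finset.prod_nonneg fun a _ => Finset.prod_nonneg fun b _ =>
      Real.rpow_nonneg (abs_nonneg _) _) (pow_le_one₀ (Finset.prod_nonneg fun a _ =>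
      (Real.exp_pos _).le) (Finset.prod_le_one (fun a _ => (Real.exp_pos _).le) fun a _ => ?_))
    have := hm a
    exact Real.exp_le_one_iff.2 (neg_nonpos.2 (by positivity))
  refine hw.trans (prod_prod_Ioi_le (f := fun a b => |X b - X a| ^ (|κ * m a * m b| * 2))
    (fun a b => Real.rpow_nonneg (abs_nonneg _) _)
    (fun a b => Real.rpow_le_rpow (abs_nonneg _) (hX b a) (by positivity)) h ?_)
  have hp : 0 ≤ |κ * m j * m k| * 2 - 1 := by
    have := hα j k hjk
    have := le_abs_self (κ * m j * m k)
    linarith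
  have h2 : |κ * m j * m k| * 2 = (|κ * m j * m k| * 2 - 1) + 1 := by ring
  calc |X k - X j| ^ (|κ * m j * m k| * 2)
      = |X k - X j| ^ (|κ * m j * m k| * 2 - 1) * |X k - X j| := by
        conv_lhs => rw [h2]
        rw [Real.rpow_add_of_nonneg (abs_nonneg _) hp zero_le_one, Real.rpow_one]
    _ ≤ M ^ (|κ * m j * m k| * 2 - 1) * |X k - X j| :=
        mul_le_mul_of_nonneg_right (Real.rpow_le_rpow (abs_nonneg _) (hX k j) hp) (abs_nonneg _)
    _ ≤ M ^ (|κ * m j * m k| * 2) * |X j - X k| := by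
        rw [abs_sub_comm (X k)]
        exact mul_le_mul_of_nonneg_right (Real.rpow_le_rpow_of_exponent_le hM (by linarith))
          (abs_nonneg _)

/-- In a bounded region the discriminant is at most a constant times the square of any single gap,
so where the cutoff varies every gap is at least of order `exp (-t)`. -/
theorem le_abs_sub_of_le_discr {M : ℝ} (hM : 1 ≤ M) {X : Fin N → ℝ}
    (hX : ∀ a b, |X a - X b| ≤ M) {t : ℝ} (h : Real.exp (-2 * t) ≤ discr X) {j k : Fin N}
    (hjk : j ≠ k) :
    Real.exp (-t) / (∏ a : Fin N, ∏ _b ∈ Finset.Ioi a, M ^ 2) ≤ |X j - X k| := by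
  wlog hlt : j < k generalizing j k
  · rw [abs_sub_comm]
    exact this hjk.symm (lt_of_le_of_ne (not_lt.1 hlt) hjk.symm)
  have hM2 : 1 ≤ M ^ 2 := one_le_pow₀ hM
  set P := ∏ a : Fin N, ∏ _b ∈ Finset.Ioi a, M ^ 2 with hP
  have hP1 : 1 ≤ P := by
    rw [hP]
    have h1 : ∏ a : Fin N, ∏ _b ∈ Finset.Ioi a, (1 : ℝ) ≤ ∏ a : Fin N, ∏ _b ∈ Finset.Ioi a, M ^ 2 :=
      Finset.prod_le_prod (fun _ _ => by simp) fun a _ =>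
        Finset.prod_le_prod (fun _ _ => by simp) fun _ _ => hM2
    simpa using h1
  have h1 : discr X ≤ P * (X k - X j) ^ 2 := by
    refine prod_prod_Ioi_le (f := fun a b => (X b - X a) ^ 2) (B := fun _ _ => M ^ 2)
      (fun a b => sq_nonneg _) (fun a b => ?_) hlt ?_
    · rw [← sq_abs]; exact pow_le_pow_left₀ (abs_nonneg _) (hX b a) 2
    · exact le_mul_of_one_le_left (sq_nonneg _) hM2
  rw [div_le_iff₀ (by linarith)]
  refine le_of_sq_le_sq ?_ (by positivity)
  have h2 : Real.exp (-t) ^ 2 = Real.exp (-2 * t) := by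
    rw [← Real.exp_nat_mul]; congr 1; push_cast; ring
  rw [h2, mul_pow, sq_abs]
  refine h.trans (h1.trans ?_)
  have h3 : P ≤ P ^ 2 := by nlinarith
  have h4 : (X k - X j) ^ 2 = (X j - X k) ^ 2 := by ring
  rw [h4, mul_comm]
  exact mul_le_mul_of_nonneg_left h3 (sq_nonneg _)

/-- If all exponents are at least `1 / 2`, the collision hyperplanes have zero capacity for the
weighted Dirichlet form. -/
theorem tendsto_integral_collisionCutoff (hm : ∀ j, 0 < m j)
    (hα : ∀ j k, j ≠ k → 1 / 2 ≤ κ * m j * m k)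
    (hΦ : MemLp (groundStateFun m κ) 2 (volume : Measure (Fin N → ℝ)))
    {g : (Fin N → ℝ) → ℂ} (hg : ContDiff ℝ ∞ g) (hc : HasCompactSupport g) :
    Tendsto (fun n : ℕ => ∫ X, weight m κ X * ∑ j, 1 / m j *
      ‖partialDeriv j (g - fun X => (collisionCutoff n X : ℂ) * g X) X‖ ^ 2) atTop (𝓝 0) := by
  obtain ⟨B₁, hB₁0, hB₁⟩ := exists_norm_le_of_hasCompactSupport hg.continuous hc
  obtain ⟨B₂, hB₂0, hB₂⟩ := exists_norm_partialDeriv_le hg hc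
  obtain ⟨B₃, hB₃0, hχ'⟩ := exists_hasLineDerivAt_collisionCutoff N
  obtain ⟨R, hR0, hR⟩ := hc.isCompact.isBounded.exists_pos_norm_le
  have hw := integrable_weight hΦ
  -- On the support of `g` this bounds the coordinates and their differences, and it is at least
  -- one.
  set M : ℝ := 2 * R + 1 with hMdef
  have hM1 : 1 ≤ M := by linarith
  have hcoord : ∀ X, g X ≠ 0 → (∀ i, |X i| ≤ M) ∧ ∀ a b, |X a - X b| ≤ M := by
    intro X hX
    have h1 : ∀ i, |X i| ≤ R := fun i =>
      (norm_le_pi_norm X i).trans (hR X (subset_tsupport _ hX))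
    refine ⟨fun i => (h1 i).trans (by linarith), fun a b => (abs_sub _ _).trans ?_⟩
    linarith [h1 a, h1 b]
  set P := ∏ a : Fin N, ∏ _b ∈ Finset.Ioi a, M ^ 2 with hP
  set Cw := ∏ a, ∏ b ∈ Finset.Ioi a, M ^ (|κ * m a * m b| * 2) with hCw
  have hP0 : 1 ≤ P := by
    have h1 : ∏ a : Fin N, ∏ _b ∈ Finset.Ioi a, (1 : ℝ) ≤ P :=
      Finset.prod_le_prod (fun _ _ => by simp) fun a _ =>
        Finset.prod_le_prod (fun _ _ => by simp) fun _ _ => one_le_pow₀ hM1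
    simpa using h1
  have hCw0 : 0 ≤ Cw := Finset.prod_nonneg fun a _ => Finset.prod_nonneg fun b _ =>
    Real.rpow_nonneg (by linarith) _
  set V := (2 * M) ^ (N - 1) with hV
  have hV0 : 0 ≤ V := by positivity
  -- `Θ` dominates the inverse gap on the region where the gradient of the cutoff can be non-zero.
  -- As the smallest gap is of order `exp (-(n+1))`, its logarithmic integral grows only linearly in
  -- `n`.
  have hΘ : ∀ (n : ℕ) (j k : Fin N), ∃ Θ : (Fin N → ℝ) → ℝ, Integrable Θ ∧ (∀ X, 0 ≤ Θ X) ∧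
      ∫ X, Θ X ≤ V * (2 * (Real.log (M * P) + ((n : ℝ) + 1))) ∧
      (j ≠ k → ∀ X, (∀ i, |X i| ≤ M) → Real.exp (-((n : ℝ) + 1)) / P ≤ |X j - X k| →
        |X j - X k| ≤ M → |X j - X k|⁻¹ ≤ Θ X) := by
    intro n j k
    by_cases hjk : j = k
    · refine ⟨fun _ => 0, integrable_zero _ _ _, fun _ => le_rfl, ?_, fun h => absurd hjk h⟩
      have : 0 ≤ Real.log (M * P) := Real.log_nonneg (by nlinarith)
      simp only [integral_zero]
      positivity
    · have hδ : 0 < Real.exp (-((n : ℝ) + 1)) / P := by positivity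
      have hδM : Real.exp (-((n : ℝ) + 1)) / P ≤ M := by
        rw [div_le_iff₀ (by linarith)]
        have : Real.exp (-((n : ℝ) + 1)) ≤ 1 :=
          Real.exp_le_one_iff.2 (neg_nonpos.2 (by positivity))
        nlinarith
      obtain ⟨Θ, h1, h2, h3, h4⟩ := exists_integrable_ge_inv_abs_sub hjk hδ hδM
      refine ⟨Θ, h1, h2, ?_, fun _ => h4⟩
      rw [h3]
      refine le_of_eq ?_
      congr 2
      have : M / (Real.exp (-((n : ℝ) + 1)) / P) = M * P * Real.exp ((n : ℝ) + 1) := by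
        rw [Real.exp_neg]; field_simp
      rw [this, Real.log_mul (by positivity) (Real.exp_pos _).ne', Real.log_exp]
  choose Θ hΘi hΘ0 hΘint hΘle using hΘ
  set σ := ∑ j, 1 / m j with hσ
  have hmi : ∀ j, 0 ≤ 1 / m j := fun j => by have := hm j; positivity
  have hσ0 : 0 ≤ σ := Finset.sum_nonneg fun j _ => hmi j
  set K₁ := σ * (2 * B₂ ^ 2) with hK₁
  set K₂ := σ * (2 * (B₃ ^ 2 * B₁ ^ 2 * N * Cw)) with hK₂
  -- The gradient of `g - χ g` is `(1 - χ) ∇g - g ∇χ`. In the second term the linear vanishing of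
  -- the weight reduces the squared inverse gaps to inverse gaps, which `Θ` dominates.
  have hpt : ∀ (n : ℕ), ∀ X ∈ configSpace N, weight m κ X * ∑ j, 1 / m j *
      ‖partialDeriv j (g - fun X => (collisionCutoff n X : ℂ) * g X) X‖ ^ 2
      ≤ weight m κ X * (1 - collisionCutoff n X) ^ 2 * K₁
        + K₂ / ((n : ℝ) + 1) ^ 2 * ∑ j, ∑ k, Θ n j k X := by
    intro n X hX
    obtain ⟨b, hb, hb0, hd⟩ := hχ' n X hX
    have hn : (0 : ℝ) < (n : ℝ) + 1 := by positivity
    have hder : ∀ j, partialDeriv j (g - fun X => (collisionCutoff n X : ℂ) * g X) X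
        = ((1 - collisionCutoff n X : ℝ) : ℂ) * partialDeriv j g X
          - ((b / (n + 1) * ∑ k, (X j - X k)⁻¹ : ℝ) : ℂ) * g X := by
      intro j
      have h1 := hasLineDerivAt_partialDeriv hg j X
      have h2 := hasLineDerivAt_mul (hasLineDerivAt_ofReal (hd j)) h1
      refine (HasDerivAt.sub h1 h2).deriv.trans ?_
      push_cast
      ring
    have hsum : ∀ j, weight m κ X * (b / (n + 1) * ∑ k, (X j - X k)⁻¹) ^ 2 * ‖g X‖ ^ 2
        ≤ B₃ ^ 2 * B₁ ^ 2 * N * Cw / ((n : ℝ) + 1) ^ 2 * ∑ j, ∑ k, Θ n j k X := by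
      intro j
      have hrhs : 0 ≤ B₃ ^ 2 * B₁ ^ 2 * N * Cw / ((n : ℝ) + 1) ^ 2 * ∑ j, ∑ k, Θ n j k X :=
        mul_nonneg (by positivity)
          (Finset.sum_nonneg fun j _ => Finset.sum_nonneg fun k _ => hΘ0 n j k X)
      by_cases hg0 : g X = 0
      · simpa [hg0] using hrhs
      by_cases hbz : b = 0
      · simpa [hbz] using hrhs
      obtain ⟨hX1, hX2⟩ := hcoord X hg0
      have hdis : Real.exp (-2 * ((n : ℝ) + 1)) ≤ discr X := not_lt.1 fun h => hbz (hb0 h)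
      have hterm : ∀ k, weight m κ X * ((X j - X k)⁻¹) ^ 2 ≤ Cw * Θ n j k X := by
        intro k
        by_cases hjk : j = k
        · subst hjk
          simpa using mul_nonneg hCw0 (hΘ0 n j j X)
        · have h1 := weight_le hm hα hM1 hX2 hjk
          have h2 := hΘle n j k hjk X hX1 (le_abs_sub_of_le_discr hM1 hX2 hdis hjk) (hX2 j k)
          have h3 : |X j - X k| ≠ 0 := abs_ne_zero.2 (sub_ne_zero_of_mem_configSpace hX hjk)
          calc weight m κ X * ((X j - X k)⁻¹) ^ 2
              ≤ Cw * |X j - X k| * ((X j - X k)⁻¹) ^ 2 :=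
                mul_le_mul_of_nonneg_right h1 (sq_nonneg _)
            _ = Cw * |X j - X k|⁻¹ := by
                rw [← sq_abs, abs_inv]; field_simp
            _ ≤ Cw * Θ n j k X := mul_le_mul_of_nonneg_left h2 hCw0
      have hcs : (∑ k, (X j - X k)⁻¹) ^ 2 ≤ N * ∑ k, ((X j - X k)⁻¹) ^ 2 := by
        have := sq_sum_le_card_mul_sum_sq (s := Finset.univ) (f := fun k => (X j - X k)⁻¹)
        simpa using this
      have hwsum : weight m κ X * (∑ k, (X j - X k)⁻¹) ^ 2 ≤ N * (Cw * ∑ j, ∑ k, Θ n j k X) := by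
        calc weight m κ X * (∑ k, (X j - X k)⁻¹) ^ 2
            ≤ weight m κ X * (N * ∑ k, ((X j - X k)⁻¹) ^ 2) :=
              mul_le_mul_of_nonneg_left hcs (weight_nonneg X)
          _ = N * ∑ k, weight m κ X * ((X j - X k)⁻¹) ^ 2 := by
              rw [← Finset.mul_sum]; ring
          _ ≤ N * ∑ k, Cw * Θ n j k X :=
              mul_le_mul_of_nonneg_left (Finset.sum_le_sum fun k _ => hterm k) (Nat.cast_nonneg N)
          _ ≤ N * (Cw * ∑ j, ∑ k, Θ n j k X) := by
              rw [← Finset.mul_sum]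
              refine mul_le_mul_of_nonneg_left (mul_le_mul_of_nonneg_left ?_ hCw0)
                (Nat.cast_nonneg N)
              exact Finset.single_le_sum (f := fun j => ∑ k, Θ n j k X)
                (fun j _ => Finset.sum_nonneg fun k _ => hΘ0 n j k X) (Finset.mem_univ j)
      have hb2 : b ^ 2 ≤ B₃ ^ 2 := by
        rw [← sq_abs]; exact pow_le_pow_left₀ (abs_nonneg _) hb 2
      have hg2 : ‖g X‖ ^ 2 ≤ B₁ ^ 2 := pow_le_pow_left₀ (norm_nonneg _) (hB₁ X) 2
      have hS0 : 0 ≤ N * (Cw * ∑ j, ∑ k, Θ n j k X) :=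
        (mul_nonneg (weight_nonneg X) (sq_nonneg _)).trans hwsum
      calc weight m κ X * (b / (n + 1) * ∑ k, (X j - X k)⁻¹) ^ 2 * ‖g X‖ ^ 2
          = b ^ 2 * ‖g X‖ ^ 2 * (weight m κ X * (∑ k, (X j - X k)⁻¹) ^ 2) / ((n : ℝ) + 1) ^ 2 := by
            field_simp
        _ ≤ B₃ ^ 2 * B₁ ^ 2 * (N * (Cw * ∑ j, ∑ k, Θ n j k X)) / ((n : ℝ) + 1) ^ 2 := by
            refine div_le_div_of_nonneg_right ?_ (by positivity)
            exact mul_le_mul (mul_le_mul hb2 hg2 (sq_nonneg _) (sq_nonneg _)) hwsum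
              (mul_nonneg (weight_nonneg X) (sq_nonneg _)) (by positivity)
        _ = _ := by ring
    have hj : ∀ j, weight m κ X * (1 / m j *
        ‖partialDeriv j (g - fun X => (collisionCutoff n X : ℂ) * g X) X‖ ^ 2)
        ≤ 1 / m j * (weight m κ X * (1 - collisionCutoff n X) ^ 2 * (2 * B₂ ^ 2)
          + 2 * (B₃ ^ 2 * B₁ ^ 2 * N * Cw / ((n : ℝ) + 1) ^ 2 * ∑ j, ∑ k, Θ n j k X)) := by
      intro j
      rw [mul_left_comm]
      refine mul_le_mul_of_nonneg_left ?_ (hmi j)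
      have h1 : ‖partialDeriv j (g - fun X => (collisionCutoff n X : ℂ) * g X) X‖ ^ 2
          ≤ 2 * ((1 - collisionCutoff n X) ^ 2 * B₂ ^ 2)
            + 2 * ((b / (n + 1) * ∑ k, (X j - X k)⁻¹) ^ 2 * ‖g X‖ ^ 2) := by
        rw [hder]
        have h2 := norm_sub_le (((1 - collisionCutoff n X : ℝ) : ℂ) * partialDeriv j g X)
          (((b / (n + 1) * ∑ k, (X j - X k)⁻¹ : ℝ) : ℂ) * g X)
        have h3 : ‖((1 - collisionCutoff n X : ℝ) : ℂ) * partialDeriv j g X‖ ^ 2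
            ≤ (1 - collisionCutoff n X) ^ 2 * B₂ ^ 2 := by
          rw [norm_mul, mul_pow, Complex.norm_real, Real.norm_eq_abs, sq_abs]
          exact mul_le_mul_of_nonneg_left (pow_le_pow_left₀ (norm_nonneg _) (hB₂ j X) 2)
            (sq_nonneg _)
        have h4 : ‖((b / (n + 1) * ∑ k, (X j - X k)⁻¹ : ℝ) : ℂ) * g X‖ ^ 2
            = (b / (n + 1) * ∑ k, (X j - X k)⁻¹) ^ 2 * ‖g X‖ ^ 2 := by
          rw [norm_mul, mul_pow, Complex.norm_real, Real.norm_eq_abs, sq_abs]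
        rw [← h4]
        refine (pow_le_pow_left₀ (norm_nonneg _) h2 2).trans ((add_sq_le).trans ?_)
        rw [mul_add]
        linarith
      have h5 := mul_le_mul_of_nonneg_left h1 (weight_nonneg (m := m) (κ := κ) X)
      linarith [hsum j]
    rw [Finset.mul_sum]
    refine (Finset.sum_le_sum fun j _ => hj j).trans (le_of_eq ?_)
    rw [← Finset.sum_mul, hK₁, hK₂, ← hσ]
    ring
  have hχ01 : ∀ n (X : Fin N → ℝ), |1 - collisionCutoff n X| ≤ 1 := fun n X => by
    have := collisionCutoff_mem_Icc n X
    rw [abs_le]; constructor <;> linarith [this.1, this.2]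
  have hm1 : ∀ n : ℕ, AEStronglyMeasurable (fun X : Fin N → ℝ => weight m κ X *
      (1 - collisionCutoff n X) ^ 2) volume := fun n =>
    hw.1.mul ((continuous_const.sub (contDiff_collisionCutoff n).continuous).pow
      2).aestronglyMeasurable
  have hb1 : ∀ (n : ℕ) (X : Fin N → ℝ), ‖weight m κ X * (1 - collisionCutoff n X) ^ 2‖
      ≤ weight m κ X := fun n X => by
    rw [norm_mul, Real.norm_of_nonneg (weight_nonneg X), norm_pow, Real.norm_eq_abs]
    exact mul_le_of_le_one_right (weight_nonneg X) (pow_le_one₀ (abs_nonneg _) (hχ01 n X))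
  have hi1 : ∀ n : ℕ, Integrable (fun X : Fin N → ℝ => weight m κ X *
      (1 - collisionCutoff n X) ^ 2) := fun n =>
    hw.mono' (hm1 n) (Eventually.of_forall (hb1 n))
  have hlim1 : Tendsto (fun n : ℕ => ∫ X : Fin N → ℝ, weight m κ X *
      (1 - collisionCutoff n X) ^ 2) atTop (𝓝 0) := by
    have : (0 : ℝ) = ∫ _ : Fin N → ℝ, (0 : ℝ) := by simp
    rw [this]
    refine tendsto_integral_of_dominated_convergence _ hm1 hw
      (fun n => Eventually.of_forall (hb1 n)) ?_
    filter_upwards [ae_mem_configSpace N] with X hX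
    have := (((tendsto_collisionCutoff hX).const_sub 1).pow 2).const_mul (weight m κ X)
    simpa using this
  have hi2 : ∀ n : ℕ, Integrable fun X : Fin N → ℝ => ∑ j, ∑ k, Θ n j k X := fun n =>
    integrable_finsetSum _ fun j _ => integrable_finsetSum _ fun k _ => hΘi n j k
  have hup : ∀ n : ℕ, ∫ X, weight m κ X * ∑ j, 1 / m j *
      ‖partialDeriv j (g - fun X => (collisionCutoff n X : ℂ) * g X) X‖ ^ 2
      ≤ (∫ X : Fin N → ℝ, weight m κ X * (1 - collisionCutoff n X) ^ 2) * K₁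
        + K₂ / ((n : ℝ) + 1) ^ 2 * ∑ _j : Fin N, ∑ _k : Fin N,
          V * (2 * (Real.log (M * P) + ((n : ℝ) + 1))) := by
    intro n
    have hbi := ((hi1 n).mul_const K₁).add ((hi2 n).const_mul (K₂ / ((n : ℝ) + 1) ^ 2))
    refine (integral_mono_of_nonneg (Eventually.of_forall fun X => mul_nonneg (weight_nonneg X)
      (Finset.sum_nonneg fun j _ => mul_nonneg (hmi j) (sq_nonneg _))) hbi ?_).trans ?_
    · filter_upwards [ae_mem_configSpace N] with X hX using hpt n X hX
    · rw [Pi.add_def, integral_add ((hi1 n).mul_const K₁)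
        ((hi2 n).const_mul (K₂ / ((n : ℝ) + 1) ^ 2)), integral_mul_const, integral_const_mul,
        integral_finsetSum _ fun j _ => integrable_finsetSum _ fun k _ => hΘi n j k]
      refine add_le_add le_rfl (mul_le_mul_of_nonneg_left (Finset.sum_le_sum fun j _ => ?_)
        (by positivity))
      rw [integral_finsetSum _ fun k _ => hΘi n j k]
      exact Finset.sum_le_sum fun k _ => hΘint n j k
  refine squeeze_zero (fun n => integral_nonneg fun X => mul_nonneg (weight_nonneg X)
    (Finset.sum_nonneg fun j _ => mul_nonneg (hmi j) (sq_nonneg _))) hup ?_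
  have hinv : Tendsto (fun n : ℕ => ((n : ℝ) + 1)⁻¹) atTop (𝓝 0) :=
    (tendsto_atTop_add_const_right _ _ tendsto_natCast_atTop_atTop).inv_tendsto_atTop
  -- The squared gradient of the cutoff has a factor `(n+1)⁻²` against an integral of order `n+1`.
  have h1 : Tendsto (fun n : ℕ => K₂ * (N * (N * (V * 2))) *
      (Real.log (M * P) * (((n : ℝ) + 1)⁻¹) ^ 2 + ((n : ℝ) + 1)⁻¹)) atTop (𝓝 0) := by
    simpa using (((hinv.pow 2).const_mul (Real.log (M * P))).add hinv).const_mul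
      (K₂ * (N * (N * (V * 2))))
  have h2 := (hlim1.mul_const K₁).add h1
  simp only [zero_mul, add_zero] at h2
  refine h2.congr fun n => ?_
  have hn : (n : ℝ) + 1 ≠ 0 := by positivity
  simp only [Finset.sum_const, Finset.card_univ, Fintype.card_fin, nsmul_eq_mul]
  congr 1
  field_simp

end Capacity

/-! ### The Friedrichs extension from test functions away from collisions. -/

section Friedrichs

variable {N : ℕ} {m : Fin N → ℝ} {κ : ℝ}

/-- If all exponents are at least `1 / 2`, the test functions supported away from the collision
hyperplanes suffice to define the Friedrichs extension. -/
theorem isFriedrichsExtension_testFunctions (hm : ∀ j, 0 < m j)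
    (hα : ∀ j k, j ≠ k → 1 / 2 ≤ κ * m j * m k)
    (hΦ : MemLp (groundStateFun m κ) 2 (volume : Measure (Fin N → ℝ)))
    {T T₀ A : L2 N →ₗ.[ℂ] L2 N}
    (hT : IsRealization (hamiltonian m κ) (initialDomain m κ) T)
    (hT₀ : IsRealization (hamiltonian m κ) (testFunctions N) T₀)
    (hd₀ : Dense (T₀.domain : Set (L2 N))) (hle : T₀ ≤ T) (hA : IsFriedrichsExtension T A) :
    IsFriedrichsExtension T₀ A := by
  have hm' : ∀ j, m j ≠ 0 := fun j => (hm j).ne'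
  refine hA.of_le (hd₀.mono hle.1) (isFormalAdjoint_of_isRealization hm' hΦ hT)
    (isBoundedBelowBy_of_isRealization hm hΦ hT) hd₀ hle fun x => ?_
  obtain ⟨g, hg, hx⟩ := exists_smoothCore_of_mem_domain hT x
  obtain ⟨B, -, hB⟩ := exists_norm_le_of_hasCompactSupport hg.1.continuous hg.2.1
  let G : ℕ → (Fin N → ℝ) → ℂ := fun n X => (collisionCutoff n X : ℂ) * g X
  have hχ : ∀ n (X : Fin N → ℝ), ‖(collisionCutoff n X : ℂ)‖ ≤ 1 := fun n X => by
    rw [Complex.norm_real, Real.norm_of_nonneg (collisionCutoff_mem_Icc n X).1]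
    exact (collisionCutoff_mem_Icc n X).2
  have hGB : ∀ n X, ‖G n X‖ ≤ B := fun n X => by
    rw [norm_mul]
    exact (mul_le_of_le_one_left (norm_nonneg _) (hχ n X)).trans (hB X)
  have hsupp : ∀ n, Function.support (G n) ⊆ Function.support (collisionCutoff n) :=
    fun n X hX h0 => hX (by simp [G, h0])
  have hG : ∀ n, G n ∈ testCore N := fun n =>
    ⟨contDiff_mul_of_tsupport_subset (contDiff_collisionCutoff n)
      (tsupport_collisionCutoff_subset n) hg.1.contDiffOn, hg.2.1.mul_left,
      (closure_mono (hsupp n)).trans (tsupport_collisionCutoff_subset n)⟩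
  have hmem := fun n => memLp_groundStateFun_mul hΦ (hG n).1.continuous.aestronglyMeasurable
    (hGB n)
  have hdom : ∀ n, (hmem n).toLp ∈ T₀.domain := fun n => (hT₀.1 _).2
    ⟨_, (testFunctions_eq m κ).symm ▸ ⟨_, hG n, rfl⟩, (hmem n).coeFn_toLp⟩
  let s : ℕ → T.domain := fun n => ⟨(hmem n).toLp, hle.1 (hdom n)⟩
  have hlim : Tendsto (fun n => (s n : L2 N)) atTop (𝓝 x) := by
    refine tendsto_of_ae_eq_groundStateFun_mul hΦ (g := G) (g₀ := g) (B := B + B)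
      (fun n => (hG n).1.continuous) hg.1.continuous
      (fun n X => (norm_sub_le _ _).trans (add_le_add (hGB n X) (hB X))) (fun X hX => ?_)
      (fun n => (hmem n).coeFn_toLp) hx
    simpa using (tendsto_collisionCutoff hX).ofReal.mul_const (g X)
  refine ⟨s, hdom, hlim, ?_⟩
  have hform : ∀ n, inner ℂ ((x - s n : T.domain) : L2 N) (T (x - s n))
      = ((groundEnergy m κ * ‖(x : L2 N) - s n‖ ^ 2 + ∫ X, weight m κ X *
        ∑ j, 1 / m j * ‖partialDeriv j (g - G n) X‖ ^ 2 : ℝ) : ℂ) := by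
    intro n
    refine inner_self_realization hm' hΦ hT _
      ((smoothCore m).sub_mem hg (testCore_le m (hG n))) ?_
    refine (Lp.coeFn_sub _ _).trans ?_
    rw [mul_sub]
    exact hx.sub (hmem n).coeFn_toLp
  simp only [hform]
  have hN : Tendsto (fun n => ‖(x : L2 N) - s n‖ ^ 2) atTop (𝓝 0) := by
    simpa using ((tendsto_const_nhds (x := (x : L2 N))).sub hlim).norm.pow 2
  have h0 : (0 : ℂ) = ((groundEnergy m κ * 0 + 0 : ℝ) : ℂ) := by simp
  rw [h0]
  exact ((hN.const_mul _).add
    (tendsto_integral_collisionCutoff hm hα hΦ hg.1 hg.2.1)).ofReal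

end Friedrichs

end

end Calogero

/-! ### The main theorem. -/

theorem proposition1 (N : ℕ) (m : Fin N → ℝ) (hm : ∀ j, m j ≠ 0) (κ : ℝ) :
    (ContDiffOn ℝ ∞ (Calogero.groundStateFun m κ) (Calogero.configSpace N) ∧
      ∀ X ∈ Calogero.configSpace N,
        Calogero.hamiltonian m κ (Calogero.groundStateFun m κ) X =
          (Calogero.groundEnergy m κ : ℂ) * Calogero.groundStateFun m κ X) ∧
    ((∀ j, 0 < m j) →
      ∀ hΦ : MemLp (Calogero.groundStateFun m κ) 2 (volume : Measure (Fin N → ℝ)),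
      ∃ T A : Calogero.L2 N →ₗ.[ℂ] Calogero.L2 N,
        -- `T` is the differential operator on its initial domain
        Calogero.IsRealization (Calogero.hamiltonian m κ) (Calogero.initialDomain m κ) T ∧
        Dense (T.domain : Set (Calogero.L2 N)) ∧
        T.IsFormalAdjoint T ∧
        Calogero.IsBoundedBelowBy T (Calogero.groundEnergy m κ) ∧
        -- `A` is its Friedrichs extension
        Calogero.IsFriedrichsExtension T A ∧
        T ≤ A ∧
        IsSelfAdjoint A ∧
        (∀ B : Calogero.L2 N →ₗ.[ℂ] Calogero.L2 N, T ≤ B → IsSelfAdjoint B →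
          (B.domain : Set (Calogero.L2 N)) ⊆ Calogero.formDomain T → B = A) ∧
        Calogero.IsBoundedBelowBy A (Calogero.groundEnergy m κ) ∧
        Calogero.IsGroundState A (Calogero.groundEnergy m κ) (hΦ.toLp) ∧
        -- `A` extends the differential operator on test functions, and is the Friedrichs extension
        -- of that operator when all exponents are at least `1/2`
        (∃ T₀ : Calogero.L2 N →ₗ.[ℂ] Calogero.L2 N,
          Calogero.IsRealization (Calogero.hamiltonian m κ) (Calogero.testFunctions N) T₀ ∧
          T₀ ≤ A ∧
          ((∀ j k, j ≠ k → 1 / 2 ≤ κ * m j * m k) →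
            Calogero.IsFriedrichsExtension T₀ A))) := by
  refine ⟨⟨Calogero.contDiffOn_groundStateFun m κ,
    fun X hX => Calogero.hamiltonian_groundStateFun hm hX⟩, fun hpos hΦ => ?_⟩
  obtain ⟨T, hT'⟩ := Calogero.exists_isRealization_hamiltonian hm hΦ le_rfl
  obtain ⟨T₀, hT₀'⟩ := Calogero.exists_isRealization_hamiltonian hm hΦ (Calogero.testCore_le m)
  have hT : Calogero.IsRealization (Calogero.hamiltonian m κ) (Calogero.initialDomain m κ) T := by
    rw [Calogero.initialDomain_eq]; exact hT'
  have hT₀ : Calogero.IsRealization (Calogero.hamiltonian m κ) (Calogero.testFunctions N) T₀ := by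
    rw [Calogero.testFunctions_eq m κ]; exact hT₀'
  have hle : T₀ ≤ T := hT'.le hT₀' (Set.image_mono (Calogero.testCore_le m))
  have hd₀ := Calogero.dense_domain_of_isRealization hT₀
  have hd : Dense (T.domain : Set (Calogero.L2 N)) := hd₀.mono hle.1
  have hs := Calogero.isFormalAdjoint_of_isRealization hm hΦ hT
  have hc := Calogero.isBoundedBelowBy_of_isRealization hpos hΦ hT
  obtain ⟨A, hA⟩ := Calogero.exists_isFriedrichsExtension hs hc
  have hb := hA.isBoundedBelowBy hd hs hc
  exact ⟨T, A, hT, hd, hs, hc, hA, hA.le hd hs, hA.isSelfAdjoint hd hs hc,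
    fun B hTB hB hBd => hA.eq_of_isSelfAdjoint hd hs hc hTB hB hBd, hb,
    Calogero.isGroundState_toLp_groundStateFun hpos hΦ hT hd hA hb,
    T₀, hT₀, hle.trans (hA.le hd hs), fun hα =>
      Calogero.isFriedrichsExtension_testFunctions hpos hα hΦ hT hT₀ hd₀ hle hA⟩
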